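/- Let $X$ be a smooth 4-manifold with boundary $M=\partial X$, let $g$ be a Riemannian metric on $X$, smooth up to the boundary, with Levi-Civita connection $\nabla$ (a comma denotes $\nabla$: $T_{ij,k}=(\nabla_kT)_{ij}$), and let $n$ be one of the two unit normal fields along $M$ (inward or outward). Write $R_{ijkl}=\langle R(\partial_i,\partial_j)\partial_l,\partial_k\rangle$ with $R(U,V)=\nabla_U\nabla_V-\nabla_V\nabla_U-\nabla_{[U,V]}$ (so $R_{ijij}>0$ on round spheres), $R_{jl}=g^{ik}R_{ijkl}$, $R=g^{jl}R_{jl}$, let $A=\frac12(Ric-\frac R6 g)$ be the Schouten tensor, and let $W$ be the Weyl tensor, $R_{ijkl}=W_{ijkl}+A_{ik}g_{jl}+A_{jl}g_{ik}-A_{il}g_{jk}-A_{jk}g_{il}$. Latin indices run over all directions, Greek indices over directions tangent to $M$, and an index $n$ means contraction with $n$. Let $\hat g$ be the induced metric on $M$, $\hat\nabla$ its Levi-Civita connection (hatted indices denote derivatives by $\hat\nabla$, in the order written: $L_{\gamma\alpha,\hat\beta\hat\delta}=(\hat\nabla_\delta\hat\nabla_\beta L)_{\gamma\alpha}$), $L_{\alpha\beta}=\langle\nabla_\alpha\partial_\beta,n\rangle$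 the second fundamental form, $H=\hat g^{\alpha\beta}L_{\alpha\beta}$ the mean curvature, $\hat\Delta L_{\alpha\beta}=\hat g^{\gamma\delta}L_{\alpha\beta,\hat\gamma\hat\delta}$. On $M$ define $$S_{\alpha\beta}=\nabla^iW_{i\alpha n\beta}+\nabla^iW_{i\beta n\alpha}-\nabla^nW_{n\alpha n\beta}+\tfrac43HW_{n\alpha n\beta}.$$ Then, at every point of $M$: 1. $S$ is a symmetric 2-tensor on $M$: its components transform as those of a covariant 2-tensor under changes of boundary charts, and $S_{\alpha\beta}=S_{\beta\alpha}$. 2. $S$ is trace-free: $\hat g^{\alpha\beta}S_{\alpha\beta}=0$. 3. For every smooth $\varphi:X\to(0,\infty)$, $S(\varphi^2g)=\varphi^{-1}S(g)$, where the same (inward or outward) choice of unit normal is made for both metrics. 4. In every boundary chart (coordinates $x_0\ge0$, $M=\{x_0=0\}$, with tangential coordinates $x_1,x_2,x_3$), in particular in Fermi coordinates, $$\begin{aligned}S_{\alpha\beta}={}&-A_{\alpha n,\beta}+A_{\beta n,\alpha}+A_{\alpha\beta,n}+\hat\Delta L_{\alpha\beta}-L_{\gamma\alpha,\hat\beta\hat\gamma}+L_{\beta\gamma}R_{\gamma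 n\alpha n}\\&-HR_{\alpha n\beta n}+L_{\gamma\delta}R_{\beta\gamma\alpha\delta}-A_{\gamma n,\gamma}g_{\alpha\beta}+\tfrac43HW_{\alpha n\beta n},\end{aligned}$$ where repeated tangential indices are contracted with $\hat g^{-1}$. 5. If the boundary is totally geodesic ($L\equiv0$), then $$S_{\alpha\beta}=A_{\alpha\beta,n}=\tfrac12R_{\alpha\beta,n}-\tfrac{R_{,n}}{12}g_{\alpha\beta}.$$ -/

import Mathlib

open Set Bundle Matrix
open scoped Manifold ContDiff

noncomputable section

namespace BoundaryTensor

/-- The model vector space `ℝ⁴`. -/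
abbrev E4 : Type := EuclideanSpace ℝ (Fin 4)

/-- The closed half-space `{x ∈ ℝ⁴ | 0 ≤ x₀}`, the local model of a 4-manifold with boundary. -/
abbrev H4 : Type := EuclideanHalfSpace 4

/-- Smooth Riemannian metrics (up to the boundary) on a smooth 4-manifold with boundary `X`. -/
abbrev Metric4 (X : Type*) [TopologicalSpace X] [ChartedSpace H4 X] [IsManifold (𝓡∂ 4) ∞ X] :=
  ContMDiffRiemannianMetric (𝓡∂ 4) ∞ E4 (fun x : X => TangentSpace (𝓡∂ 4) x)

section Conformal

variable {X : Type*} [TopologicalSpace X] [ChartedSpace H4 X] [IsManifold (𝓡∂ 4) ∞ X]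

/-- The conformal metric `φ² g`, for a smooth positive function `φ`. -/
def conformal (g : Metric4 X) (φ : X → ℝ) (hφ : ContMDiff (𝓡∂ 4) 𝓘(ℝ, ℝ) ∞ φ)
    (hpos : ∀ x, 0 < φ x) : Metric4 X where
  inner x := (φ x) ^ 2 • g.inner x
  symm x v w := by
    change (φ x) ^ 2 * g.inner x v w = (φ x) ^ 2 * g.inner x w v
    rw [g.symm]
  pos x v hv := by
    change 0 < (φ x) ^ 2 * g.inner x v v
    exact mul_pos (pow_pos (hpos x) 2) (g.pos x v hv)
  isVonNBounded x := by
    have h := (g.isVonNBounded x).image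
      ((φ x)⁻¹ • ContinuousLinearMap.id ℝ (TangentSpace (𝓡∂ 4) x))
    refine h.subset ?_
    intro v hv
    have hne : φ x ≠ 0 := (hpos x).ne'
    refine ⟨φ x • v, ?_, ?_⟩
    · change g.inner x (φ x • v) (φ x • v) < 1
      have hv' : (φ x) ^ 2 * g.inner x v v < 1 := hv
      simp only [map_smul, _root_.smul_apply, smul_eq_mul]
      nlinarith [hv']
    · change (φ x)⁻¹ • (φ x • v) = v
      rw [smul_smul, inv_mul_cancel₀ hne, one_smul]
  contMDiff := by
    have h2 : ContMDiff (𝓡∂ 4) 𝓘(ℝ, ℝ) ∞ (fun x => (φ x) ^ 2) := hφ.pow 2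
    set_option synthInstance.maxHeartbeats 200000 in
    have := ContMDiff.smul_section (F := E4 →L[ℝ] E4 →L[ℝ] ℝ)
      (V := fun x : X => TangentSpace (𝓡∂ 4) x →L[ℝ] TangentSpace (𝓡∂ 4) x →L[ℝ] ℝ)
      h2 g.contMDiff
    exact this

end Conformal

/-! ### Coordinate calculus

Everything below is computed in one chart: fields are functions on `ℝ⁴` (meaningful on the image of
the chart, which is open in the half-space), given by their components. The same formulas serve the
four coordinates `x₀, …, x₃` of `X` and the three tangential coordinates `x₁, x₂, x₃` of `∂X`, so
the coordinate derivations `d i` are a parameter. -/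

/-- The coordinate derivative `∂ᵢ f`, one-sided at the boundary of the half-space. -/
def pd (i : Fin 4) (f : E4 → ℝ) (y : E4) : ℝ :=
  fderivWithin ℝ f (range (𝓡∂ 4)) y (EuclideanSpace.single i 1)

/-- The tangential coordinate derivatives `∂_α`, `α = 1, 2, 3`. -/
def tpd (a : Fin 3) : (E4 → ℝ) → E4 → ℝ := pd a.succ

section Connection

variable {m : ℕ} (d : Fin m → (E4 → ℝ) → E4 → ℝ) (G : E4 → Matrix (Fin m) (Fin m) ℝ)

/-- Christoffel symbols `Γᵏᵢⱼ` of the Levi-Civita connection of the metric `G`. -/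
def christoffel (k i j : Fin m) (y : E4) : ℝ :=
  (1 / 2) * ∑ l, (G y)⁻¹ k l *
    (d i (fun z => G z j l) y + d j (fun z => G z i l) y - d l (fun z => G z i j) y)

/-- `cov2 d G T i j k = T_{ij,k} = (∇_k T)_{ij}`, for a 2-tensor `T`. -/
def cov2 (T : Fin m → Fin m → E4 → ℝ) (i j k : Fin m) (y : E4) : ℝ :=
  d k (T i j) y
    - ∑ p, (christoffel d G p k i y * T p j y + christoffel d G p k j y * T i p y)

/-- `cov3 d G T i j k l = T_{ijk,l} = (∇_l T)_{ijk}`, for a 3-tensor `T`. -/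
def cov3 (T : Fin m → Fin m → Fin m → E4 → ℝ) (i j k l : Fin m) (y : E4) : ℝ :=
  d l (T i j k) y
    - ∑ p, (christoffel d G p l i y * T p j k y + christoffel d G p l j y * T i p k y
        + christoffel d G p l k y * T i j p y)

/-- `cov4 d G T i j k l r = T_{ijkl,r} = (∇_r T)_{ijkl}`, for a 4-tensor `T`. -/
def cov4 (T : Fin m → Fin m → Fin m → Fin m → E4 → ℝ) (i j k l r : Fin m) (y : E4) : ℝ :=
  d r (T i j k l) y
    - ∑ p, (christoffel d G p r i y * T p j k l y + christoffel d G p r j y * T i p k l y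
        + christoffel d G p r k y * T i j p l y + christoffel d G p r l y * T i j k p y)

/-- The curvature tensor `R_{ijkl} = ⟨R(∂ᵢ,∂ⱼ)∂ₗ, ∂ₖ⟩`, with
`R(X,Y) = ∇_X∇_Y - ∇_Y∇_X - ∇_{[X,Y]}`; on the round sphere `R_{ijij} > 0`. -/
def riem (i j k l : Fin m) (y : E4) : ℝ :=
  ∑ r, G y k r *
    (d i (christoffel d G r j l) y - d j (christoffel d G r i l) y
      + ∑ p, (christoffel d G r i p y * christoffel d G p j l y
        - christoffel d G r j p y * christoffel d G p i l y))

/-- The Ricci tensor `R_{jl} = g^{ik} R_{ijkl}`. -/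
def ricci (j l : Fin m) (y : E4) : ℝ :=
  ∑ i, ∑ k, (G y)⁻¹ i k * riem d G i j k l y

/-- The scalar curvature `R = g^{jl} R_{jl}`. -/
def scal (y : E4) : ℝ := ∑ j, ∑ l, (G y)⁻¹ j l * ricci d G j l y

end Connection

section Interior

variable (G : E4 → Matrix (Fin 4) (Fin 4) ℝ)

/-- The Schouten tensor `A = ½ (Ric - (R/6) g)` in dimension four. -/
def schouten (i j : Fin 4) (y : E4) : ℝ :=
  (1 / 2) * (ricci pd G i j y - scal pd G y / 6 * G y i j)

/-- The Weyl tensor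
`W_{ijkl} = R_{ijkl} - A_{ik} g_{jl} - A_{jl} g_{ik} + A_{il} g_{jk} + A_{jk} g_{il}`. -/
def weyl (i j k l : Fin 4) (y : E4) : ℝ :=
  riem pd G i j k l y
    - (schouten G i k y * G y j l + schouten G j l y * G y i k
        - schouten G i l y * G y j k - schouten G j k y * G y i l)

end Interior

section Boundary

variable (s : ℤˣ) (G : E4 → Matrix (Fin 4) (Fin 4) ℝ)

/-- The components `nⁱ = ± g^{0i} / √g^{00}` of the unit normal of the hypersurface `x₀ = 0`,
inward for `s = 1` and outward for `s = -1`. -/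
def normal (i : Fin 4) (y : E4) : ℝ :=
  ((s : ℤ) : ℝ) * (G y)⁻¹ 0 i / Real.sqrt ((G y)⁻¹ 0 0)

/-- The induced metric on the boundary, in the tangential coordinates `x₁, x₂, x₃`. -/
def bmetric (y : E4) : Matrix (Fin 3) (Fin 3) ℝ := (G y).submatrix Fin.succ Fin.succ

/-- The second fundamental form `L_{αβ} = ⟨∇_α ∂_β, n⟩` of the boundary. -/
def secondFF (a b : Fin 3) (y : E4) : ℝ :=
  ∑ i, ∑ j, G y i j * christoffel pd G i a.succ b.succ y * normal s G j y

/-- The mean curvature `H = ĝ^{αβ} L_{αβ}`. -/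
def meanCurv (y : E4) : ℝ :=
  ∑ a, ∑ b, (bmetric G y)⁻¹ a b * secondFF s G a b y

/-- `W_{nαnβ}`. -/
def weylNN (a b : Fin 3) (y : E4) : ℝ :=
  ∑ i, ∑ k, normal s G i y * normal s G k y * weyl G i a.succ k b.succ y

/-- `∇ⁱ W_{iαnβ}`. -/
def divWeyl (a b : Fin 3) (y : E4) : ℝ :=
  ∑ i, ∑ r, ∑ k, (G y)⁻¹ i r * normal s G k y * cov4 pd G (weyl G) i a.succ k b.succ r y

/-- `∇ⁿ W_{nαnβ}`. -/
def normalDerivWeyl (a b : Fin 3) (y : E4) : ℝ :=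
  ∑ i, ∑ k, ∑ r, normal s G i y * normal s G k y * normal s G r y *
    cov4 pd G (weyl G) i a.succ k b.succ r y

/-- The boundary tensor
`S_{αβ} = ∇ⁱ W_{iαnβ} + ∇ⁱ W_{iβnα} - ∇ⁿ W_{nαnβ} + (4/3) H W_{nαnβ}`. -/
def tensorS (a b : Fin 3) (y : E4) : ℝ :=
  divWeyl s G a b y + divWeyl s G b a y - normalDerivWeyl s G a b y
    + (4 / 3) * meanCurv s G y * weylNN s G a b y

/-- `A_{αn,β}`. -/
def dA_tn_t (a b : Fin 3) (y : E4) : ℝ :=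
  ∑ i, normal s G i y * cov2 pd G (schouten G) a.succ i b.succ y

/-- `A_{αβ,n}`. -/
def dA_tt_n (a b : Fin 3) (y : E4) : ℝ :=
  ∑ k, normal s G k y * cov2 pd G (schouten G) a.succ b.succ k y

/-- `R_{αβ,n}`, the normal covariant derivative of the Ricci tensor. -/
def dRic_tt_n (a b : Fin 3) (y : E4) : ℝ :=
  ∑ k, normal s G k y * cov2 pd G (ricci pd G) a.succ b.succ k y

/-- `R_{,n}`, the normal derivative of the scalar curvature. -/
def dScal_n (y : E4) : ℝ := ∑ k, normal s G k y * pd k (scal pd G) y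

/-- `R_{αnβn}` (equal to `R_{nαnβ}`). -/
def riemNN (a b : Fin 3) (y : E4) : ℝ :=
  ∑ j, ∑ l, normal s G j y * normal s G l y * riem pd G a.succ j b.succ l y

/-- `L_{αβ,γ̂}`: the covariant derivative of `L` for the Levi-Civita connection of the boundary. -/
def covL (a b c : Fin 3) (y : E4) : ℝ :=
  cov2 tpd (bmetric G) (secondFF s G) a b c y

/-- `L_{αβ,γ̂δ̂}`: first derivative in `γ`, second in `δ`. -/
def covcovL (a b c e : Fin 3) (y : E4) : ℝ :=
  cov3 tpd (bmetric G) (covL s G) a b c e y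

/-- The right-hand side of the explicit formula for `S_{αβ}`:
`-A_{αn,β} + A_{βn,α} + A_{αβ,n} + Δ̂L_{αβ} - L_{γα,β̂γ̂} + L_{βγ} R_{γnαn} - H R_{αnβn}`
`+ L_{γδ} R_{βγαδ} - A_{γn,γ} g_{αβ} + (4/3) H W_{αnβn}`,
where repeated tangential indices are contracted with the inverse of the boundary metric. In Fermi
coordinates centred at the point, `n = ∂₀` (up to sign) and these contractions are plain sums. -/
def explicitS (a b : Fin 3) (y : E4) : ℝ :=
  - dA_tn_t s G a b y + dA_tn_t s G b a y + dA_tt_n s G a b y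
    + (∑ c, ∑ e, (bmetric G y)⁻¹ c e * covcovL s G a b c e y)
    - (∑ c, ∑ e, (bmetric G y)⁻¹ c e * covcovL s G c a b e y)
    + (∑ c, ∑ e, (bmetric G y)⁻¹ c e * secondFF s G b c y * riemNN s G e a y)
    - meanCurv s G y * riemNN s G a b y
    + (∑ c, ∑ c', ∑ e, ∑ e', (bmetric G y)⁻¹ c c' * (bmetric G y)⁻¹ e e' *
        secondFF s G c e y * riem pd G b.succ c'.succ a.succ e'.succ y)
    - (∑ c, ∑ e, (bmetric G y)⁻¹ c e * dA_tn_t s G c e y) * G y a.succ b.succ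
    + (4 / 3) * meanCurv s G y * weylNN s G a b y

end Boundary

/-! ### Charts of a manifold with boundary

A chart `e` of `X` maps into the half-space, and the boundary points of `X` go to `x₀ = 0`. -/

section Charts

variable {X : Type*} [TopologicalSpace X] [ChartedSpace H4 X] [IsManifold (𝓡∂ 4) ∞ X]

/-- The coordinate vector field `∂ᵢ` of the chart `e`, at the point with coordinates `y`. -/
def coordVec (e : OpenPartialHomeomorph X H4) (i : Fin 4) (y : E4) :
    TangentSpace (𝓡∂ 4) ((e.extend (𝓡∂ 4)).symm y) :=
  mfderivWithin 𝓘(ℝ, E4) (𝓡∂ 4) (e.extend (𝓡∂ 4)).symm (range (𝓡∂ 4)) y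
    (EuclideanSpace.single i 1)

/-- The components `g_{ij} = g(∂ᵢ, ∂ⱼ)` of the metric in the chart `e`. -/
def coeff (g : Metric4 X) (e : OpenPartialHomeomorph X H4) (y : E4) :
    Matrix (Fin 4) (Fin 4) ℝ :=
  Matrix.of fun i j => g.inner ((e.extend (𝓡∂ 4)).symm y) (coordVec e i y) (coordVec e j y)

/-- The Jacobian matrix `∂y'ⁱ/∂yʲ` of the change of coordinates from `e` to `e'`, at the point with
`e`-coordinates `y`. -/
def jac (e e' : OpenPartialHomeomorph X H4) (i j : Fin 4) (y : E4) : ℝ :=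
  pd j (fun z => e'.extend (𝓡∂ 4) ((e.extend (𝓡∂ 4)).symm z) i) y

/-- The components at the boundary point `p` of the boundary tensor `S(g)` in the chart `e`. -/
def S (s : ℤˣ) (g : Metric4 X) (e : OpenPartialHomeomorph X H4) (a b : Fin 3) (p : X) : ℝ :=
  tensorS s (coeff g e) a b (e.extend (𝓡∂ 4) p)

/-- The boundary is totally geodesic: its second fundamental form vanishes identically. -/
def TotallyGeodesicBoundary (s : ℤˣ) (g : Metric4 X) : Prop :=
  ∀ e ∈ IsManifold.maximalAtlas (𝓡∂ 4) ∞ X, ∀ p ∈ e.source, p ∈ (𝓡∂ 4).boundary X →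
    ∀ a b : Fin 3, secondFF s (coeff g e) a b (e.extend (𝓡∂ 4) p) = 0

end Charts

end BoundaryTensor

end

/-! Every claim concerns finitely many derivatives of metric coefficients at a boundary point, so
the calculus is done once, algebraically. Smooth functions near the boundary form a commutative
ℝ-algebra `A`, vector fields form a module `V` over it, and a `LeviCivita` structure records the
metric, its connection and a frame with dual frame. Tensor identities are proved there without
evaluating at points. A `Realization` then carries them to the component formulas of the statement
by evaluation homomorphisms. The unit normal is extended off the boundary as `c • dual 0`, a
multiple of the gradient of x₀ of length one throughout the chart, so identities containing it can
be differentiated. Symmetry comes from the pair symmetry of W and ∇W. For trace-freeness, the full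
trace of W and of ∇W over slots one and three vanishes, and the normal entry of that trace vanishes
by skew-symmetry; so each term of S has zero boundary trace (`sum_tensorS`). For conformal
invariance put u = grad log φ. The weighted divergence of W gains W(u,X,n,Y), with coefficient 4 − 3
= 1; ∇ⁿW(n,X,n,Y) gains W(u,X,n,Y) + W(n,X,u,Y) − 4⟨u,n⟩W(n,X,n,Y); and H gains −3⟨u,n⟩. The factor
4/3 makes the last two cancel (`tensorS_conformal`). For the explicit formula, one divergence of W
is rewritten as the Cotton tensor (`div4_weyl`). The other is split into tangential and normal
parts: the normal part cancels −∇ⁿW_{nαnβ}, and the tangential part is the derivative of the Codazzi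
equation (`cov4_riem_tangential`). If L vanishes on the boundary, the functions vanishing there form
an ideal stable under tangential derivatives, and every term except A_{αβ,n} lies in it
(`tensorS_sub_mem`). For tensoriality, the coordinate fields of a second chart are regarded as
another frame of the same structure. W and its divergence do not depend on the frame. The two
extended normals agree only on the boundary, which suffices because S differentiates n only
tangentially, through H (`tensorS_withFrame`). -/

/-! ### Algebraic Levi-Civita structures. -/

/-- A metric with its Levi-Civita connection on a module `V` of vector fields over a ring `A` of
functions, with a frame `fr` and the dual frame `dual`. -/
structure LeviCivita (ι A V : Type*) [Fintype ι] [DecidableEq ι] [CommRing A] [Algebra ℝ A]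
    [AddCommGroup V] [Module A V] where
  der : V →ₗ[A] Derivation ℝ A A
  met : V →ₗ[A] V →ₗ[A] A
  nab : V →ₗ[A] (V →+ V)
  fr : ι → V
  dual : ι → V
  met_comm : ∀ X Y, met X Y = met Y X
  nab_smul : ∀ X (f : A) Y, nab X (f • Y) = der X f • Y + f • nab X Y
  der_met : ∀ Z X Y, der Z (met X Y) = met (nab Z X) Y + met X (nab Z Y)
  -- The bracket is not a separate datum: it is ∇_X Y − ∇_Y X, so this axiom contains
  -- torsion-freeness. The Jacobi identity is required separately because `der` need not be
  -- injective.
  der_comm : ∀ X Y f, der X (der Y f) - der Y (der X f) = der (nab X Y) f - der (nab Y X) f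
  jacobi : ∀ X Y Z, nab X (nab Y Z - nab Z Y) - nab (nab Y Z - nab Z Y) X
    + (nab Y (nab Z X - nab X Z) - nab (nab Z X - nab X Z) Y)
    + (nab Z (nab X Y - nab Y X) - nab (nab X Y - nab Y X) Z) = 0
  met_fr_dual : ∀ i j, met (fr i) (dual j) = if i = j then 1 else 0
  sum_dual : ∀ X, ∑ i, met X (dual i) • fr i = X

namespace LeviCivita

/-! ### Covariant tensors and traces. -/

section Tensor

variable {A V : Type*} [CommRing A] [AddCommGroup V] [Module A V]

/-- A covariant 4-tensor from a function linear in each argument. -/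
def mkTensor4 (f : V → V → V → V → A)
    (a1 : ∀ X X' Y Z W, f (X + X') Y Z W = f X Y Z W + f X' Y Z W)
    (s1 : ∀ (c : A) X Y Z W, f (c • X) Y Z W = c * f X Y Z W)
    (a2 : ∀ X Y Y' Z W, f X (Y + Y') Z W = f X Y Z W + f X Y' Z W)
    (s2 : ∀ (c : A) X Y Z W, f X (c • Y) Z W = c * f X Y Z W)
    (a3 : ∀ X Y Z Z' W, f X Y (Z + Z') W = f X Y Z W + f X Y Z' W)
    (s3 : ∀ (c : A) X Y Z W, f X Y (c • Z) W = c * f X Y Z W)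
    (a4 : ∀ X Y Z W W', f X Y Z (W + W') = f X Y Z W + f X Y Z W')
    (s4 : ∀ (c : A) X Y Z W, f X Y Z (c • W) = c * f X Y Z W) :
    V →ₗ[A] V →ₗ[A] V →ₗ[A] V →ₗ[A] A :=
  LinearMap.mk₂ A (fun X Y => LinearMap.mk₂ A (fun Z W => f X Y Z W)
      (fun _ _ _ => a3 _ _ _ _ _) (fun _ _ _ => s3 _ _ _ _ _)
      (fun _ _ _ => a4 _ _ _ _ _) (fun _ _ _ => s4 _ _ _ _ _))
    (fun _ _ _ => by ext Z W; exact a1 _ _ _ _ _) (fun _ _ _ => by ext Z W; exact s1 _ _ _ _ _)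
    (fun _ _ _ => by ext Z W; exact a2 _ _ _ _ _) (fun _ _ _ => by ext Z W; exact s2 _ _ _ _ _)

@[simp] theorem mkTensor4_apply (f : V → V → V → V → A) (a1 s1 a2 s2 a3 s3 a4 s4) (X Y Z W : V) :
    mkTensor4 f a1 s1 a2 s2 a3 s3 a4 s4 X Y Z W = f X Y Z W := rfl

/-- The Kulkarni–Nomizu product
`(P ∧ Q)_{ijkl} = P_{ik} Q_{jl} + P_{jl} Q_{ik} - P_{il} Q_{jk} - P_{jk} Q_{il}`. -/
def kulkarniNomizu (P Q : V →ₗ[A] V →ₗ[A] A) : V →ₗ[A] V →ₗ[A] V →ₗ[A] V →ₗ[A] A :=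
  mkTensor4 (fun X Y Z W => P X Z * Q Y W + P Y W * Q X Z - P X W * Q Y Z - P Y Z * Q X W)
    (by intros; simp only [map_add, LinearMap.add_apply]; ring)
    (by intros; simp only [map_smul, LinearMap.smul_apply, smul_eq_mul]; ring)
    (by intros; simp only [map_add, LinearMap.add_apply]; ring)
    (by intros; simp only [map_smul, LinearMap.smul_apply, smul_eq_mul]; ring)
    (by intros; simp only [map_add]; ring)
    (by intros; simp only [map_smul, smul_eq_mul]; ring)
    (by intros; simp only [map_add]; ring)
    (by intros; simp only [map_smul, smul_eq_mul]; ring)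

@[simp] theorem kulkarniNomizu_apply (P Q : V →ₗ[A] V →ₗ[A] A) (X Y Z W : V) :
    kulkarniNomizu P Q X Y Z W =
      P X Z * Q Y W + P Y W * Q X Z - P X W * Q Y Z - P Y Z * Q X W := rfl

/-- The form `(P, Q) ↦ T(P, X, Q, Y)`. -/
def slot13 (T : V →ₗ[A] V →ₗ[A] V →ₗ[A] V →ₗ[A] A) (X Y : V) : V →ₗ[A] V →ₗ[A] A :=
  LinearMap.mk₂ A (fun P Q => T P X Q Y) (by intros; simp) (by intros; simp) (by intros; simp)
    (by intros; simp)

@[simp] theorem slot13_apply (T : V →ₗ[A] V →ₗ[A] V →ₗ[A] V →ₗ[A] A) (X Y P Q : V) :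
    slot13 T X Y P Q = T P X Q Y := rfl

/-- The trace of a bilinear form is the same in any two frames. -/
theorem trace_eq_trace {ι κ : Type*} [Fintype ι] [Fintype κ] (B : V →ₗ[A] V →ₗ[A] A)
    (β : V →ₗ[A] V →ₗ[A] A) (hB : ∀ X Y, B X Y = B Y X) {E F : ι → V} {E' F' : κ → V}
    (h' : ∀ X, ∑ j, B X (F' j) • E' j = X) (h : ∀ X, ∑ i, B X (E i) • F i = X) :
    ∑ i, β (E i) (F i) = ∑ j, β (E' j) (F' j) := by
  calc ∑ i, β (E i) (F i) = ∑ i, ∑ j, B (E i) (F' j) * β (E' j) (F i) := by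
        refine Finset.sum_congr rfl fun i _ => ?_
        conv_lhs => rw [← h' (E i)]
        simp [LinearMap.sum_apply]
    _ = ∑ j, β (E' j) (F' j) := by
        rw [Finset.sum_comm]
        refine Finset.sum_congr rfl fun j _ => ?_
        conv_rhs => rw [← h (F' j)]
        simp [hB]

end Tensor

variable {ι A V : Type*} [Fintype ι] [DecidableEq ι] [CommRing A] [Algebra ℝ A]
  [AddCommGroup V] [Module A V] (𝒢 : LeviCivita ι A V)

/-! ### Frames, dual frames and nondegeneracy. -/

section Frame

/-- `sum_dual` makes the metric nondegenerate, since a vector is recovered from its products with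
the dual frame. The two frames may therefore exchange roles. -/
theorem sum_fr (X : V) : ∑ i, 𝒢.met X (𝒢.fr i) • 𝒢.dual i = X := by
  have h : ∀ Z, (∀ Y, 𝒢.met Z Y = 0) → Z = 0 := by
    intro Z hZ
    rw [← 𝒢.sum_dual Z]
    simp [hZ]
  rw [← sub_eq_zero]
  apply h
  intro Y
  conv_lhs => rw [← 𝒢.sum_dual Y]
  simp [𝒢.met_comm (𝒢.dual _), 𝒢.met_fr_dual, LinearMap.sub_apply]

theorem met_ext {X Y : V} (h : ∀ i, 𝒢.met X (𝒢.fr i) = 𝒢.met Y (𝒢.fr i)) : X = Y := by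
  rw [← 𝒢.sum_fr X, ← 𝒢.sum_fr Y]
  simp [h]

theorem trace_symm (β : V →ₗ[A] V →ₗ[A] A) :
    ∑ i, β (𝒢.fr i) (𝒢.dual i) = ∑ i, β (𝒢.dual i) (𝒢.fr i) :=
  trace_eq_trace 𝒢.met β 𝒢.met_comm 𝒢.sum_fr 𝒢.sum_fr

/-- The frame tensor `∑ fr i ⊗ dual i` is parallel. -/
theorem sum_nab_fr (β : V →ₗ[A] V →ₗ[A] A) (Z : V) :
    ∑ i, (β (𝒢.nab Z (𝒢.fr i)) (𝒢.dual i) + β (𝒢.fr i) (𝒢.nab Z (𝒢.dual i))) = 0 := by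
  have h1 : ∀ i, β (𝒢.nab Z (𝒢.fr i)) (𝒢.dual i) =
      ∑ j, 𝒢.met (𝒢.nab Z (𝒢.fr i)) (𝒢.dual j) * β (𝒢.fr j) (𝒢.dual i) := by
    intro i
    conv_lhs => rw [← 𝒢.sum_dual (𝒢.nab Z (𝒢.fr i))]
    simp [LinearMap.sum_apply]
  have h2 : ∀ i, β (𝒢.fr i) (𝒢.nab Z (𝒢.dual i)) =
      ∑ j, 𝒢.met (𝒢.nab Z (𝒢.dual i)) (𝒢.fr j) * β (𝒢.fr i) (𝒢.dual j) := by
    intro i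
    conv_lhs => rw [← 𝒢.sum_fr (𝒢.nab Z (𝒢.dual i))]
    simp
  simp_rw [Finset.sum_add_distrib, h1, h2]
  rw [Finset.sum_comm, ← Finset.sum_add_distrib]
  refine Finset.sum_eq_zero fun i _ => ?_
  rw [← Finset.sum_add_distrib]
  refine Finset.sum_eq_zero fun j _ => ?_
  -- The products ⟨fr j, dual i⟩ are the constants 0 and 1, so the coefficients of ∇fr and ∇dual are
  -- opposite.
  have h3 := 𝒢.der_met Z (𝒢.fr j) (𝒢.dual i)
  rw [𝒢.met_fr_dual] at h3
  have h4 : 𝒢.der Z (if j = i then (1 : A) else 0) = 0 := by split_ifs <;> simp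
  rw [h4, 𝒢.met_comm (𝒢.fr j)] at h3
  linear_combination (-β (𝒢.fr i) (𝒢.dual j)) * h3

end Frame

/-! ### Covariant derivatives of tensors. -/

section Derivative

theorem der_sum_apply {κ : Type*} (s : Finset κ) (Y : κ → V) (f : A) :
    𝒢.der (∑ i ∈ s, Y i) f = ∑ i ∈ s, 𝒢.der (Y i) f := by
  induction s using Finset.cons_induction with
  | empty => simp
  | cons a s ha ih => rw [Finset.sum_cons, Finset.sum_cons, map_add, Derivation.add_apply, ih]

/-- The covariant derivative `∇_Z T` of a covariant 2-tensor. -/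
def cov2 (T : V →ₗ[A] V →ₗ[A] A) (Z : V) : V →ₗ[A] V →ₗ[A] A :=
  LinearMap.mk₂ A (fun X Y => 𝒢.der Z (T X Y) - T (𝒢.nab Z X) Y - T X (𝒢.nab Z Y))
    (by intros; simp only [map_add, LinearMap.add_apply]; ring)
    (by
      intros
      simp only [map_smul, LinearMap.smul_apply, smul_eq_mul, 𝒢.nab_smul, map_add,
        LinearMap.add_apply, Derivation.leibniz]
      ring)
    (by intros; simp only [map_add]; ring)
    (by
      intros
      simp only [map_smul, smul_eq_mul, 𝒢.nab_smul, map_add,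
        Derivation.leibniz]
      ring)

@[simp] theorem cov2_apply (T : V →ₗ[A] V →ₗ[A] A) (Z X Y : V) :
    𝒢.cov2 T Z X Y = 𝒢.der Z (T X Y) - T (𝒢.nab Z X) Y - T X (𝒢.nab Z Y) := rfl

/-- The covariant derivative `∇_Z T` of a covariant 4-tensor. -/
def cov4 (T : V →ₗ[A] V →ₗ[A] V →ₗ[A] V →ₗ[A] A) (Z : V) :
    V →ₗ[A] V →ₗ[A] V →ₗ[A] V →ₗ[A] A :=
  mkTensor4 (fun X Y P Q => 𝒢.der Z (T X Y P Q) - T (𝒢.nab Z X) Y P Q - T X (𝒢.nab Z Y) P Q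
      - T X Y (𝒢.nab Z P) Q - T X Y P (𝒢.nab Z Q))
    (by intros; simp only [map_add, LinearMap.add_apply]; ring)
    (by
      intros
      simp only [map_smul, LinearMap.smul_apply, smul_eq_mul, 𝒢.nab_smul, map_add,
        LinearMap.add_apply, Derivation.leibniz]
      ring)
    (by intros; simp only [map_add, LinearMap.add_apply]; ring)
    (by
      intros
      simp only [map_smul, LinearMap.smul_apply, smul_eq_mul, 𝒢.nab_smul, map_add,
        LinearMap.add_apply, Derivation.leibniz]
      ring)
    (by intros; simp only [map_add, LinearMap.add_apply]; ring)
    (by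
      intros
      simp only [map_smul, LinearMap.smul_apply, smul_eq_mul, 𝒢.nab_smul, map_add,
        LinearMap.add_apply, Derivation.leibniz]
      ring)
    (by intros; simp only [map_add]; ring)
    (by
      intros
      simp only [map_smul, smul_eq_mul, 𝒢.nab_smul, map_add, Derivation.leibniz]
      ring)

@[simp] theorem cov4_apply (T : V →ₗ[A] V →ₗ[A] V →ₗ[A] V →ₗ[A] A) (Z X Y P Q : V) :
    𝒢.cov4 T Z X Y P Q = 𝒢.der Z (T X Y P Q) - T (𝒢.nab Z X) Y P Q - T X (𝒢.nab Z Y) P Q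
      - T X Y (𝒢.nab Z P) Q - T X Y P (𝒢.nab Z Q) := rfl

theorem cov4_add (T : V →ₗ[A] V →ₗ[A] V →ₗ[A] V →ₗ[A] A) (Z Z' X Y P Q : V) :
    𝒢.cov4 T (Z + Z') X Y P Q = 𝒢.cov4 T Z X Y P Q + 𝒢.cov4 T Z' X Y P Q := by
  simp only [cov4_apply, map_add, LinearMap.add_apply, Derivation.add_apply,
    AddMonoidHom.add_apply]
  ring

theorem cov4_smul (T : V →ₗ[A] V →ₗ[A] V →ₗ[A] V →ₗ[A] A) (c : A) (Z X Y P Q : V) :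
    𝒢.cov4 T (c • Z) X Y P Q = c * 𝒢.cov4 T Z X Y P Q := by
  simp only [cov4_apply, map_smul, LinearMap.smul_apply, Derivation.smul_apply,
    AddMonoidHom.smul_apply, smul_eq_mul]
  ring

theorem cov4_swap {T : V →ₗ[A] V →ₗ[A] V →ₗ[A] V →ₗ[A] A}
    (h : ∀ X Y Z W, T Y X Z W = -T X Y Z W) (U X Y Z W : V) :
    𝒢.cov4 T U Y X Z W = -𝒢.cov4 T U X Y Z W := by
  simp only [cov4_apply, h X Y, h X (𝒢.nab U Y), h (𝒢.nab U X) Y, map_neg]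
  ring

theorem cov4_swap_right {T : V →ₗ[A] V →ₗ[A] V →ₗ[A] V →ₗ[A] A}
    (h : ∀ X Y Z W, T X Y W Z = -T X Y Z W) (U X Y Z W : V) :
    𝒢.cov4 T U X Y W Z = -𝒢.cov4 T U X Y Z W := by
  simp only [cov4_apply, h _ _ Z W, h _ _ Z (𝒢.nab U W), h _ _ (𝒢.nab U Z) W, map_neg]
  ring

theorem cov4_pair {T : V →ₗ[A] V →ₗ[A] V →ₗ[A] V →ₗ[A] A}
    (h : ∀ X Y Z W, T X Y Z W = T Z W X Y) (U X Y Z W : V) :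
    𝒢.cov4 T U X Y Z W = 𝒢.cov4 T U Z W X Y := by
  rw [cov4_apply, cov4_apply, h X, h _ Y, h X, h X, h X]
  ring

/-- `∇T` with the direction of differentiation and the first argument free. -/
def divForm (T : V →ₗ[A] V →ₗ[A] V →ₗ[A] V →ₗ[A] A) (X Y Z : V) : V →ₗ[A] V →ₗ[A] A :=
  LinearMap.mk₂ A (fun P Q => 𝒢.cov4 T Q P X Y Z)
    (by intros; simp only [map_add, LinearMap.add_apply])
    (by intros; simp only [map_smul, LinearMap.smul_apply])
    (by intros; rw [cov4_add]) (by intros; rw [cov4_smul, smul_eq_mul])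

@[simp] theorem divForm_apply (T : V →ₗ[A] V →ₗ[A] V →ₗ[A] V →ₗ[A] A) (X Y Z P Q : V) :
    𝒢.divForm T X Y Z P Q = 𝒢.cov4 T Q P X Y Z := rfl

/-- The covariant derivative commutes with the trace in the first and third arguments. -/
theorem sum_cov4 (T : V →ₗ[A] V →ₗ[A] V →ₗ[A] V →ₗ[A] A) (Z X Y : V) :
    ∑ i, 𝒢.cov4 T Z (𝒢.fr i) X (𝒢.dual i) Y =
      𝒢.der Z (∑ i, T (𝒢.fr i) X (𝒢.dual i) Y)
        - (∑ i, T (𝒢.fr i) (𝒢.nab Z X) (𝒢.dual i) Y)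
        - ∑ i, T (𝒢.fr i) X (𝒢.dual i) (𝒢.nab Z Y) := by
  have h := 𝒢.sum_nab_fr (slot13 T X Y) Z
  simp only [slot13_apply] at h
  simp only [cov4_apply, map_sum, ← Finset.sum_sub_distrib]
  rw [← sub_eq_zero, ← Finset.sum_sub_distrib, ← neg_eq_zero, ← Finset.sum_neg_distrib, ← h]
  exact Finset.sum_congr rfl fun i _ => by ring

end Derivative

/-! ### Curvature symmetries, Bianchi identities, Schouten and Weyl tensors. -/

section Curvature

/-- The curvature operator `R(X, Y) Z`. -/
def curv (X Y Z : V) : V :=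
  𝒢.nab X (𝒢.nab Y Z) - 𝒢.nab Y (𝒢.nab X Z) - 𝒢.nab (𝒢.nab X Y - 𝒢.nab Y X) Z

theorem curv_smul_right (f : A) (X Y Z : V) : 𝒢.curv X Y (f • Z) = f • 𝒢.curv X Y Z := by
  have h := 𝒢.der_comm X Y f
  have h' : 𝒢.der X (𝒢.der Y f) =
      𝒢.der Y (𝒢.der X f) + (𝒢.der (𝒢.nab X Y) f - 𝒢.der (𝒢.nab Y X) f) := by
    rw [← h]; ring
  simp only [curv, nab_smul, map_add, map_sub, AddMonoidHom.sub_apply, h']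
  module

/-- The curvature tensor `⟨R(X, Y) W, Z⟩`. -/
def riem : V →ₗ[A] V →ₗ[A] V →ₗ[A] V →ₗ[A] A :=
  mkTensor4 (fun X Y Z W => 𝒢.met (𝒢.curv X Y W) Z)
    (by
      intros
      simp only [curv, map_add, map_sub, LinearMap.add_apply, LinearMap.sub_apply,
        AddMonoidHom.add_apply, AddMonoidHom.sub_apply]
      ring)
    (by
      intros
      simp only [curv, map_add, map_sub, map_smul, LinearMap.add_apply, LinearMap.sub_apply,
        AddMonoidHom.sub_apply, AddMonoidHom.smul_apply, nab_smul, LinearMap.smul_apply,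
        smul_eq_mul, AddMonoidHom.add_apply]
      ring)
    (by
      intros
      simp only [curv, map_add, map_sub, LinearMap.add_apply, LinearMap.sub_apply,
        AddMonoidHom.add_apply, AddMonoidHom.sub_apply]
      ring)
    (by
      intros
      simp only [curv, map_add, map_sub, map_smul, LinearMap.add_apply, LinearMap.sub_apply,
        AddMonoidHom.sub_apply, AddMonoidHom.smul_apply, nab_smul, LinearMap.smul_apply,
        smul_eq_mul, AddMonoidHom.add_apply]
      ring)
    (by intros; simp only [map_add])
    (by intros; simp only [map_smul, smul_eq_mul])
    (by
      intros
      simp only [curv, map_add, map_sub, LinearMap.add_apply, LinearMap.sub_apply]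
      ring)
    (by intros; rw [curv_smul_right, map_smul, LinearMap.smul_apply, smul_eq_mul])

theorem riem_apply (X Y Z W : V) : 𝒢.riem X Y Z W = 𝒢.met (𝒢.curv X Y W) Z := rfl

theorem riem_swap (X Y Z W : V) : 𝒢.riem Y X Z W = -𝒢.riem X Y Z W := by
  simp only [riem_apply, curv, map_sub, LinearMap.sub_apply, AddMonoidHom.sub_apply]
  ring

theorem riem_bianchi (X Y Z W : V) : 𝒢.riem X Y W Z + 𝒢.riem Y Z W X + 𝒢.riem Z X W Y = 0 := by
  have h := congrArg (fun P => 𝒢.met P W) (𝒢.jacobi X Y Z)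
  simp only [map_sub, map_add, LinearMap.add_apply, LinearMap.sub_apply, AddMonoidHom.sub_apply,
    map_zero, LinearMap.zero_apply] at h
  simp only [riem_apply, curv, map_sub, LinearMap.sub_apply, AddMonoidHom.sub_apply]
  linear_combination h

theorem riem_swap_right (X Y Z W : V) : 𝒢.riem X Y W Z = -𝒢.riem X Y Z W := by
  have h := 𝒢.der_comm X Y (𝒢.met Z W)
  simp only [der_met, map_add] at h
  simp only [riem_apply, curv, map_sub, LinearMap.sub_apply, AddMonoidHom.sub_apply]
  rw [𝒢.met_comm _ Z, 𝒢.met_comm _ Z, 𝒢.met_comm _ Z, 𝒢.met_comm _ Z]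
  linear_combination h

/-- The octahedron argument: in a signed sum of the four cyclic identities on X, Y, Z, W everything
cancels except twice the desired difference; `c` plays the role of one half. -/
theorem pair_symm_of_bianchi (T : V → V → V → V → A) {c : A} (hc : 2 * c = 1)
    (h1 : ∀ X Y Z W, T Y X Z W = -T X Y Z W)
    (h2 : ∀ X Y Z W, T X Y W Z = -T X Y Z W)
    (h3 : ∀ X Y Z W, T X Y W Z + T Y Z W X + T Z X W Y = 0) (X Y Z W : V) :
    T X Y Z W = T Z W X Y := by
  have e1 := h3 X Y Z W
  have e2 := h3 Y Z W X
  have e3 := h3 Z W X Y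
  have e4 := h3 W X Y Z
  have h : 2 * T X Y Z W = 2 * T Z W X Y := by
    linear_combination -e1 - e2 + e3 + e4 + h2 X Y Z W + h2 Y Z X W + h2 Z X Y W + h1 Y W X Z
      - h2 Y W Z X - h2 Z W X Y - h1 Z X Y W - h2 W X Y Z
  linear_combination c * h + (T Z W X Y - T X Y Z W) * hc

/-- The scalar `1/12`. -/
noncomputable def twelfth (A : Type*) [CommRing A] [Algebra ℝ A] : A := algebraMap ℝ A (1 / 12)

/-- One constant supplies all fractions: 6/12 = 1/2 for the Schouten tensor and 16/12 = 4/3 in S. It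
is an atom for `ring`, so this relation is added by hand in each `linear_combination` that needs it.
-/
theorem twelfth_spec (A : Type*) [CommRing A] [Algebra ℝ A] : 12 * twelfth A = 1 := by
  have h : (12 : A) = algebraMap ℝ A 12 := (map_ofNat _ 12).symm
  rw [twelfth, h, ← map_mul]
  norm_num

theorem der_twelfth (X : V) : 𝒢.der X (twelfth A) = 0 := Derivation.map_algebraMap _ _

theorem riem_pair (X Y Z W : V) : 𝒢.riem X Y Z W = 𝒢.riem Z W X Y :=
  pair_symm_of_bianchi (fun X Y Z W => 𝒢.riem X Y Z W) (c := 6 * twelfth A)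
    (by linear_combination twelfth_spec A) 𝒢.riem_swap 𝒢.riem_swap_right 𝒢.riem_bianchi X Y Z W

/-- The second Bianchi identity. -/
theorem cov4_riem_bianchi (X Y Z P Q : V) :
    𝒢.cov4 𝒢.riem X Y Z P Q + 𝒢.cov4 𝒢.riem Y Z X P Q + 𝒢.cov4 𝒢.riem Z X Y P Q = 0 := by
  have h := congrArg (fun W => 𝒢.met (𝒢.nab W Q) P) (𝒢.jacobi X Y Z)
  simp only [map_sub, map_add, LinearMap.add_apply, LinearMap.sub_apply, AddMonoidHom.sub_apply,
    AddMonoidHom.add_apply, map_zero, LinearMap.zero_apply, AddMonoidHom.zero_apply] at h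
  simp only [cov4_apply, riem_apply, der_met, curv, map_sub, LinearMap.sub_apply,
    AddMonoidHom.sub_apply]
  linear_combination -h

/-- The Ricci form of a curvature-like tensor: the trace in the first and third arguments. -/
def trace13 (T : V →ₗ[A] V →ₗ[A] V →ₗ[A] V →ₗ[A] A) : V →ₗ[A] V →ₗ[A] A :=
  LinearMap.mk₂ A (fun X Y => ∑ i, T (𝒢.fr i) X (𝒢.dual i) Y)
    (by intros; simp [Finset.sum_add_distrib]) (by intros; simp [Finset.mul_sum])
    (by intros; simp [Finset.sum_add_distrib]) (by intros; simp [Finset.mul_sum])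

theorem trace13_apply (T : V →ₗ[A] V →ₗ[A] V →ₗ[A] V →ₗ[A] A) (X Y : V) :
    𝒢.trace13 T X Y = ∑ i, T (𝒢.fr i) X (𝒢.dual i) Y := rfl

theorem cov2_trace13 (T : V →ₗ[A] V →ₗ[A] V →ₗ[A] V →ₗ[A] A) (Z X Y : V) :
    𝒢.cov2 (𝒢.trace13 T) Z X Y = ∑ i, 𝒢.cov4 T Z (𝒢.fr i) X (𝒢.dual i) Y := by
  rw [sum_cov4]; rfl

def ric : V →ₗ[A] V →ₗ[A] A := 𝒢.trace13 𝒢.riem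

def scal : A := ∑ i, 𝒢.ric (𝒢.fr i) (𝒢.dual i)

theorem ric_symm (X Y : V) : 𝒢.ric X Y = 𝒢.ric Y X := by
  have h := 𝒢.trace_symm (slot13 𝒢.riem X Y)
  simp only [slot13_apply] at h
  rw [ric, trace13_apply, trace13_apply, h]
  exact Finset.sum_congr rfl fun i _ => 𝒢.riem_pair _ _ _ _

/-- The Schouten tensor `½ (Ric - (R/6) g)`. -/
noncomputable def sch : V →ₗ[A] V →ₗ[A] A :=
  (6 * twelfth A) • 𝒢.ric - (twelfth A * 𝒢.scal) • 𝒢.met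

theorem sch_apply (X Y : V) :
    𝒢.sch X Y = 6 * twelfth A * 𝒢.ric X Y - twelfth A * 𝒢.scal * 𝒢.met X Y := rfl

theorem sch_symm (X Y : V) : 𝒢.sch X Y = 𝒢.sch Y X := by
  rw [sch_apply, sch_apply, ric_symm, met_comm]

/-- The Weyl tensor. -/
noncomputable def weyl : V →ₗ[A] V →ₗ[A] V →ₗ[A] V →ₗ[A] A :=
  mkTensor4 (fun X Y Z W => 𝒢.riem X Y Z W - kulkarniNomizu 𝒢.sch 𝒢.met X Y Z W)
    (by intros; simp only [map_add, LinearMap.add_apply]; ring)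
    (by intros; simp only [map_smul, LinearMap.smul_apply, smul_eq_mul]; ring)
    (by intros; simp only [map_add, LinearMap.add_apply]; ring)
    (by intros; simp only [map_smul, LinearMap.smul_apply, smul_eq_mul]; ring)
    (by intros; simp only [map_add, LinearMap.add_apply]; ring)
    (by intros; simp only [map_smul, LinearMap.smul_apply, smul_eq_mul]; ring)
    (by intros; simp only [map_add]; ring)
    (by intros; simp only [map_smul, smul_eq_mul]; ring)

theorem weyl_apply (X Y Z W : V) : 𝒢.weyl X Y Z W = 𝒢.riem X Y Z W
    - (𝒢.sch X Z * 𝒢.met Y W + 𝒢.sch Y W * 𝒢.met X Z - 𝒢.sch X W * 𝒢.met Y Z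
      - 𝒢.sch Y Z * 𝒢.met X W) := rfl

theorem weyl_swap (X Y Z W : V) : 𝒢.weyl Y X Z W = -𝒢.weyl X Y Z W := by
  rw [weyl_apply, weyl_apply, riem_swap]; ring

theorem weyl_swap_right (X Y Z W : V) : 𝒢.weyl X Y W Z = -𝒢.weyl X Y Z W := by
  rw [weyl_apply, weyl_apply, riem_swap_right]; ring

theorem weyl_pair (X Y Z W : V) : 𝒢.weyl X Y Z W = 𝒢.weyl Z W X Y := by
  rw [weyl_apply, weyl_apply, riem_pair, 𝒢.sch_symm X Z, 𝒢.sch_symm Y W, 𝒢.sch_symm X W,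
    𝒢.sch_symm Y Z, 𝒢.met_comm X Z, 𝒢.met_comm Y W, 𝒢.met_comm X W, 𝒢.met_comm Y Z]
  ring

theorem weyl_bianchi (X Y Z W : V) : 𝒢.weyl X Y W Z + 𝒢.weyl Y Z W X + 𝒢.weyl Z X W Y = 0 := by
  simp only [weyl_apply, 𝒢.sch_symm Y X, 𝒢.sch_symm Z X, 𝒢.sch_symm Z Y, 𝒢.met_comm Y X,
    𝒢.met_comm Z X, 𝒢.met_comm Z Y]
  linear_combination 𝒢.riem_bianchi X Y Z W

end Curvature

/-! ### Contractions in dimension four. -/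

section Dimension

variable (𝒢 : LeviCivita (Fin 4) A V)

theorem sum_met_fr_dual : ∑ i, 𝒢.met (𝒢.fr i) (𝒢.dual i) = 4 := by
  simp [met_fr_dual]

theorem sum_met_mul (P : V →ₗ[A] V →ₗ[A] A) (X Y : V) :
    ∑ i, 𝒢.met X (𝒢.dual i) * P (𝒢.fr i) Y = P X Y := by
  conv_rhs => rw [← 𝒢.sum_dual X]
  simp [LinearMap.sum_apply]

theorem sum_met_mul' (P : V →ₗ[A] V →ₗ[A] A) (X Y : V) :
    ∑ i, 𝒢.met (𝒢.fr i) Y * P X (𝒢.dual i) = P X Y := by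
  conv_rhs => rw [← 𝒢.sum_fr Y]
  simp [𝒢.met_comm Y]

/-- In dimension m the coefficient of P would be m − 2. The value 2 is what fixes the factor ½ of
the Schouten tensor. -/
theorem trace13_kulkarniNomizu (P : V →ₗ[A] V →ₗ[A] A) (X Y : V) :
    𝒢.trace13 (kulkarniNomizu P 𝒢.met) X Y =
      (∑ i, P (𝒢.fr i) (𝒢.dual i)) * 𝒢.met X Y + 2 * P X Y := by
  have h1 := 𝒢.sum_met_mul P X Y
  have h2 := 𝒢.sum_met_mul' P X Y
  have h3 := 𝒢.sum_met_fr_dual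
  have h : 𝒢.trace13 (kulkarniNomizu P 𝒢.met) X Y =
      (∑ i, P (𝒢.fr i) (𝒢.dual i)) * 𝒢.met X Y + P X Y * (∑ i, 𝒢.met (𝒢.fr i) (𝒢.dual i))
       - (∑ i, 𝒢.met X (𝒢.dual i) * P (𝒢.fr i) Y)
       - ∑ i, 𝒢.met (𝒢.fr i) Y * P X (𝒢.dual i) := by
    rw [trace13_apply, Finset.sum_mul, Finset.mul_sum, ← Finset.sum_add_distrib,
      ← Finset.sum_sub_distrib, ← Finset.sum_sub_distrib]
    exact Finset.sum_congr rfl fun i _ => by rw [kulkarniNomizu_apply]; ring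
  rw [h, h1, h2, h3]
  ring

/-- A decomposition of the curvature as a trace-free tensor plus `P ∧ g` forces `P` to be the
Schouten tensor. -/
theorem sch_eq_of_riem_eq (K : V →ₗ[A] V →ₗ[A] V →ₗ[A] V →ₗ[A] A) (P : V →ₗ[A] V →ₗ[A] A)
    (hK : ∀ X Y, 𝒢.trace13 K X Y = 0)
    (h : ∀ X Y Z W, 𝒢.riem X Y Z W = K X Y Z W + kulkarniNomizu P 𝒢.met X Y Z W) :
    𝒢.sch = P := by
  have hr : ∀ X Y, 𝒢.ric X Y = (∑ i, P (𝒢.fr i) (𝒢.dual i)) * 𝒢.met X Y + 2 * P X Y := by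
    intro X Y
    rw [← trace13_kulkarniNomizu, ric, ← zero_add (𝒢.trace13 (kulkarniNomizu P 𝒢.met) X Y),
      ← hK X Y]
    simp only [trace13_apply, h, Finset.sum_add_distrib]
  have hs : 𝒢.scal = 6 * ∑ i, P (𝒢.fr i) (𝒢.dual i) := by
    rw [scal]
    simp only [hr, Finset.sum_add_distrib, ← Finset.mul_sum, sum_met_fr_dual]
    ring
  ext X Y
  rw [sch_apply, hr, hs]
  linear_combination P X Y * twelfth_spec A

theorem trace13_weyl (X Y : V) : 𝒢.trace13 𝒢.weyl X Y = 0 := by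
  have h := 𝒢.trace13_kulkarniNomizu 𝒢.sch X Y
  have h' : 𝒢.trace13 𝒢.weyl X Y =
      𝒢.ric X Y - 𝒢.trace13 (kulkarniNomizu 𝒢.sch 𝒢.met) X Y := by
    simp only [ric, weyl, trace13_apply, mkTensor4_apply, Finset.sum_sub_distrib]
  have hs : ∑ i, 𝒢.sch (𝒢.fr i) (𝒢.dual i) = 2 * twelfth A * 𝒢.scal := by
    simp only [sch_apply, Finset.sum_sub_distrib, ← Finset.mul_sum, sum_met_fr_dual]
    rw [← scal]
    ring
  rw [h', h, hs, sch_apply]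
  linear_combination (-𝒢.ric X Y) * twelfth_spec A

/-- The divergence `∇ⁱ T_{i X Y Z}`. -/
def div4 {ι : Type*} [Fintype ι] [DecidableEq ι] (𝒢 : LeviCivita ι A V)
    (T : V →ₗ[A] V →ₗ[A] V →ₗ[A] V →ₗ[A] A) (X Y Z : V) : A :=
  ∑ i, 𝒢.cov4 T (𝒢.dual i) (𝒢.fr i) X Y Z

theorem sum_cov4_weyl (Z X Y : V) : ∑ i, 𝒢.cov4 𝒢.weyl Z (𝒢.fr i) X (𝒢.dual i) Y = 0 := by
  rw [sum_cov4]
  simp only [← trace13_apply, trace13_weyl, map_zero, sub_zero]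

/-- A trace of the second Bianchi identity. The pair symmetry first moves the contracted slot into
the second pair, so that the direction of differentiation can be rotated with the other two slots.
-/
theorem div4_riem (X Y Z : V) :
    𝒢.div4 𝒢.riem X Y Z = 𝒢.cov2 𝒢.ric Y X Z - 𝒢.cov2 𝒢.ric Z X Y := by
  have hsym : ∀ U P Q, 𝒢.cov2 𝒢.ric U P Q = 𝒢.cov2 𝒢.ric U Q P := by
    intro U P Q
    simp only [cov2_apply, 𝒢.ric_symm P, 𝒢.ric_symm _ Q]
    ring
  rw [hsym Y, hsym Z X, ric, cov2_trace13, cov2_trace13, div4, ← Finset.sum_sub_distrib]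
  have h1 := 𝒢.trace_symm (slot13 (𝒢.cov4 𝒢.riem Y) Z X)
  have h2 := 𝒢.trace_symm (slot13 (𝒢.cov4 𝒢.riem Z) Y X)
  simp only [slot13_apply] at h1 h2
  rw [Finset.sum_sub_distrib, h1, h2, ← Finset.sum_sub_distrib]
  refine Finset.sum_congr rfl fun i _ => ?_
  have h := 𝒢.cov4_riem_bianchi (𝒢.dual i) Y Z (𝒢.fr i) X
  rw [𝒢.cov4_swap 𝒢.riem_swap Y (𝒢.dual i) Z] at h
  rw [𝒢.cov4_pair 𝒢.riem_pair]
  linear_combination h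

/-- The divergence of a symmetric 2-tensor. -/
def div2 {ι : Type*} [Fintype ι] [DecidableEq ι] (𝒢 : LeviCivita ι A V)
    (T : V →ₗ[A] V →ₗ[A] A) (X : V) : A := ∑ i, 𝒢.cov2 T (𝒢.dual i) (𝒢.fr i) X

theorem sum_cov2 {ι : Type*} [Fintype ι] [DecidableEq ι] (𝒢 : LeviCivita ι A V)
    (T : V →ₗ[A] V →ₗ[A] A) (Z : V) :
    ∑ i, 𝒢.cov2 T Z (𝒢.fr i) (𝒢.dual i) = 𝒢.der Z (∑ i, T (𝒢.fr i) (𝒢.dual i)) := by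
  have h := 𝒢.sum_nab_fr T Z
  rw [← sub_eq_zero, ← neg_eq_zero, ← h, map_sum, ← Finset.sum_sub_distrib,
    ← Finset.sum_neg_distrib]
  exact Finset.sum_congr rfl fun i _ => by rw [cov2_apply]; ring

/-- The contracted second Bianchi identity. -/
theorem div2_ric (Y : V) : 2 * 𝒢.div2 𝒢.ric Y = 𝒢.der Y 𝒢.scal := by
  -- Tracing the divergence of the curvature in X and Z gives the divergence of Ric once both
  -- skew-symmetries are used; `div4_riem` computes the same trace as dR − div Ric.
  have h1 : ∑ j, 𝒢.div4 𝒢.riem (𝒢.fr j) Y (𝒢.dual j) = 𝒢.div2 𝒢.ric Y := by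
    simp only [div4, div2]
    rw [Finset.sum_comm]
    refine Finset.sum_congr rfl fun i _ => ?_
    rw [ric, cov2_trace13]
    refine Finset.sum_congr rfl fun j _ => ?_
    rw [𝒢.cov4_swap 𝒢.riem_swap, 𝒢.cov4_swap_right 𝒢.riem_swap_right, neg_neg]
  simp only [div4_riem, Finset.sum_sub_distrib, sum_cov2] at h1
  rw [← scal] at h1
  change _ - 𝒢.div2 𝒢.ric Y = _ at h1
  linear_combination -h1

theorem cov2_sch (Z X Y : V) : 𝒢.cov2 𝒢.sch Z X Y =
    6 * twelfth A * 𝒢.cov2 𝒢.ric Z X Y - twelfth A * 𝒢.der Z 𝒢.scal * 𝒢.met X Y := by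
  have h := 𝒢.der_met Z X Y
  have h6 : 𝒢.der Z (6 * twelfth A) = 0 := by
    have : (6 * twelfth A) = (6 : ℕ) • twelfth A := by simp
    rw [this, map_nsmul, der_twelfth, nsmul_zero]
  simp only [cov2_apply, sch_apply, map_sub, Derivation.leibniz, smul_eq_mul, der_twelfth, h, h6]
  ring

theorem cov4_kulkarniNomizu (P : V →ₗ[A] V →ₗ[A] A) (U X Y Z W : V) :
    𝒢.cov4 (kulkarniNomizu P 𝒢.met) U X Y Z W =
      kulkarniNomizu (𝒢.cov2 P U) 𝒢.met X Y Z W := by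
  simp only [cov4_apply, kulkarniNomizu_apply, cov2_apply, map_sub, map_add, Derivation.leibniz,
    smul_eq_mul, der_met]
  ring

theorem cov4_weyl (U X Y Z W : V) : 𝒢.cov4 𝒢.weyl U X Y Z W =
    𝒢.cov4 𝒢.riem U X Y Z W - kulkarniNomizu (𝒢.cov2 𝒢.sch U) 𝒢.met X Y Z W := by
  rw [← cov4_kulkarniNomizu]
  simp only [weyl, cov4_apply, mkTensor4_apply, map_sub]
  ring

theorem cov2_add (T : V →ₗ[A] V →ₗ[A] A) (Z Z' X Y : V) :
    𝒢.cov2 T (Z + Z') X Y = 𝒢.cov2 T Z X Y + 𝒢.cov2 T Z' X Y := by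
  simp only [cov2_apply, map_add, LinearMap.add_apply, Derivation.add_apply,
    AddMonoidHom.add_apply]
  ring

theorem cov2_smul (T : V →ₗ[A] V →ₗ[A] A) (c : A) (Z X Y : V) :
    𝒢.cov2 T (c • Z) X Y = c * 𝒢.cov2 T Z X Y := by
  simp only [cov2_apply, map_smul, LinearMap.smul_apply, Derivation.smul_apply,
    AddMonoidHom.smul_apply, smul_eq_mul]
  ring

/-- `∇T` as a bilinear form in its last argument and the direction of differentiation. -/
def cov2Form (T : V →ₗ[A] V →ₗ[A] A) (X : V) : V →ₗ[A] V →ₗ[A] A :=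
  LinearMap.mk₂ A (fun P Q => 𝒢.cov2 T Q P X)
    (by intros; simp only [map_add, LinearMap.add_apply])
    (by intros; simp only [map_smul, LinearMap.smul_apply])
    (by intros; rw [cov2_add]) (by intros; rw [cov2_smul, smul_eq_mul])

@[simp] theorem cov2Form_apply (T : V →ₗ[A] V →ₗ[A] A) (X P Q : V) :
    𝒢.cov2Form T X P Q = 𝒢.cov2 T Q P X := rfl

/-- The divergence of the Weyl tensor is the Cotton tensor. -/
theorem div4_weyl (X Y Z : V) :
    𝒢.div4 𝒢.weyl X Y Z = 𝒢.cov2 𝒢.sch Y X Z - 𝒢.cov2 𝒢.sch Z X Y := by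
  have hr := 𝒢.div4_riem X Y Z
  -- Here div A = dR/6: half of div Ric = dR/2, minus the divergence of (R/12)g.
  have hd : ∀ Y, 𝒢.div2 𝒢.sch Y = 2 * twelfth A * 𝒢.der Y 𝒢.scal := by
    intro Y
    have h := 𝒢.div2_ric Y
    have h2 := 𝒢.trace_symm (LinearMap.mk₂ A (fun P Q => 𝒢.der P 𝒢.scal * 𝒢.met Q Y)
      (by intros; simp [add_mul]) (by intros; simp [mul_assoc]) (by intros; simp [mul_add])
      (by intros; simp [mul_left_comm]))
    simp only [LinearMap.mk₂_apply] at h2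
    have h3 : 𝒢.der Y 𝒢.scal = ∑ i, 𝒢.der (𝒢.dual i) 𝒢.scal * 𝒢.met (𝒢.fr i) Y := by
      rw [← h2]
      conv_lhs => rw [← 𝒢.sum_dual Y]
      simp only [der_sum_apply, map_smul, Derivation.smul_apply, smul_eq_mul]
      exact Finset.sum_congr rfl fun i _ => by rw [𝒢.met_comm Y]; ring
    have h4 : 𝒢.div2 𝒢.sch Y = 6 * twelfth A * 𝒢.div2 𝒢.ric Y
        - twelfth A * ∑ i, 𝒢.der (𝒢.dual i) 𝒢.scal * 𝒢.met (𝒢.fr i) Y := by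
      simp only [div2, cov2_sch, Finset.sum_sub_distrib, Finset.mul_sum, mul_assoc]
    rw [h4, ← h3]
    linear_combination (3 * twelfth A) * h
  have hsplit : 𝒢.div4 𝒢.weyl X Y Z = 𝒢.div4 𝒢.riem X Y Z - (𝒢.div2 𝒢.sch Y * 𝒢.met X Z
      + (∑ i, 𝒢.met (𝒢.fr i) Y * 𝒢.cov2 𝒢.sch (𝒢.dual i) X Z) - 𝒢.div2 𝒢.sch Z * 𝒢.met X Y
      - ∑ i, 𝒢.met (𝒢.fr i) Z * 𝒢.cov2 𝒢.sch (𝒢.dual i) X Y) := by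
    simp only [div4, div2, cov4_weyl, kulkarniNomizu_apply, Finset.sum_sub_distrib,
      Finset.sum_add_distrib, Finset.sum_mul]
    simp only [mul_comm]
  have hc : ∀ X Y Z, ∑ i, 𝒢.met (𝒢.fr i) Y * 𝒢.cov2 𝒢.sch (𝒢.dual i) X Z
      = 𝒢.cov2 𝒢.sch Y X Z := fun X Y Z => 𝒢.sum_met_mul' (𝒢.cov2Form 𝒢.sch Z) X Y
  rw [hsplit, hr, hd, hd, hc, hc, cov2_sch, cov2_sch]
  linear_combination (𝒢.cov2 𝒢.ric Z X Y - 𝒢.cov2 𝒢.ric Y X Z) * twelfth_spec A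

end Dimension

end LeviCivita

/-! ### The hypersurface: normal, second fundamental form, Codazzi, explicit formula. -/

namespace LeviCivita

section Hypersurface

variable {A V : Type*} [CommRing A] [Algebra ℝ A] [AddCommGroup V] [Module A V]
  (𝒢 : LeviCivita (Fin 4) A V) (c : A)

/-- A multiple of the gradient of the coordinate `x₀`; it is the unit normal when
`c ^ 2 * |dx₀|² = 1`. -/
def unitNormal : V := c • 𝒢.dual 0

/-- The tangential dual frame. -/
def tdual (a : Fin 3) : V :=
  𝒢.dual a.succ - 𝒢.met (𝒢.dual a.succ) (𝒢.unitNormal c) • 𝒢.unitNormal c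

/-- The second fundamental form `L(X, Y) = -⟨∇_X n, Y⟩`, as a form on all vectors. -/
def shape : V →ₗ[A] V →ₗ[A] A :=
  LinearMap.mk₂ A (fun X Y => -𝒢.met (𝒢.nab X (𝒢.unitNormal c)) Y)
    (by intros; simp only [map_add, AddMonoidHom.add_apply, LinearMap.add_apply, neg_add])
    (by
      intros
      simp only [map_smul, AddMonoidHom.smul_apply, LinearMap.smul_apply, smul_neg])
    (by intros; simp only [map_add, neg_add])
    (by intros; simp only [map_smul, smul_neg])

theorem shape_apply (X Y : V) :
    𝒢.shape c X Y = -𝒢.met (𝒢.nab X (𝒢.unitNormal c)) Y := rfl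

theorem met_fr_succ_unitNormal (a : Fin 3) : 𝒢.met (𝒢.fr a.succ) (𝒢.unitNormal c) = 0 := by
  simp [unitNormal, met_fr_dual, Fin.succ_ne_zero]

/-- The coefficient of the boundary Christoffel symbols. -/
def tchr (p a b : Fin 3) : A := 𝒢.met (𝒢.nab (𝒢.fr a.succ) (𝒢.fr b.succ)) (𝒢.tdual c p)

/-- The boundary covariant derivative of the second fundamental form. -/
def covL (a b e : Fin 3) : A :=
  𝒢.der (𝒢.fr e.succ) (𝒢.shape c (𝒢.fr a.succ) (𝒢.fr b.succ))
    - ∑ p, (𝒢.tchr c p e a * 𝒢.shape c (𝒢.fr p.succ) (𝒢.fr b.succ)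
      + 𝒢.tchr c p e b * 𝒢.shape c (𝒢.fr a.succ) (𝒢.fr p.succ))

/-- The second boundary covariant derivative of the second fundamental form. -/
def covcovL (a b e k : Fin 3) : A :=
  𝒢.der (𝒢.fr k.succ) (𝒢.covL c a b e)
    - ∑ p, (𝒢.tchr c p k a * 𝒢.covL c p b e + 𝒢.tchr c p k b * 𝒢.covL c a p e
      + 𝒢.tchr c p k e * 𝒢.covL c a b p)

/-- The mean curvature. -/
def meanCurv : A := ∑ a, ∑ b, 𝒢.met (𝒢.tdual c a) (𝒢.tdual c b) *
  𝒢.shape c (𝒢.fr a.succ) (𝒢.fr b.succ)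

theorem cov4_weyl_swap_self (U X Y Z : V) : 𝒢.cov4 𝒢.weyl U X Y Z Z = 0 := by
  have h := 𝒢.cov4_swap_right 𝒢.weyl_swap_right U X Y Z Z
  linear_combination (6 * twelfth A) * h - 𝒢.cov4 𝒢.weyl U X Y Z Z * twelfth_spec A

/-- The tensor `∇ⁱW_{iαnβ} + ∇ⁱW_{iβnα} - ∇ⁿW_{nαnβ} + (4/3) H W_{nαnβ}`. -/
noncomputable def tensorS : V →ₗ[A] V →ₗ[A] A :=
  LinearMap.mk₂ A (fun X Y => 𝒢.div4 𝒢.weyl X (𝒢.unitNormal c) Y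
      + 𝒢.div4 𝒢.weyl Y (𝒢.unitNormal c) X
      - 𝒢.cov4 𝒢.weyl (𝒢.unitNormal c) (𝒢.unitNormal c) X (𝒢.unitNormal c) Y
      + 16 * twelfth A * 𝒢.meanCurv c * 𝒢.weyl (𝒢.unitNormal c) X (𝒢.unitNormal c) Y)
    (by
      intros
      simp only [div4, map_add, LinearMap.add_apply, Finset.sum_add_distrib]
      ring)
    (by
      intros
      simp only [div4, map_smul, LinearMap.smul_apply, smul_eq_mul, ← Finset.mul_sum]
      ring)
    (by
      intros
      simp only [div4, map_add, LinearMap.add_apply, Finset.sum_add_distrib]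
      ring)
    (by
      intros
      simp only [div4, map_smul, LinearMap.smul_apply, smul_eq_mul, ← Finset.mul_sum]
      ring)

theorem tensorS_apply (X Y : V) : 𝒢.tensorS c X Y = 𝒢.div4 𝒢.weyl X (𝒢.unitNormal c) Y
      + 𝒢.div4 𝒢.weyl Y (𝒢.unitNormal c) X
      - 𝒢.cov4 𝒢.weyl (𝒢.unitNormal c) (𝒢.unitNormal c) X (𝒢.unitNormal c) Y
      + 16 * twelfth A * 𝒢.meanCurv c * 𝒢.weyl (𝒢.unitNormal c) X (𝒢.unitNormal c) Y := rfl

theorem tensorS_symm (X Y : V) : 𝒢.tensorS c X Y = 𝒢.tensorS c Y X := by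
  rw [tensorS_apply, tensorS_apply, 𝒢.weyl_pair _ X, 𝒢.cov4_pair 𝒢.weyl_pair _ _ X]
  ring

variable (hc : c * c * 𝒢.met (𝒢.dual 0) (𝒢.dual 0) = 1)
  (hfr : ∀ i j, 𝒢.nab (𝒢.fr i) (𝒢.fr j) = 𝒢.nab (𝒢.fr j) (𝒢.fr i))

section

include hc

theorem met_unitNormal_self : 𝒢.met (𝒢.unitNormal c) (𝒢.unitNormal c) = 1 := by
  rw [← hc, unitNormal]
  simp only [map_smul, LinearMap.smul_apply, smul_eq_mul]
  ring

theorem met_tdual_unitNormal (a : Fin 3) : 𝒢.met (𝒢.tdual c a) (𝒢.unitNormal c) = 0 := by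
  simp only [tdual, map_sub, LinearMap.sub_apply, map_smul, LinearMap.smul_apply, smul_eq_mul,
    𝒢.met_unitNormal_self c hc]
  ring

/-- The field `fr 0` is traded for the normal: the tangential coordinate fields and n form a frame
whose dual frame is `tdual` and n. All splittings into tangential and normal parts rest on this. -/
theorem sum_tdual (X : V) : ∑ a, 𝒢.met X (𝒢.tdual c a) • 𝒢.fr (Fin.succ a)
    + 𝒢.met X (𝒢.unitNormal c) • 𝒢.unitNormal c = X := by
  have h1 := 𝒢.sum_dual X
  have h2 := 𝒢.sum_dual (𝒢.unitNormal c)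
  rw [Fin.sum_univ_succ] at h1 h2
  have h3 : ∑ a : Fin 3, 𝒢.met X (𝒢.tdual c a) • 𝒢.fr a.succ =
      ∑ a : Fin 3, 𝒢.met X (𝒢.dual a.succ) • 𝒢.fr a.succ - 𝒢.met X (𝒢.unitNormal c) •
        ∑ a : Fin 3, 𝒢.met (𝒢.unitNormal c) (𝒢.dual a.succ) • 𝒢.fr a.succ := by
    rw [Finset.smul_sum, ← Finset.sum_sub_distrib]
    refine Finset.sum_congr rfl fun a _ => ?_
    rw [tdual, map_sub, map_smul, smul_smul, ← sub_smul, 𝒢.met_comm (𝒢.unitNormal c) (𝒢.dual a.succ),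
      smul_eq_mul, mul_comm (𝒢.met (𝒢.dual a.succ) _)]
  have h4 : 𝒢.met X (𝒢.unitNormal c) * 𝒢.met (𝒢.unitNormal c) (𝒢.dual 0)
      = 𝒢.met X (𝒢.dual 0) := by
    simp only [unitNormal, map_smul, LinearMap.smul_apply, smul_eq_mul]
    linear_combination 𝒢.met X (𝒢.dual 0) * hc
  rw [h3, eq_sub_iff_add_eq'.mpr h1, eq_sub_iff_add_eq'.mpr h2, smul_sub, smul_smul, h4]
  abel

theorem sum_tdual' (X : V) : ∑ a, 𝒢.met X (𝒢.fr (Fin.succ a)) • 𝒢.tdual c a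
    + 𝒢.met X (𝒢.unitNormal c) • 𝒢.unitNormal c = X := by
  refine 𝒢.met_ext fun i => ?_
  conv_rhs => rw [← 𝒢.sum_tdual c hc (𝒢.fr i)]
  simp only [map_add, map_sum, LinearMap.add_apply, LinearMap.sum_apply, map_smul,
    LinearMap.smul_apply, smul_eq_mul]
  congr 1
  · exact Finset.sum_congr rfl fun a _ => by rw [𝒢.met_comm (𝒢.tdual c a)]; ring
  · rw [𝒢.met_comm (𝒢.unitNormal c)]; ring

theorem sum_tangential (β : V →ₗ[A] V →ₗ[A] A) : ∑ i, β (𝒢.fr i) (𝒢.dual i) =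
    ∑ a : Fin 3, β (𝒢.fr a.succ) (𝒢.tdual c a) + β (𝒢.unitNormal c) (𝒢.unitNormal c) := by
  have h := trace_eq_trace 𝒢.met β 𝒢.met_comm
    (E := 𝒢.fr) (F := 𝒢.dual) (E' := Fin.cons (𝒢.unitNormal c) fun a : Fin 3 => 𝒢.fr a.succ)
    (F' := Fin.cons (𝒢.unitNormal c) (𝒢.tdual c))
    (fun X => by
      rw [Fin.sum_univ_succ]
      simp only [Fin.cons_zero, Fin.cons_succ]
      rw [add_comm, 𝒢.sum_tdual c hc]) 𝒢.sum_fr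
  rw [h, Fin.sum_univ_succ]
  simp only [Fin.cons_zero, Fin.cons_succ]
  rw [add_comm]

theorem sum_tangential_symm (β : V →ₗ[A] V →ₗ[A] A) :
    ∑ a : Fin 3, β (𝒢.fr a.succ) (𝒢.tdual c a) = ∑ a : Fin 3, β (𝒢.tdual c a) (𝒢.fr a.succ) := by
  have h1 := 𝒢.sum_tangential c hc β
  have h2 := 𝒢.sum_tangential c hc β.flip
  simp only [LinearMap.flip_apply] at h2
  rw [← trace_symm, h1] at h2
  exact add_right_cancel h2

theorem tdual_eq (a : Fin 3) :
    𝒢.tdual c a = ∑ b, 𝒢.met (𝒢.tdual c a) (𝒢.tdual c b) • 𝒢.fr (Fin.succ b) := by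
  conv_lhs => rw [← 𝒢.sum_tdual c hc (𝒢.tdual c a), 𝒢.met_tdual_unitNormal c hc]
  simp

/-- The full trace of ∇W vanishes, and its normal entry has n in both slots of a skew pair; hence
the tangential trace vanishes too. -/
theorem sum_cov4_weyl_tangential (U X : V) :
    ∑ a : Fin 3, 𝒢.cov4 𝒢.weyl U X (𝒢.fr a.succ) (𝒢.unitNormal c) (𝒢.tdual c a) = 0 := by
  have h := 𝒢.sum_tangential c hc (slot13 (𝒢.cov4 𝒢.weyl U) X (𝒢.unitNormal c))
  simp only [slot13_apply, sum_cov4_weyl] at h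
  have h0 := 𝒢.cov4_weyl_swap_self U X (𝒢.unitNormal c) (𝒢.unitNormal c)
  rw [𝒢.cov4_swap 𝒢.weyl_swap] at h0
  rw [neg_eq_zero.mp h0, add_zero] at h
  rw [h]
  refine Finset.sum_congr rfl fun a _ => ?_
  rw [𝒢.cov4_swap 𝒢.weyl_swap, 𝒢.cov4_swap_right 𝒢.weyl_swap_right, neg_neg]

theorem sum_weyl_tangential (X : V) :
    ∑ a : Fin 3, 𝒢.weyl X (𝒢.fr a.succ) (𝒢.unitNormal c) (𝒢.tdual c a) = 0 := by
  have h := 𝒢.sum_tangential c hc (slot13 𝒢.weyl X (𝒢.unitNormal c))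
  simp only [slot13_apply] at h
  rw [← trace13_apply, trace13_weyl] at h
  have h0 := 𝒢.weyl_swap (𝒢.unitNormal c) X (𝒢.unitNormal c) (𝒢.unitNormal c)
  have h1 := 𝒢.weyl_swap_right (𝒢.unitNormal c) X (𝒢.unitNormal c) (𝒢.unitNormal c)
  have h2 : 𝒢.weyl (𝒢.unitNormal c) X (𝒢.unitNormal c) (𝒢.unitNormal c) = 0 := by
    linear_combination (6 * twelfth A) * h1 -
      𝒢.weyl (𝒢.unitNormal c) X (𝒢.unitNormal c) (𝒢.unitNormal c) * twelfth_spec A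
  rw [h2, add_zero] at h
  rw [h]
  refine Finset.sum_congr rfl fun a _ => ?_
  rw [weyl_swap, weyl_swap_right, neg_neg]

/-- Each term of S is traceless by itself. The second divergence has the two tangential arguments in
the opposite order, which `sum_tangential_symm` repairs. -/
theorem sum_tensorS : ∑ a : Fin 3, 𝒢.tensorS c (𝒢.fr a.succ) (𝒢.tdual c a) = 0 := by
  have h1 : ∑ a : Fin 3, 𝒢.div4 𝒢.weyl (𝒢.fr a.succ) (𝒢.unitNormal c) (𝒢.tdual c a) = 0 := by
    simp only [div4]
    rw [Finset.sum_comm]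
    exact Finset.sum_eq_zero fun i _ => 𝒢.sum_cov4_weyl_tangential c hc _ _
  have h2 : ∑ a : Fin 3, 𝒢.div4 𝒢.weyl (𝒢.tdual c a) (𝒢.unitNormal c) (𝒢.fr a.succ) = 0 := by
    simp only [div4]
    rw [Finset.sum_comm]
    refine Finset.sum_eq_zero fun i _ => ?_
    have h := 𝒢.sum_tangential_symm c hc
      ((𝒢.cov4 𝒢.weyl (𝒢.dual i) (𝒢.fr i)).flip (𝒢.unitNormal c))
    simp only [LinearMap.flip_apply] at h
    rw [← h]
    exact 𝒢.sum_cov4_weyl_tangential c hc _ _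
  simp only [tensorS_apply, Finset.sum_add_distrib, Finset.sum_sub_distrib, ← Finset.mul_sum, h1,
    h2, 𝒢.sum_cov4_weyl_tangential c hc, 𝒢.sum_weyl_tangential c hc]
  ring

theorem met_nab_unitNormal (X : V) : 𝒢.met (𝒢.nab X (𝒢.unitNormal c)) (𝒢.unitNormal c) = 0 := by
  have h := 𝒢.der_met X (𝒢.unitNormal c) (𝒢.unitNormal c)
  rw [𝒢.met_unitNormal_self c hc, Derivation.map_one_eq_zero,
    𝒢.met_comm (𝒢.unitNormal c) (𝒢.nab X _)] at h
  linear_combination (-(6 * twelfth A)) * h -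
      𝒢.met (𝒢.nab X (𝒢.unitNormal c)) (𝒢.unitNormal c) * twelfth_spec A

theorem nab_unitNormal (X : V) :
    𝒢.nab X (𝒢.unitNormal c) = -∑ a, 𝒢.shape c X (𝒢.fr (Fin.succ a)) • 𝒢.tdual c a := by
  conv_lhs => rw [← 𝒢.sum_tdual' c hc (𝒢.nab X (𝒢.unitNormal c)), 𝒢.met_nab_unitNormal c hc]
  simp only [shape_apply, neg_smul, Finset.sum_neg_distrib, neg_neg, zero_smul, add_zero]

/-- The relation ⟨∂_b, n⟩ = 0 holds throughout the chart, not only at x₀ = 0, so it may be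
differentiated in every direction X. -/
theorem shape_tangential (X : V) (b : Fin 3) :
    𝒢.shape c X (𝒢.fr b.succ) = 𝒢.met (𝒢.nab X (𝒢.fr b.succ)) (𝒢.unitNormal c) := by
  have h := 𝒢.der_met X (𝒢.fr b.succ) (𝒢.unitNormal c)
  rw [met_fr_succ_unitNormal, map_zero] at h
  rw [shape_apply, 𝒢.met_comm (𝒢.nab X (𝒢.unitNormal c))]
  linear_combination h

theorem nab_fr_succ (a b : Fin 3) : 𝒢.nab (𝒢.fr a.succ) (𝒢.fr b.succ) =
    ∑ p, 𝒢.tchr c p a b • 𝒢.fr (Fin.succ p)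
      + 𝒢.shape c (𝒢.fr a.succ) (𝒢.fr b.succ) • 𝒢.unitNormal c := by
  rw [𝒢.shape_tangential c hc]
  exact (𝒢.sum_tdual c hc _).symm

include hfr

theorem shape_symm (a b : Fin 3) : 𝒢.shape c (𝒢.fr a.succ) (𝒢.fr b.succ) =
    𝒢.shape c (𝒢.fr b.succ) (𝒢.fr a.succ) := by
  rw [𝒢.shape_tangential c hc, 𝒢.shape_tangential c hc, hfr]

/-- The Codazzi equation. -/
theorem codazzi (a b e : Fin 3) :
    𝒢.riem (𝒢.fr e.succ) (𝒢.fr b.succ) (𝒢.unitNormal c) (𝒢.fr a.succ) =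
      𝒢.covL c b a e - 𝒢.covL c e a b := by
  -- Since ∇_X n is tangential, only the tangential part of ∇_a ∂_b, given by the boundary
  -- Christoffel symbols, pairs with it.
  have hn : ∀ X (a b : Fin 3), 𝒢.met (𝒢.nab (𝒢.fr a.succ) (𝒢.fr b.succ))
      (𝒢.nab X (𝒢.unitNormal c)) = -∑ p, 𝒢.tchr c p a b * 𝒢.shape c X (𝒢.fr p.succ) := by
    intro X a b
    have h : 𝒢.shape c X (𝒢.nab (𝒢.fr a.succ) (𝒢.fr b.succ)) =
        ∑ p, 𝒢.tchr c p a b * 𝒢.shape c X (𝒢.fr p.succ) := by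
      rw [𝒢.nab_fr_succ c hc a b]
      simp only [map_add, map_sum, map_smul, smul_eq_mul, shape_apply _ _ _ (𝒢.unitNormal c),
        𝒢.met_nab_unitNormal c hc]
      ring
    rw [← h, shape_apply, 𝒢.met_comm]
    ring
  rw [riem_apply, curv, hfr e.succ b.succ, sub_self, map_zero, AddMonoidHom.zero_apply, sub_zero]
  simp only [map_sub, LinearMap.sub_apply, covL, 𝒢.shape_tangential c hc _ a, der_met,
    Finset.sum_add_distrib]
  have hs : ∀ p, 𝒢.tchr c p e b = 𝒢.tchr c p b e := fun p => by rw [tchr, tchr, hfr]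
  simp only [hn, ← 𝒢.shape_tangential c hc _ a, hs]
  ring

theorem covL_symm (a b e : Fin 3) : 𝒢.covL c a b e = 𝒢.covL c b a e := by
  simp only [covL, 𝒢.shape_symm c hc hfr a, 𝒢.shape_symm c hc hfr _ b, Finset.sum_add_distrib]
  ring

theorem covcovL_symm (a b e k : Fin 3) : 𝒢.covcovL c a b e k = 𝒢.covcovL c b a e k := by
  simp only [covcovL, 𝒢.covL_symm c hc hfr a, 𝒢.covL_symm c hc hfr _ b, Finset.sum_add_distrib]
  ring

/-- The Codazzi equation is differentiated along the boundary. Replacing ∇ by the boundary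
connection costs one term in L per slot: the tangential slots contribute a multiple of n, the normal
slot contributes ∇n = −L. The contribution of the last slot has n twice in a skew pair and drops
out. -/
theorem cov4_riem_tangential (a b e k : Fin 3) :
    𝒢.cov4 𝒢.riem (𝒢.fr k.succ) (𝒢.fr e.succ) (𝒢.fr b.succ) (𝒢.unitNormal c) (𝒢.fr a.succ) =
      𝒢.covcovL c a b e k - 𝒢.covcovL c e a b k
      - 𝒢.shape c (𝒢.fr e.succ) (𝒢.fr k.succ) *
          𝒢.riem (𝒢.fr a.succ) (𝒢.unitNormal c) (𝒢.fr b.succ) (𝒢.unitNormal c)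
      + 𝒢.shape c (𝒢.fr b.succ) (𝒢.fr k.succ) *
          𝒢.riem (𝒢.fr e.succ) (𝒢.unitNormal c) (𝒢.fr a.succ) (𝒢.unitNormal c)
      + ∑ p, 𝒢.shape c (𝒢.fr k.succ) (𝒢.fr p.succ) *
          𝒢.riem (𝒢.fr b.succ) (𝒢.fr e.succ) (𝒢.fr a.succ) (𝒢.tdual c p) := by
  have hself : 𝒢.riem (𝒢.fr e.succ) (𝒢.fr b.succ) (𝒢.unitNormal c) (𝒢.unitNormal c) = 0 := by
    have h1 := 𝒢.riem_swap_right (𝒢.fr e.succ) (𝒢.fr b.succ) (𝒢.unitNormal c) (𝒢.unitNormal c)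
    linear_combination (6 * twelfth A) * h1 - 𝒢.riem (𝒢.fr e.succ) (𝒢.fr b.succ)
      (𝒢.unitNormal c) (𝒢.unitNormal c) * twelfth_spec A
  have e1 : 𝒢.riem (𝒢.unitNormal c) (𝒢.fr b.succ) (𝒢.unitNormal c) (𝒢.fr a.succ) =
      𝒢.riem (𝒢.fr a.succ) (𝒢.unitNormal c) (𝒢.fr b.succ) (𝒢.unitNormal c) := by
    rw [riem_pair, riem_swap, riem_swap_right, neg_neg]
  have e2 : 𝒢.riem (𝒢.fr e.succ) (𝒢.unitNormal c) (𝒢.unitNormal c) (𝒢.fr a.succ) =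
      -𝒢.riem (𝒢.fr e.succ) (𝒢.unitNormal c) (𝒢.fr a.succ) (𝒢.unitNormal c) := by
    rw [riem_swap_right]
  have e3 : ∀ p, 𝒢.riem (𝒢.fr e.succ) (𝒢.fr b.succ) (𝒢.tdual c p) (𝒢.fr a.succ) =
      𝒢.riem (𝒢.fr b.succ) (𝒢.fr e.succ) (𝒢.fr a.succ) (𝒢.tdual c p) := by
    intro p
    rw [riem_swap, riem_swap_right, neg_neg]
  rw [cov4_apply, 𝒢.nab_unitNormal c hc, 𝒢.nab_fr_succ c hc k e, 𝒢.nab_fr_succ c hc k b,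
    𝒢.nab_fr_succ c hc k a]
  simp only [map_add, map_neg, map_sum, map_smul, LinearMap.add_apply, LinearMap.sum_apply,
    LinearMap.smul_apply, LinearMap.neg_apply, smul_eq_mul, 𝒢.codazzi c hc hfr, hself, e1, e2, e3,
    𝒢.covcovL_symm c hc hfr a b]
  simp only [covcovL, map_sub, 𝒢.shape_symm c hc hfr k e, 𝒢.shape_symm c hc hfr k b, mul_sub,
    Finset.sum_add_distrib, Finset.sum_sub_distrib]
  ring

end

/-- The expression of `S` through the Schouten tensor and the second fundamental form. -/
noncomputable def explicitS (a b : Fin 3) : A :=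
  - 𝒢.cov2 𝒢.sch (𝒢.fr b.succ) (𝒢.fr a.succ) (𝒢.unitNormal c)
    + 𝒢.cov2 𝒢.sch (𝒢.fr a.succ) (𝒢.fr b.succ) (𝒢.unitNormal c)
    + 𝒢.cov2 𝒢.sch (𝒢.unitNormal c) (𝒢.fr a.succ) (𝒢.fr b.succ)
    + (∑ p, ∑ q, 𝒢.met (𝒢.tdual c p) (𝒢.tdual c q) * 𝒢.covcovL c a b p q)
    - (∑ p, ∑ q, 𝒢.met (𝒢.tdual c p) (𝒢.tdual c q) * 𝒢.covcovL c p a b q)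
    + (∑ p, ∑ q, 𝒢.met (𝒢.tdual c p) (𝒢.tdual c q) *
        𝒢.shape c (𝒢.fr b.succ) (𝒢.fr p.succ) *
        𝒢.riem (𝒢.fr q.succ) (𝒢.unitNormal c) (𝒢.fr a.succ) (𝒢.unitNormal c))
    - 𝒢.meanCurv c * 𝒢.riem (𝒢.fr a.succ) (𝒢.unitNormal c) (𝒢.fr b.succ) (𝒢.unitNormal c)
    + (∑ p, ∑ p', ∑ q, ∑ q', 𝒢.met (𝒢.tdual c p) (𝒢.tdual c p') *
        𝒢.met (𝒢.tdual c q) (𝒢.tdual c q') * 𝒢.shape c (𝒢.fr p.succ) (𝒢.fr q.succ) *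
        𝒢.riem (𝒢.fr b.succ) (𝒢.fr p'.succ) (𝒢.fr a.succ) (𝒢.fr q'.succ))
    - (∑ p, ∑ q, 𝒢.met (𝒢.tdual c p) (𝒢.tdual c q) *
        𝒢.cov2 𝒢.sch (𝒢.fr q.succ) (𝒢.fr p.succ) (𝒢.unitNormal c)) *
        𝒢.met (𝒢.fr a.succ) (𝒢.fr b.succ)
    + 16 * twelfth A * 𝒢.meanCurv c *
        𝒢.weyl (𝒢.unitNormal c) (𝒢.fr a.succ) (𝒢.unitNormal c) (𝒢.fr b.succ)

include hc hfr

/-- The two divergences are treated differently. The one with arguments (α, n, β) becomes the Cotton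
tensor. The one with (β, n, α) is split by `sum_tangential`; its normal part cancels −∇ⁿW_{nαnβ},
and its tangential part is R minus A ∧ g, so that all second derivatives of L come from the Codazzi
equation. -/
theorem tensorS_eq_explicitS (a b : Fin 3) :
    𝒢.tensorS c (𝒢.fr a.succ) (𝒢.fr b.succ) = 𝒢.explicitS c a b := by
  have hdiv := 𝒢.sum_tangential c hc (𝒢.divForm 𝒢.weyl (𝒢.fr b.succ) (𝒢.unitNormal c) (𝒢.fr a.succ))
  simp only [divForm_apply] at hdiv
  change 𝒢.div4 𝒢.weyl (𝒢.fr b.succ) (𝒢.unitNormal c) (𝒢.fr a.succ) = _ at hdiv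
  have hpair := 𝒢.cov4_pair 𝒢.weyl_pair (𝒢.unitNormal c) (𝒢.unitNormal c) (𝒢.fr b.succ) (𝒢.unitNormal c) (𝒢.fr a.succ)
  have hcot := 𝒢.div4_weyl (𝒢.fr a.succ) (𝒢.unitNormal c) (𝒢.fr b.succ)
  -- the tangential divergence of `P ∧ g`
  have hk : ∀ p : Fin 3, kulkarniNomizu (𝒢.cov2 𝒢.sch (𝒢.tdual c p)) 𝒢.met (𝒢.fr p.succ)
      (𝒢.fr b.succ) (𝒢.unitNormal c) (𝒢.fr a.succ) =
      𝒢.cov2 𝒢.sch (𝒢.tdual c p) (𝒢.fr p.succ) (𝒢.unitNormal c) * 𝒢.met (𝒢.fr a.succ) (𝒢.fr b.succ)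
      - 𝒢.met (𝒢.fr a.succ) (𝒢.fr p.succ) * 𝒢.cov2 𝒢.sch (𝒢.tdual c p) (𝒢.fr b.succ) (𝒢.unitNormal c) := by
    intro p
    rw [kulkarniNomizu_apply, met_fr_succ_unitNormal, met_fr_succ_unitNormal,
      𝒢.met_comm (𝒢.fr b.succ) (𝒢.fr a.succ), 𝒢.met_comm (𝒢.fr p.succ) (𝒢.fr a.succ)]
    ring
  have ha : ∑ p : Fin 3, 𝒢.met (𝒢.fr a.succ) (𝒢.fr p.succ) *
      𝒢.cov2 𝒢.sch (𝒢.tdual c p) (𝒢.fr b.succ) (𝒢.unitNormal c) =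
      𝒢.cov2 𝒢.sch (𝒢.fr a.succ) (𝒢.fr b.succ) (𝒢.unitNormal c) := by
    have h := 𝒢.sum_tdual' c hc (𝒢.fr a.succ)
    rw [met_fr_succ_unitNormal, zero_smul, add_zero] at h
    have h' := congrArg (𝒢.cov2Form 𝒢.sch (𝒢.unitNormal c) (𝒢.fr b.succ)) h
    simpa only [map_sum, map_smul, cov2Form_apply, smul_eq_mul] using h'
  have hd : ∑ p : Fin 3, 𝒢.cov2 𝒢.sch (𝒢.tdual c p) (𝒢.fr p.succ) (𝒢.unitNormal c) =
      ∑ p, ∑ q, 𝒢.met (𝒢.tdual c p) (𝒢.tdual c q) *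
        𝒢.cov2 𝒢.sch (𝒢.fr q.succ) (𝒢.fr p.succ) (𝒢.unitNormal c) := by
    refine Finset.sum_congr rfl fun p _ => ?_
    have h' := congrArg (𝒢.cov2Form 𝒢.sch (𝒢.unitNormal c) (𝒢.fr p.succ)) (𝒢.tdual_eq c hc p)
    simpa only [map_sum, map_smul, cov2Form_apply, smul_eq_mul] using h'
  have hr : ∑ p : Fin 3, 𝒢.cov4 𝒢.riem (𝒢.tdual c p) (𝒢.fr p.succ) (𝒢.fr b.succ) (𝒢.unitNormal c) (𝒢.fr a.succ) =
      (∑ p, ∑ q, 𝒢.met (𝒢.tdual c p) (𝒢.tdual c q) * 𝒢.covcovL c a b p q)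
    - (∑ p, ∑ q, 𝒢.met (𝒢.tdual c p) (𝒢.tdual c q) * 𝒢.covcovL c p a b q)
    + (∑ p, ∑ q, 𝒢.met (𝒢.tdual c p) (𝒢.tdual c q) *
        𝒢.shape c (𝒢.fr b.succ) (𝒢.fr p.succ) *
        𝒢.riem (𝒢.fr q.succ) (𝒢.unitNormal c) (𝒢.fr a.succ) (𝒢.unitNormal c))
    - 𝒢.meanCurv c * 𝒢.riem (𝒢.fr a.succ) (𝒢.unitNormal c) (𝒢.fr b.succ) (𝒢.unitNormal c)
    + (∑ p, ∑ p', ∑ q, ∑ q', 𝒢.met (𝒢.tdual c p) (𝒢.tdual c p') *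
        𝒢.met (𝒢.tdual c q) (𝒢.tdual c q') * 𝒢.shape c (𝒢.fr p.succ) (𝒢.fr q.succ) *
        𝒢.riem (𝒢.fr b.succ) (𝒢.fr p'.succ) (𝒢.fr a.succ) (𝒢.fr q'.succ)) := by
    have h1 : ∀ p : Fin 3, 𝒢.cov4 𝒢.riem (𝒢.tdual c p) (𝒢.fr p.succ) (𝒢.fr b.succ) (𝒢.unitNormal c)
        (𝒢.fr a.succ) = ∑ q, 𝒢.met (𝒢.tdual c p) (𝒢.tdual c q) *
        𝒢.cov4 𝒢.riem (𝒢.fr q.succ) (𝒢.fr p.succ) (𝒢.fr b.succ) (𝒢.unitNormal c) (𝒢.fr a.succ) := by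
      intro p
      have h' := congrArg (𝒢.divForm 𝒢.riem (𝒢.fr b.succ) (𝒢.unitNormal c) (𝒢.fr a.succ) (𝒢.fr p.succ))
        (𝒢.tdual_eq c hc p)
      simpa only [map_sum, map_smul, divForm_apply, smul_eq_mul] using h'
    have h2 : ∀ p q : Fin 3, 𝒢.riem (𝒢.fr b.succ) (𝒢.fr p.succ) (𝒢.fr a.succ) (𝒢.tdual c q) =
        ∑ q', 𝒢.met (𝒢.tdual c q) (𝒢.tdual c q') *
          𝒢.riem (𝒢.fr b.succ) (𝒢.fr p.succ) (𝒢.fr a.succ) (𝒢.fr (Fin.succ q')) := by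
      intro p q
      have h' := congrArg (𝒢.riem (𝒢.fr b.succ) (𝒢.fr p.succ) (𝒢.fr a.succ))
        (𝒢.tdual_eq c hc q)
      simpa only [map_sum, map_smul, smul_eq_mul] using h'
    simp only [h1, 𝒢.cov4_riem_tangential c hc hfr, mul_add, mul_sub, Finset.sum_add_distrib,
      Finset.sum_sub_distrib, h2, meanCurv, Finset.sum_mul, Finset.mul_sum]
    -- The terms linear in R_{anbn} differ from the goal by exchanging the two contracted indices,
    -- and the last term by exchanging the two outer sums; symmetry of the inverse metric settles
    -- both.
    congr 1
    · have h3 : ∑ p, ∑ q, 𝒢.met (𝒢.tdual c p) (𝒢.tdual c q) *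
          (𝒢.shape c (𝒢.fr b.succ) (𝒢.fr (Fin.succ q)) * 𝒢.riem (𝒢.fr (Fin.succ p))
            (𝒢.unitNormal c) (𝒢.fr a.succ) (𝒢.unitNormal c)) =
          ∑ p, ∑ q, 𝒢.met (𝒢.tdual c p) (𝒢.tdual c q) *
            𝒢.shape c (𝒢.fr b.succ) (𝒢.fr (Fin.succ p)) * 𝒢.riem (𝒢.fr (Fin.succ q))
            (𝒢.unitNormal c) (𝒢.fr a.succ) (𝒢.unitNormal c) := by
        rw [Finset.sum_comm]
        refine Finset.sum_congr rfl fun p _ => Finset.sum_congr rfl fun q _ => ?_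
        rw [𝒢.met_comm (𝒢.tdual c q)]
        ring
      simp only [h3, mul_assoc]
      ring
    · rw [Finset.sum_comm]
      refine Finset.sum_congr rfl fun p _ => Finset.sum_congr rfl fun p' _ =>
        Finset.sum_congr rfl fun q _ => Finset.sum_congr rfl fun q' _ => ?_
      rw [𝒢.met_comm (𝒢.tdual c p')]
      ring
  simp only [cov4_weyl, Finset.sum_sub_distrib, hr, hk, ha, ← Finset.sum_mul, hd] at hdiv
  rw [tensorS_apply, explicitS, hcot]
  have hw : 𝒢.cov4 𝒢.weyl (𝒢.unitNormal c) (𝒢.unitNormal c) (𝒢.fr a.succ) (𝒢.unitNormal c) (𝒢.fr b.succ) =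
      𝒢.cov4 𝒢.riem (𝒢.unitNormal c) (𝒢.unitNormal c) (𝒢.fr b.succ) (𝒢.unitNormal c) (𝒢.fr a.succ) -
        kulkarniNomizu (𝒢.cov2 𝒢.sch (𝒢.unitNormal c)) 𝒢.met (𝒢.unitNormal c) (𝒢.fr b.succ) (𝒢.unitNormal c) (𝒢.fr a.succ) := by
    rw [← hpair, cov4_weyl]
  rw [hw]
  linear_combination hdiv

/-- If the second fundamental form vanishes modulo an ideal stable under the tangential
derivations, then so does `S - A_{αβ,n}`. -/
theorem tensorS_sub_mem (I : Ideal A)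
    (hI : ∀ (a : Fin 3) (f : A), f ∈ I → 𝒢.der (𝒢.fr a.succ) f ∈ I)
    (hL : ∀ a b : Fin 3, 𝒢.shape c (𝒢.fr a.succ) (𝒢.fr b.succ) ∈ I) (a b : Fin 3) :
    𝒢.tensorS c (𝒢.fr a.succ) (𝒢.fr b.succ)
      - 𝒢.cov2 𝒢.sch (𝒢.unitNormal c) (𝒢.fr a.succ) (𝒢.fr b.succ) ∈ I := by
  have h1 : ∀ a b e, 𝒢.covL c a b e ∈ I := fun a b e =>
    I.sub_mem (hI _ _ (hL _ _)) (I.sum_mem fun p _ =>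
      I.add_mem (I.mul_mem_left _ (hL _ _)) (I.mul_mem_left _ (hL _ _)))
  have h2 : ∀ a b e k, 𝒢.covcovL c a b e k ∈ I := fun a b e k =>
    I.sub_mem (hI _ _ (h1 _ _ _)) (I.sum_mem fun p _ =>
      I.add_mem (I.add_mem (I.mul_mem_left _ (h1 _ _ _)) (I.mul_mem_left _ (h1 _ _ _)))
        (I.mul_mem_left _ (h1 _ _ _)))
  -- The component A_{αn} equals ½ Ric_{αn}, which is a trace of the Codazzi equation and thus built
  -- from first derivatives of L.
  have h3 : ∀ a : Fin 3, 𝒢.sch (𝒢.fr a.succ) (𝒢.unitNormal c) ∈ I := by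
    intro a
    have h := 𝒢.sum_tangential c hc (slot13 𝒢.riem (𝒢.fr a.succ) (𝒢.unitNormal c))
    simp only [slot13_apply] at h
    have h0 := 𝒢.riem_swap_right (𝒢.unitNormal c) (𝒢.fr a.succ) (𝒢.unitNormal c)
      (𝒢.unitNormal c)
    have h0' : 𝒢.riem (𝒢.unitNormal c) (𝒢.fr a.succ) (𝒢.unitNormal c) (𝒢.unitNormal c) = 0 := by
      linear_combination (6 * twelfth A) * h0 - 𝒢.riem (𝒢.unitNormal c) (𝒢.fr a.succ)
        (𝒢.unitNormal c) (𝒢.unitNormal c) * twelfth_spec A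
    rw [sch_apply, met_fr_succ_unitNormal, mul_zero, sub_zero, ric, trace13_apply, h, h0', add_zero]
    refine I.mul_mem_left _ (I.sum_mem fun p _ => ?_)
    rw [riem_swap_right, 𝒢.tdual_eq c hc p]
    simp only [map_sum, map_smul, smul_eq_mul, 𝒢.codazzi c hc hfr]
    exact I.neg_mem (I.sum_mem fun q _ => I.mul_mem_left _ (I.sub_mem (h1 _ _ _) (h1 _ _ _)))
  -- Differentiating A_{αn} tangentially stays in I; the corrections carry A_{γn} or L as a factor.
  have h4 : ∀ a b : Fin 3, 𝒢.cov2 𝒢.sch (𝒢.fr b.succ) (𝒢.fr a.succ) (𝒢.unitNormal c) ∈ I := by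
    intro a b
    rw [cov2_apply, 𝒢.nab_fr_succ c hc, 𝒢.nab_unitNormal c hc]
    simp only [map_add, map_neg, map_sum, map_smul, LinearMap.add_apply, LinearMap.sum_apply,
      LinearMap.smul_apply, smul_eq_mul]
    refine I.sub_mem (I.sub_mem (hI _ _ (h3 _)) (I.add_mem (I.sum_mem fun p _ => ?_) ?_))
      (I.neg_mem (I.sum_mem fun p _ => ?_))
    · exact I.mul_mem_left _ (h3 _)
    · exact I.mul_mem_right _ (hL _ _)
    · exact I.mul_mem_right _ (hL _ _)
  have h5 : 𝒢.meanCurv c ∈ I := I.sum_mem fun p _ => I.sum_mem fun q _ => I.mul_mem_left _ (hL _ _)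
  rw [𝒢.tensorS_eq_explicitS c hc hfr, explicitS]
  -- In A/I every summand of the explicit formula vanishes except A_{αβ,n}.
  rw [← Ideal.Quotient.eq_zero_iff_mem]
  simp only [map_sub, map_add, map_neg, map_mul, map_sum, Ideal.Quotient.eq_zero_iff_mem.mpr h5,
    Ideal.Quotient.eq_zero_iff_mem.mpr (h4 _ _), Ideal.Quotient.eq_zero_iff_mem.mpr (h2 _ _ _ _),
    Ideal.Quotient.eq_zero_iff_mem.mpr (hL _ _), mul_zero, zero_mul, Finset.sum_const_zero]
  ring

end Hypersurface

end LeviCivita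

/-! ### Conformal change of the metric. -/

namespace LeviCivita

section Conformal

variable {ι A V : Type*} [Fintype ι] [DecidableEq ι] [CommRing A] [Algebra ℝ A]
  [AddCommGroup V] [Module A V] (𝒢 : LeviCivita ι A V) (φ ψ : A)

/-- The gradient of `log φ`, where `ψ = φ⁻¹`. -/
def gradLog : V := ∑ i, (ψ * 𝒢.der (𝒢.fr i) φ) • 𝒢.dual i

theorem met_gradLog (X : V) : 𝒢.met (𝒢.gradLog φ ψ) X = ψ * 𝒢.der X φ := by
  conv_rhs => rw [← 𝒢.sum_dual X, der_sum_apply]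
  simp only [gradLog, map_sum, LinearMap.sum_apply, map_smul, LinearMap.smul_apply,
    Derivation.smul_apply, smul_eq_mul, Finset.mul_sum]
  exact Finset.sum_congr rfl fun i _ => by rw [𝒢.met_comm X]; ring

variable (h : φ * ψ = 1)

/-- The Levi-Civita connection of `φ² g`. -/
def conformalNab : V →ₗ[A] (V →+ V) where
  toFun X := 𝒢.nab X + AddMonoidHom.mk' (fun Y => 𝒢.met (𝒢.gradLog φ ψ) X • Y
      + 𝒢.met (𝒢.gradLog φ ψ) Y • X - 𝒢.met X Y • 𝒢.gradLog φ ψ)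
    (by intro Y Y'; simp only [map_add]; module)
  map_add' X X' := by
    ext Y
    simp only [map_add, AddMonoidHom.add_apply, AddMonoidHom.mk'_apply, LinearMap.add_apply]
    module
  map_smul' f X := by
    ext Y
    simp only [map_smul, AddMonoidHom.add_apply, AddMonoidHom.mk'_apply, LinearMap.smul_apply,
      AddMonoidHom.smul_apply, RingHom.id_apply, smul_eq_mul]
    module

theorem conformalNab_apply (X Y : V) : 𝒢.conformalNab φ ψ X Y = 𝒢.nab X Y +
    (𝒢.met (𝒢.gradLog φ ψ) X • Y + 𝒢.met (𝒢.gradLog φ ψ) Y • X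
      - 𝒢.met X Y • 𝒢.gradLog φ ψ) := rfl

/-- The correction to the connection is symmetric in X and Y, so the bracket is unchanged; this
gives `der_comm` and `jacobi` for the new metric. -/
theorem conformalNab_sub (X Y : V) :
    𝒢.conformalNab φ ψ X Y - 𝒢.conformalNab φ ψ Y X = 𝒢.nab X Y - 𝒢.nab Y X := by
  rw [conformalNab_apply, conformalNab_apply, 𝒢.met_comm Y X]
  module

include h in
theorem der_eq_mul_gradLog (X : V) : 𝒢.der X φ = φ * 𝒢.met (𝒢.gradLog φ ψ) X := by
  rw [met_gradLog]
  linear_combination (-𝒢.der X φ) * h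

/-- The conformal metric `φ² g`. -/
def conformal : LeviCivita ι A V where
  der := 𝒢.der
  met := (φ * φ) • 𝒢.met
  nab := 𝒢.conformalNab φ ψ
  fr := 𝒢.fr
  dual i := (ψ * ψ) • 𝒢.dual i
  met_comm X Y := by
    simp only [LinearMap.smul_apply]
    rw [𝒢.met_comm]
  nab_smul X f Y := by
    simp only [conformalNab_apply, nab_smul, map_smul, smul_eq_mul]
    module
  der_met Z X Y := by
    simp only [conformalNab_apply, LinearMap.smul_apply, smul_eq_mul, Derivation.leibniz,
      𝒢.der_met, 𝒢.der_eq_mul_gradLog φ ψ h Z, map_add, map_sub, map_smul, LinearMap.add_apply,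
      LinearMap.sub_apply]
    rw [𝒢.met_comm X (𝒢.gradLog φ ψ), 𝒢.met_comm X Z]
    ring
  der_comm X Y f := by
    rw [𝒢.der_comm, ← Derivation.sub_apply, ← Derivation.sub_apply, ← map_sub, ← map_sub,
      conformalNab_sub]
  jacobi X Y Z := by
    simp only [conformalNab_sub]
    exact 𝒢.jacobi X Y Z
  met_fr_dual i j := by
    simp only [LinearMap.smul_apply, map_smul, smul_eq_mul, 𝒢.met_fr_dual]
    linear_combination ((if i = j then 1 else 0) * (φ * ψ + 1)) * h
  sum_dual X := by
    conv_rhs => rw [← 𝒢.sum_dual X]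
    refine Finset.sum_congr rfl fun i _ => congrArg (· • 𝒢.fr i) ?_
    simp only [LinearMap.smul_apply, map_smul, smul_eq_mul]
    linear_combination (𝒢.met X (𝒢.dual i) * (φ * ψ + 1)) * h

theorem conformal_met (X Y : V) : (𝒢.conformal φ ψ h).met X Y = φ * φ * 𝒢.met X Y := rfl

theorem conformal_der (X : V) (f : A) : (𝒢.conformal φ ψ h).der X f = 𝒢.der X f := rfl

theorem conformal_nab (X Y : V) : (𝒢.conformal φ ψ h).nab X Y = 𝒢.nab X Y +
    (𝒢.met (𝒢.gradLog φ ψ) X • Y + 𝒢.met (𝒢.gradLog φ ψ) Y • X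
      - 𝒢.met X Y • 𝒢.gradLog φ ψ) := rfl

include h in
/-- The Hessian of `log φ` is symmetric. -/
theorem hess_symm (X Y : V) :
    𝒢.met (𝒢.nab X (𝒢.gradLog φ ψ)) Y = 𝒢.met (𝒢.nab Y (𝒢.gradLog φ ψ)) X := by
  have h1 := 𝒢.der_met X (𝒢.gradLog φ ψ) Y
  have h2 := 𝒢.der_met Y (𝒢.gradLog φ ψ) X
  have h3 := 𝒢.der_comm X Y φ
  have h4 : ∀ Z, 𝒢.der Z ψ = -(ψ * ψ) * 𝒢.der Z φ := by
    intro Z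
    have h5 := congrArg (𝒢.der Z) h
    rw [Derivation.leibniz, Derivation.map_one_eq_zero] at h5
    simp only [smul_eq_mul] at h5
    linear_combination ψ * h5 - 𝒢.der Z ψ * h
  simp only [met_gradLog, Derivation.leibniz, smul_eq_mul, h4] at h1 h2
  linear_combination h2 - h1 + ψ * h3

/-- The tensor by which the Schouten tensor changes. -/
noncomputable def schoutenShift : V →ₗ[A] V →ₗ[A] A :=
  LinearMap.mk₂ A (fun X Y => 𝒢.met (𝒢.nab X (𝒢.gradLog φ ψ)) Y
      - 𝒢.met (𝒢.gradLog φ ψ) X * 𝒢.met (𝒢.gradLog φ ψ) Y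
      + 6 * twelfth A * 𝒢.met (𝒢.gradLog φ ψ) (𝒢.gradLog φ ψ) * 𝒢.met X Y)
    (by
      intros
      simp only [map_add, AddMonoidHom.add_apply, LinearMap.add_apply]
      ring)
    (by
      intros
      simp only [map_smul, AddMonoidHom.smul_apply, LinearMap.smul_apply, smul_eq_mul]
      ring)
    (by intros; simp only [map_add]; ring)
    (by intros; simp only [map_smul, smul_eq_mul]; ring)

/-- The shift is P = Hess log φ − d log φ ⊗ d log φ + ½|d log φ|² g. The symmetry of the Hessian is
needed because the curvature also produces its skew part. -/
theorem riem_conformal (X Y Z W : V) : (𝒢.conformal φ ψ h).riem X Y Z W =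
    φ * φ * (𝒢.riem X Y Z W - kulkarniNomizu (𝒢.schoutenShift φ ψ) 𝒢.met X Y Z W) := by
  have e : ∀ X, 𝒢.met (𝒢.nab X (𝒢.gradLog φ ψ)) (𝒢.gradLog φ ψ) =
    𝒢.met (𝒢.gradLog φ ψ) (𝒢.nab X (𝒢.gradLog φ ψ)) := fun X => 𝒢.met_comm _ _
  have hs := 𝒢.hess_symm φ ψ h X Y
  rw [riem_apply, riem_apply, conformal_met, curv, curv]
  have hsub : (𝒢.conformal φ ψ h).nab X Y - (𝒢.conformal φ ψ h).nab Y X =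
    𝒢.nab X Y - 𝒢.nab Y X := 𝒢.conformalNab_sub φ ψ X Y
  rw [hsub]
  simp only [conformal_der, conformal_nab, kulkarniNomizu_apply, schoutenShift, LinearMap.mk₂_apply, map_add,
    map_sub, map_smul, nab_smul, LinearMap.add_apply, LinearMap.sub_apply, LinearMap.smul_apply,
    smul_eq_mul, der_met, AddMonoidHom.sub_apply]
  simp only [𝒢.met_comm Y X,
    𝒢.met_comm W Z, 𝒢.met_comm X (𝒢.gradLog φ ψ), 𝒢.met_comm Y (𝒢.gradLog φ ψ),

    𝒢.met_comm X (𝒢.nab _ _), 𝒢.met_comm Y (𝒢.nab _ _)]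
  linear_combination (φ ^ 2 * 𝒢.met Z W) * hs + (φ ^ 2 * 𝒢.met (𝒢.gradLog φ ψ) (𝒢.gradLog φ ψ) *
    (𝒢.met X Z * 𝒢.met Y W - 𝒢.met X W * 𝒢.met Y Z)) * twelfth_spec A

end Conformal

/-! ### Conformal behaviour of the Weyl tensor, H and S. -/

section ConformalWeyl

variable {A V : Type*} [CommRing A] [Algebra ℝ A]
  [AddCommGroup V] [Module A V] (𝒢 : LeviCivita (Fin 4) A V) (φ ψ : A) (h : φ * ψ = 1)

/-- By uniqueness of the decomposition: φ²W is still trace-free, and φ²(A − P) ∧ g is (A − P) ∧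
(φ²g). -/
theorem sch_conformal : (𝒢.conformal φ ψ h).sch = 𝒢.sch - 𝒢.schoutenShift φ ψ := by
  refine sch_eq_of_riem_eq _ ((φ * φ) • 𝒢.weyl) _ ?_ ?_
  · intro X Y
    have h1 := 𝒢.trace13_weyl X Y
    rw [trace13_apply] at h1 ⊢
    have h2 : ∀ i, ((φ * φ) • 𝒢.weyl) ((𝒢.conformal φ ψ h).fr i) X
        ((𝒢.conformal φ ψ h).dual i) Y =
        (φ * φ) * (ψ * ψ) * 𝒢.weyl (𝒢.fr i) X (𝒢.dual i) Y := by
      intro i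
      simp only [conformal, LinearMap.smul_apply, map_smul, smul_eq_mul]
      ring
    simp only [h2, ← Finset.mul_sum, h1, mul_zero]
  · intro X Y Z W
    rw [riem_conformal]
    simp only [kulkarniNomizu_apply, LinearMap.smul_apply, LinearMap.sub_apply, smul_eq_mul,
      conformal_met, weyl_apply]
    ring

theorem weyl_conformal (X Y Z W : V) :
    (𝒢.conformal φ ψ h).weyl X Y Z W = φ * φ * 𝒢.weyl X Y Z W := by
  rw [weyl_apply, sch_conformal, riem_conformal, weyl_apply]
  simp only [kulkarniNomizu_apply, LinearMap.sub_apply, conformal_met]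
  ring

theorem map_sub_four (T : V →ₗ[A] V →ₗ[A] V →ₗ[A] V →ₗ[A] A) (P P' Q R W : V) :
    T (P - P') Q R W = T P Q R W - T P' Q R W := by
  rw [sub_eq_add_neg, ← neg_one_smul A P', map_add, map_smul]
  simp only [LinearMap.add_apply, LinearMap.smul_apply, smul_eq_mul]
  ring

/-- Each of the four slots contributes −⟨u,Z⟩W and two further terms, where u = grad log φ;
differentiating φ² contributes +2⟨u,Z⟩W, which leaves the coefficient −2. -/
theorem cov4_weyl_conformal (Z P Q R T : V) :
    (𝒢.conformal φ ψ h).cov4 (𝒢.conformal φ ψ h).weyl Z P Q R T = φ * φ *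
      (𝒢.cov4 𝒢.weyl Z P Q R T - 2 * 𝒢.met (𝒢.gradLog φ ψ) Z * 𝒢.weyl P Q R T
        - 𝒢.met (𝒢.gradLog φ ψ) P * 𝒢.weyl Z Q R T + 𝒢.met Z P * 𝒢.weyl (𝒢.gradLog φ ψ) Q R T
        - 𝒢.met (𝒢.gradLog φ ψ) Q * 𝒢.weyl P Z R T + 𝒢.met Z Q * 𝒢.weyl P (𝒢.gradLog φ ψ) R T
        - 𝒢.met (𝒢.gradLog φ ψ) R * 𝒢.weyl P Q Z T + 𝒢.met Z R * 𝒢.weyl P Q (𝒢.gradLog φ ψ) T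
        - 𝒢.met (𝒢.gradLog φ ψ) T * 𝒢.weyl P Q R Z
        + 𝒢.met Z T * 𝒢.weyl P Q R (𝒢.gradLog φ ψ)) := by
  simp only [cov4_apply, weyl_conformal, conformal_der, conformal_nab, map_add, map_sub_four, map_sub, map_smul,
    LinearMap.add_apply, LinearMap.sub_apply, LinearMap.smul_apply, smul_eq_mul,
    Derivation.leibniz, 𝒢.der_eq_mul_gradLog φ ψ h Z]
  ring

theorem sum_weyl_antisymm (X Y : V) : ∑ i, 𝒢.weyl (𝒢.fr i) (𝒢.dual i) X Y = 0 := by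
  have h1 := 𝒢.trace_symm (LinearMap.mk₂ A (fun P Q => 𝒢.weyl P Q X Y) (by intros; simp)
    (by intros; simp) (by intros; simp) (by intros; simp))
  simp only [LinearMap.mk₂_apply, 𝒢.weyl_swap (𝒢.fr _) (𝒢.dual _), Finset.sum_neg_distrib] at h1
  linear_combination (6 * twelfth A) * h1
    - (∑ i, 𝒢.weyl (𝒢.fr i) (𝒢.dual i) X Y) * twelfth_spec A

/-- After contraction the multiples of W(u,X,Y,Z) are −2 − 1 + 4 − 1 = 0, the 4 being the trace of
the metric. The terms from the last two slots combine by the first Bianchi identity into one copy of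
W(u,X,Y,Z), and the remaining terms are traces of W. -/
theorem div4_weyl_conformal (X Y Z : V) :
    (𝒢.conformal φ ψ h).div4 (𝒢.conformal φ ψ h).weyl X Y Z =
      𝒢.div4 𝒢.weyl X Y Z + 𝒢.weyl (𝒢.gradLog φ ψ) X Y Z := by
  have e1 : ∀ (f : V →ₗ[A] A) (W : V), ∑ i, 𝒢.met W (𝒢.dual i) * f (𝒢.fr i) = f W := by
    intro f W
    conv_rhs => rw [← 𝒢.sum_dual W]
    simp
  have e2 : ∀ (f : V →ₗ[A] A) (W : V), ∑ i, 𝒢.met W (𝒢.fr i) * f (𝒢.dual i) = f W := by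
    intro f W
    conv_rhs => rw [← 𝒢.sum_fr W]
    simp
  have s1 := e1 (((𝒢.weyl.flip X).flip Y).flip Z) (𝒢.gradLog φ ψ)
  have s2 := e2 (((𝒢.weyl.flip X).flip Y).flip Z) (𝒢.gradLog φ ψ)
  have s3 := e1 (((𝒢.weyl.flip (𝒢.gradLog φ ψ)).flip Y).flip Z) X
  have s4 := e1 (((𝒢.weyl.flip X).flip (𝒢.gradLog φ ψ)).flip Z) Y
  have s5 := e1 (((𝒢.weyl.flip X).flip Y).flip (𝒢.gradLog φ ψ)) Z
  simp only [LinearMap.flip_apply] at s1 s2 s3 s4 s5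
  have t1 := 𝒢.sum_weyl_antisymm Y Z
  have t2 := 𝒢.trace13_weyl X Z
  have t3 := 𝒢.trace13_weyl X Y
  rw [trace13_apply] at t2 t3
  have t3' : ∑ i, 𝒢.weyl (𝒢.fr i) X Y (𝒢.dual i) = 0 := by
    rw [← neg_eq_zero, ← Finset.sum_neg_distrib, ← t3]
    exact Finset.sum_congr rfl fun i _ => by rw [← weyl_swap_right]
  have hsplit : (𝒢.conformal φ ψ h).div4 (𝒢.conformal φ ψ h).weyl X Y Z =
      (φ * φ) * (ψ * ψ) * (𝒢.div4 𝒢.weyl X Y Z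
      - 2 * (∑ i, 𝒢.met (𝒢.gradLog φ ψ) (𝒢.dual i) * 𝒢.weyl (𝒢.fr i) X Y Z)
      - (∑ i, 𝒢.met (𝒢.gradLog φ ψ) (𝒢.fr i) * 𝒢.weyl (𝒢.dual i) X Y Z)
      + (∑ i, 𝒢.met (𝒢.fr i) (𝒢.dual i)) * 𝒢.weyl (𝒢.gradLog φ ψ) X Y Z
      - 𝒢.met (𝒢.gradLog φ ψ) X * (∑ i, 𝒢.weyl (𝒢.fr i) (𝒢.dual i) Y Z)
      + (∑ i, 𝒢.met X (𝒢.dual i) * 𝒢.weyl (𝒢.fr i) (𝒢.gradLog φ ψ) Y Z)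
      - 𝒢.met (𝒢.gradLog φ ψ) Y * (∑ i, 𝒢.weyl (𝒢.fr i) X (𝒢.dual i) Z)
      + (∑ i, 𝒢.met Y (𝒢.dual i) * 𝒢.weyl (𝒢.fr i) X (𝒢.gradLog φ ψ) Z)
      - 𝒢.met (𝒢.gradLog φ ψ) Z * (∑ i, 𝒢.weyl (𝒢.fr i) X Y (𝒢.dual i))
      + ∑ i, 𝒢.met Z (𝒢.dual i) * 𝒢.weyl (𝒢.fr i) X Y (𝒢.gradLog φ ψ)) := by
    have hdual : ∀ i, (𝒢.conformal φ ψ h).dual i = (ψ * ψ) • 𝒢.dual i := fun _ => rfl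
    have hfr : ∀ i, (𝒢.conformal φ ψ h).fr i = 𝒢.fr i := fun _ => rfl
    simp only [div4, hdual, hfr, cov4_smul, cov4_weyl_conformal]
    simp only [Finset.mul_sum, Finset.sum_mul, ← Finset.sum_add_distrib,
      ← Finset.sum_sub_distrib]
    refine Finset.sum_congr rfl fun i _ => ?_
    rw [𝒢.met_comm (𝒢.dual i), 𝒢.met_comm (𝒢.dual i), 𝒢.met_comm (𝒢.dual i),
      𝒢.met_comm (𝒢.dual i)]
    ring
  rw [hsplit, s1, s2, s3, s4, s5, t1, t2, t3', sum_met_fr_dual]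
  linear_combination (𝒢.div4 𝒢.weyl X Y Z + 𝒢.weyl (𝒢.gradLog φ ψ) X Y Z
      + (𝒢.weyl X (𝒢.gradLog φ ψ) Y Z + 𝒢.weyl (𝒢.gradLog φ ψ) X Y Z)
      + (𝒢.weyl Y X (𝒢.gradLog φ ψ) Z + 𝒢.weyl Z X Y (𝒢.gradLog φ ψ)
        - 𝒢.weyl (𝒢.gradLog φ ψ) X Y Z)) * (φ * ψ + 1) * h
    + 𝒢.weyl_swap (𝒢.gradLog φ ψ) X Y Z + 𝒢.weyl_pair Y X (𝒢.gradLog φ ψ) Z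
    + 𝒢.weyl_pair Z X Y (𝒢.gradLog φ ψ) + 𝒢.weyl_swap (𝒢.gradLog φ ψ) Y Z X
    + 𝒢.weyl_swap_right (𝒢.gradLog φ ψ) Z X Y - 𝒢.weyl_swap_right (𝒢.gradLog φ ψ) Y X Z
    + 𝒢.weyl_bianchi Y Z (𝒢.gradLog φ ψ) X - 𝒢.weyl_pair Y Z X (𝒢.gradLog φ ψ)
    - 𝒢.weyl_swap (𝒢.gradLog φ ψ) X Y Z - 𝒢.weyl_swap (𝒢.gradLog φ ψ) Z X Y

/-- The length of dx₀ scales by ψ, so the normalising factor becomes φc. For positive φ this keeps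
the chosen side. -/
theorem unitNormal_conformal (c : A) :
    (𝒢.conformal φ ψ h).unitNormal (φ * c) = ψ • 𝒢.unitNormal c := by
  have e : (𝒢.conformal φ ψ h).unitNormal (φ * c) = (φ * c) • ((ψ * ψ) • 𝒢.dual 0) := rfl
  rw [e, unitNormal, smul_smul, smul_smul]
  congr 1
  linear_combination (c * ψ) * h

theorem unitNormal_conformal_spec {c : A} (hc : c * c * 𝒢.met (𝒢.dual 0) (𝒢.dual 0) = 1) :
    (φ * c) * (φ * c) * (𝒢.conformal φ ψ h).met ((𝒢.conformal φ ψ h).dual 0)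
      ((𝒢.conformal φ ψ h).dual 0) = 1 := by
  have e : (𝒢.conformal φ ψ h).dual 0 = (ψ * ψ) • 𝒢.dual 0 := rfl
  rw [e, conformal_met]
  simp only [map_smul, LinearMap.smul_apply, smul_eq_mul]
  linear_combination hc + c * c * 𝒢.met (𝒢.dual 0) (𝒢.dual 0) *
    (φ * ψ + 1) * (φ ^ 2 * ψ ^ 2 + 1) * h

variable {c : A} (hc : c * c * 𝒢.met (𝒢.dual 0) (𝒢.dual 0) = 1)

include hc

theorem meanCurv_eq_sum : 𝒢.meanCurv c =
    ∑ a : Fin 3, 𝒢.shape c (𝒢.fr a.succ) (𝒢.tdual c a) := by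
  refine Finset.sum_congr rfl fun a _ => ?_
  conv_rhs => rw [𝒢.tdual_eq c hc a]
  simp only [map_sum, map_smul, smul_eq_mul]

/-- On tangential fields L becomes φ(L − ⟨u,n⟩ĝ) with u = grad log φ; the inverse boundary metric
scales by ψ², and the 3 is the trace of ĝ. -/
theorem meanCurv_conformal : (𝒢.conformal φ ψ h).meanCurv (φ * c) =
    ψ * (𝒢.meanCurv c - 3 * 𝒢.met (𝒢.gradLog φ ψ) (𝒢.unitNormal c)) := by
  have ht : ∀ a : Fin 3, (𝒢.conformal φ ψ h).tdual (φ * c) a = (ψ * ψ) • 𝒢.tdual c a := by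
    intro a
    have e : ∀ i, (𝒢.conformal φ ψ h).dual i = (ψ * ψ) • 𝒢.dual i := fun _ => rfl
    rw [tdual, tdual, unitNormal_conformal, conformal_met, e]
    simp only [map_smul, LinearMap.smul_apply, smul_eq_mul, smul_sub, smul_smul]
    congr 2
    linear_combination (ψ * ψ * 𝒢.met (𝒢.dual a.succ) (𝒢.unitNormal c)) * (φ * ψ + 1) * h
  have hs : ∀ a b : Fin 3, (𝒢.conformal φ ψ h).shape (φ * c) (𝒢.fr a.succ) (𝒢.fr b.succ) =
      φ * (𝒢.shape c (𝒢.fr a.succ) (𝒢.fr b.succ)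
        - 𝒢.met (𝒢.fr a.succ) (𝒢.fr b.succ) * 𝒢.met (𝒢.gradLog φ ψ) (𝒢.unitNormal c)) := by
    intro a b
    have e := (𝒢.conformal φ ψ h).shape_tangential (φ * c)
      (𝒢.unitNormal_conformal_spec φ ψ h hc) (𝒢.fr a.succ) b
    have e' : (𝒢.conformal φ ψ h).fr b.succ = 𝒢.fr b.succ := rfl
    rw [e'] at e
    rw [e, conformal_met, unitNormal_conformal, conformal_nab, 𝒢.shape_tangential c hc]
    simp only [map_add, map_sub, map_smul, LinearMap.add_apply, LinearMap.sub_apply,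
      LinearMap.smul_apply, smul_eq_mul, met_fr_succ_unitNormal]
    linear_combination φ * (𝒢.met (𝒢.nab (𝒢.fr a.succ) (𝒢.fr b.succ)) (𝒢.unitNormal c)
      - 𝒢.met (𝒢.fr a.succ) (𝒢.fr b.succ) * 𝒢.met (𝒢.gradLog φ ψ) (𝒢.unitNormal c)) * h
  have h3 : ∑ a : Fin 3, 𝒢.met (𝒢.fr a.succ) (𝒢.tdual c a) = 3 := by
    have h4 := 𝒢.sum_tangential c hc 𝒢.met
    rw [sum_met_fr_dual, 𝒢.met_unitNormal_self c hc] at h4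
    linear_combination -h4
  have h5 : ∑ a : Fin 3, 𝒢.met (𝒢.fr a.succ) (𝒢.tdual c a) =
      ∑ a, ∑ b, 𝒢.met (𝒢.tdual c a) (𝒢.tdual c b) *
        𝒢.met (𝒢.fr (Fin.succ a)) (𝒢.fr (Fin.succ b)) := by
    refine Finset.sum_congr rfl fun a _ => ?_
    conv_lhs => rw [𝒢.tdual_eq c hc a]
    simp only [map_sum, map_smul, smul_eq_mul]
  have hfr : ∀ i, (𝒢.conformal φ ψ h).fr i = 𝒢.fr i := fun _ => rfl
  rw [h3] at h5
  rw [h5, meanCurv, meanCurv, Finset.sum_mul, ← Finset.sum_sub_distrib, Finset.mul_sum]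
  refine Finset.sum_congr rfl fun a _ => ?_
  rw [Finset.sum_mul, ← Finset.sum_sub_distrib, Finset.mul_sum]
  refine Finset.sum_congr rfl fun b _ => ?_
  rw [hfr, hfr, hs, ht, ht, conformal_met]
  simp only [map_smul, LinearMap.smul_apply, smul_eq_mul]
  linear_combination (𝒢.met (𝒢.tdual c a) (𝒢.tdual c b) *
    (𝒢.shape c (𝒢.fr a.succ) (𝒢.fr b.succ)
        - 𝒢.met (𝒢.fr a.succ) (𝒢.fr b.succ) * 𝒢.met (𝒢.gradLog φ ψ) (𝒢.unitNormal c))) *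
    ψ * (φ ^ 2 * ψ ^ 2 + φ * ψ + 1) * h

/-- Two divergences contribute W(u,X,n,Y) + W(u,Y,n,X), which the normal derivative cancels by pair
symmetry. It leaves 4⟨u,n⟩W(n,X,n,Y), and this is removed by (4/3)(−3⟨u,n⟩) from the mean curvature.
Tangency of X and Y kills the terms in which they pair with n. -/
theorem tensorS_conformal (X Y : V) (hX : 𝒢.met (𝒢.unitNormal c) X = 0)
    (hY : 𝒢.met (𝒢.unitNormal c) Y = 0) :
    (𝒢.conformal φ ψ h).tensorS (φ * c) X Y = ψ * 𝒢.tensorS c X Y := by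
  have z : ∀ Z W, 𝒢.weyl Z Z W Y = 0 := by
    intro Z W
    have h1 := 𝒢.weyl_swap Z Z W Y
    linear_combination (6 * twelfth A) * h1 - 𝒢.weyl Z Z W Y * twelfth_spec A
  have z' : ∀ Z P Q, 𝒢.weyl P Q Z Z = 0 := by
    intro Z P Q
    have h1 := 𝒢.weyl_swap_right P Q Z Z
    linear_combination (6 * twelfth A) * h1 - 𝒢.weyl P Q Z Z * twelfth_spec A
  rw [tensorS_apply, tensorS_apply, unitNormal_conformal, 𝒢.meanCurv_conformal φ ψ h hc]
  simp only [div4_weyl_conformal, weyl_conformal, cov4_smul, map_smul, LinearMap.smul_apply,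
    smul_eq_mul, cov4_weyl_conformal, hX, hY, 𝒢.met_unitNormal_self c hc, z, z']
  have hd : ∀ X Y, 𝒢.div4 𝒢.weyl X (ψ • 𝒢.unitNormal c) Y =
      ψ * 𝒢.div4 𝒢.weyl X (𝒢.unitNormal c) Y := by
    intro X Y
    simp only [div4, map_smul, LinearMap.smul_apply, smul_eq_mul, Finset.mul_sum]
  have p1 : 𝒢.weyl (𝒢.unitNormal c) X (𝒢.gradLog φ ψ) Y =
      𝒢.weyl (𝒢.gradLog φ ψ) Y (𝒢.unitNormal c) X := 𝒢.weyl_pair _ _ _ _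
  rw [hd, hd, p1]
  linear_combination (-(ψ * (φ * ψ + 1)) * (𝒢.weyl (𝒢.gradLog φ ψ) X (𝒢.unitNormal c) Y
      + 𝒢.weyl (𝒢.gradLog φ ψ) Y (𝒢.unitNormal c) X
      + 𝒢.cov4 𝒢.weyl (𝒢.unitNormal c) (𝒢.unitNormal c) X (𝒢.unitNormal c) Y
      - 16 * twelfth A * 𝒢.meanCurv c * 𝒢.weyl (𝒢.unitNormal c) X (𝒢.unitNormal c) Y)) * h
    - 4 * ψ ^ 3 * φ ^ 2 * 𝒢.met (𝒢.gradLog φ ψ) (𝒢.unitNormal c)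
      * 𝒢.weyl (𝒢.unitNormal c) X (𝒢.unitNormal c) Y * twelfth_spec A

end ConformalWeyl

end LeviCivita

/-! ### From the algebra to component formulas at points. -/

open BoundaryTensor in
/-- An interpretation of the elements of `A` as functions near certain points of coordinate space,
under which the frame vectors act as coordinate derivations and the metric has components `G`. -/
structure Realization {A V : Type*} [CommRing A] [Algebra ℝ A] [AddCommGroup V] [Module A V]
    (𝒢 : LeviCivita (Fin 4) A V) (G : E4 → Matrix (Fin 4) (Fin 4) ℝ) (Ω : Type*) where
  pt : Ω → E4
  ev : Ω → A →ₐ[ℝ] ℝ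
  -- Agreement of `f` with `a` is asked only at the points `pt u`: Christoffel symbols and curvature
  -- components are functions on all of ℝ⁴ that are meaningful only on the image of the chart.
  pd_eq : ∀ (f : E4 → ℝ) (a : A), (∀ u, f (pt u) = ev u a) →
    ∀ i u, pd i f (pt u) = ev u (𝒢.der (𝒢.fr i) a)
  metric_eq : ∀ i j u, G (pt u) i j = ev u (𝒢.met (𝒢.fr i) (𝒢.fr j))
  nab_comm : ∀ i j, 𝒢.nab (𝒢.fr i) (𝒢.fr j) = 𝒢.nab (𝒢.fr j) (𝒢.fr i)

namespace Realization

open BoundaryTensor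

variable {A V : Type*} [CommRing A] [Algebra ℝ A] [AddCommGroup V] [Module A V]
  {𝒢 : LeviCivita (Fin 4) A V} {G : E4 → Matrix (Fin 4) (Fin 4) ℝ} {Ω : Type*}
  (r : Realization 𝒢 G Ω)

theorem ev_twelfth (u : Ω) : r.ev u (LeviCivita.twelfth A) = 1 / 12 := by
  rw [LeviCivita.twelfth, AlgHom.commutes]
  rfl

section Frame

variable {m : ℕ} {d : Fin m → (E4 → ℝ) → E4 → ℝ} {g : E4 → Matrix (Fin m) (Fin m) ℝ}
  {E F : Fin m → V}

/-- The vectors `E` need not span V; only each `F k` must lie in their span. Hence the lemma serves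
both the four coordinate fields and the three tangential ones. -/
theorem inv_eq (hg : ∀ i j u, g (r.pt u) i j = r.ev u (𝒢.met (E i) (E j)))
    (hF : ∀ k, ∑ l, 𝒢.met (F k) (F l) • E l = F k)
    (hEF : ∀ i j, 𝒢.met (E i) (F j) = if i = j then 1 else 0) (i j : Fin m) (u : Ω) :
    (g (r.pt u))⁻¹ i j = r.ev u (𝒢.met (F i) (F j)) := by
  have h : (g (r.pt u))⁻¹ = Matrix.of fun i j => r.ev u (𝒢.met (F i) (F j)) := by
    apply Matrix.inv_eq_left_inv
    ext i k
    rw [Matrix.mul_apply]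
    simp only [Matrix.of_apply, hg, ← map_mul, ← map_sum]
    have h1 : ∑ l, 𝒢.met (F i) (F l) * 𝒢.met (E l) (E k) = 𝒢.met (E k) (F i) := by
      conv_rhs => rw [𝒢.met_comm, ← hF i]
      simp only [map_sum, map_smul, LinearMap.sum_apply, LinearMap.smul_apply, smul_eq_mul]
    rw [h1, hEF, Matrix.one_apply]
    simp only [eq_comm (a := k)]
    split_ifs <;> simp
  rw [h, Matrix.of_apply]

/-- Koszul's formula for commuting fields, with `F k` expanded in `E`. For the tangential frame it
says that the boundary connection is the tangential part of the ambient one. -/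
theorem christoffel_eq (hd : ∀ (f : E4 → ℝ) (a : A), (∀ u, f (r.pt u) = r.ev u a) →
      ∀ i u, d i f (r.pt u) = r.ev u (𝒢.der (E i) a))
    (hg : ∀ i j u, g (r.pt u) i j = r.ev u (𝒢.met (E i) (E j)))
    (hF : ∀ k, ∑ l, 𝒢.met (F k) (F l) • E l = F k)
    (hEF : ∀ i j, 𝒢.met (E i) (F j) = if i = j then 1 else 0)
    (hE : ∀ i j, 𝒢.nab (E i) (E j) = 𝒢.nab (E j) (E i)) (k i j : Fin m) (u : Ω) :
    christoffel d g k i j (r.pt u) = r.ev u (𝒢.met (𝒢.nab (E i) (E j)) (F k)) := by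
  have h : 𝒢.met (𝒢.nab (E i) (E j)) (F k) = 6 * LeviCivita.twelfth A *
      ∑ l, 𝒢.met (F k) (F l) * (𝒢.der (E i) (𝒢.met (E j) (E l))
        + 𝒢.der (E j) (𝒢.met (E i) (E l)) - 𝒢.der (E l) (𝒢.met (E i) (E j))) := by
    conv_lhs => rw [← hF k]
    rw [map_sum, Finset.mul_sum]
    refine Finset.sum_congr rfl fun l _ => ?_
    rw [𝒢.der_met, 𝒢.der_met, 𝒢.der_met, hE l i, hE l j, hE j i, 𝒢.met_comm (E j),
      map_smul, smul_eq_mul]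
    linear_combination (-(𝒢.met (F k) (F l) * 𝒢.met (𝒢.nab (E i) (E j)) (E l)))
      * LeviCivita.twelfth_spec A
  rw [h, christoffel]
  simp only [map_mul, map_sum, map_add, map_sub, r.ev_twelfth, r.inv_eq hg hF hEF,
    hd (fun z => g z _ _) _ (hg _ _), map_ofNat]
  norm_num

end Frame

theorem sum_dual_met (k : Fin 4) : ∑ l, 𝒢.met (𝒢.dual k) (𝒢.dual l) • 𝒢.fr l = 𝒢.dual k :=
  𝒢.sum_dual _

theorem inv_metric_eq (i j : Fin 4) (u : Ω) :
    (G (r.pt u))⁻¹ i j = r.ev u (𝒢.met (𝒢.dual i) (𝒢.dual j)) :=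
  r.inv_eq r.metric_eq sum_dual_met 𝒢.met_fr_dual i j u

theorem christoffel_pd_eq (k i j : Fin 4) (u : Ω) : christoffel pd G k i j (r.pt u) =
    r.ev u (𝒢.met (𝒢.nab (𝒢.fr i) (𝒢.fr j)) (𝒢.dual k)) :=
  r.christoffel_eq r.pd_eq r.metric_eq sum_dual_met 𝒢.met_fr_dual r.nab_comm k i j u

theorem sum_dual_apply (t : V →ₗ[A] A) (X : V) :
    ∑ i, 𝒢.met X (𝒢.dual i) * t (𝒢.fr i) = t X := by
  conv_rhs => rw [← 𝒢.sum_dual X]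
  simp only [map_sum, map_smul, smul_eq_mul]

theorem sum_inv_apply (t : V →ₗ[A] A) (i : Fin 4) :
    ∑ k, 𝒢.met (𝒢.dual i) (𝒢.dual k) * t (𝒢.fr k) = t (𝒢.dual i) := sum_dual_apply t _

/-- Differentiating Γ = ⟨∇_j ∂_l, dual q⟩ produces an unwanted term with ∇ dual q; `h2` identifies
the quadratic Christoffel terms as exactly what removes it. -/
theorem riem_eq (i j k l : Fin 4) (u : Ω) : riem pd G i j k l (r.pt u) =
    r.ev u (𝒢.riem (𝒢.fr i) (𝒢.fr j) (𝒢.fr k) (𝒢.fr l)) := by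
  have h1 : ∀ X Y Z, 𝒢.der X (𝒢.met Y Z) = 𝒢.met (𝒢.nab X Y) Z + 𝒢.met Y (𝒢.nab X Z) := 𝒢.der_met
  have h2 : ∀ (i j l q : Fin 4), ∑ p, 𝒢.met (𝒢.nab (𝒢.fr i) (𝒢.fr p)) (𝒢.dual q) *
      𝒢.met (𝒢.nab (𝒢.fr j) (𝒢.fr l)) (𝒢.dual p) =
      -𝒢.met (𝒢.nab (𝒢.fr j) (𝒢.fr l)) (𝒢.nab (𝒢.fr i) (𝒢.dual q)) := by
    intro i j l q
    have h3 : ∀ p, 𝒢.met (𝒢.nab (𝒢.fr i) (𝒢.fr p)) (𝒢.dual q) =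
        -𝒢.met (𝒢.fr p) (𝒢.nab (𝒢.fr i) (𝒢.dual q)) := by
      intro p
      have h4 := 𝒢.der_met (𝒢.fr i) (𝒢.fr p) (𝒢.dual q)
      have h5 : 𝒢.der (𝒢.fr i) (if p = q then (1 : A) else 0) = 0 := by split_ifs <;> simp
      rw [𝒢.met_fr_dual, h5] at h4
      linear_combination -h4
    have h6 := sum_dual_apply (𝒢 := 𝒢) (𝒢.met.flip (𝒢.nab (𝒢.fr i) (𝒢.dual q)))
      (𝒢.nab (𝒢.fr j) (𝒢.fr l))
    simp only [LinearMap.flip_apply] at h6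
    rw [← h6, ← Finset.sum_neg_distrib]
    exact Finset.sum_congr rfl fun p _ => by rw [h3]; ring
  have h : 𝒢.riem (𝒢.fr i) (𝒢.fr j) (𝒢.fr k) (𝒢.fr l) = ∑ q, 𝒢.met (𝒢.fr k) (𝒢.fr q) *
      (𝒢.der (𝒢.fr i) (𝒢.met (𝒢.nab (𝒢.fr j) (𝒢.fr l)) (𝒢.dual q))
        - 𝒢.der (𝒢.fr j) (𝒢.met (𝒢.nab (𝒢.fr i) (𝒢.fr l)) (𝒢.dual q))
        + ∑ p, (𝒢.met (𝒢.nab (𝒢.fr i) (𝒢.fr p)) (𝒢.dual q) *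
              𝒢.met (𝒢.nab (𝒢.fr j) (𝒢.fr l)) (𝒢.dual p)
            - 𝒢.met (𝒢.nab (𝒢.fr j) (𝒢.fr p)) (𝒢.dual q) *
              𝒢.met (𝒢.nab (𝒢.fr i) (𝒢.fr l)) (𝒢.dual p))) := by
    rw [LeviCivita.riem_apply, LeviCivita.curv, r.nab_comm i j, sub_self, map_zero,
      AddMonoidHom.zero_apply, sub_zero, 𝒢.met_comm,
      ← sum_dual_apply (𝒢.met (𝒢.fr k))]
    refine Finset.sum_congr rfl fun q _ => ?_
    rw [Finset.sum_sub_distrib, h2, h2, h1, h1, map_sub, LinearMap.sub_apply]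
    ring
  have hc : ∀ k i j u, christoffel pd G k i j (r.pt u) =
      r.ev u (𝒢.met (𝒢.nab (𝒢.fr i) (𝒢.fr j)) (𝒢.dual k)) := r.christoffel_pd_eq
  rw [h, riem]
  simp only [map_mul, map_sum, map_add, map_sub, hc, r.pd_eq _ _ (hc _ _ _), r.metric_eq]

theorem ricci_eq (j l : Fin 4) (u : Ω) :
    ricci pd G j l (r.pt u) = r.ev u (𝒢.ric (𝒢.fr j) (𝒢.fr l)) := by
  rw [ricci, LeviCivita.ric, LeviCivita.trace13_apply, map_sum]
  refine Finset.sum_congr rfl fun i _ => ?_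
  have h := sum_inv_apply (𝒢 := 𝒢) ((𝒢.riem (𝒢.fr i) (𝒢.fr j)).flip (𝒢.fr l)) i
  simp only [LinearMap.flip_apply] at h
  rw [← h]
  simp only [map_sum, map_mul, r.riem_eq, r.inv_metric_eq]

theorem scal_eq (u : Ω) : scal pd G (r.pt u) = r.ev u 𝒢.scal := by
  rw [scal, LeviCivita.scal, map_sum]
  refine Finset.sum_congr rfl fun i _ => ?_
  rw [← sum_inv_apply]
  simp only [map_sum, map_mul, r.ricci_eq, r.inv_metric_eq]

theorem schouten_eq (i j : Fin 4) (u : Ω) :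
    schouten G i j (r.pt u) = r.ev u (𝒢.sch (𝒢.fr i) (𝒢.fr j)) := by
  rw [schouten, LeviCivita.sch_apply, r.ricci_eq, r.scal_eq, r.metric_eq]
  simp only [map_sub, map_mul, r.ev_twelfth, map_ofNat]
  ring

theorem weyl_eq (i j k l : Fin 4) (u : Ω) : weyl G i j k l (r.pt u) =
    r.ev u (𝒢.weyl (𝒢.fr i) (𝒢.fr j) (𝒢.fr k) (𝒢.fr l)) := by
  rw [weyl, LeviCivita.weyl_apply]
  simp only [map_sub, map_add, map_mul, r.riem_eq, r.schouten_eq, r.metric_eq]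

theorem cov2_eq {T : Fin 4 → Fin 4 → E4 → ℝ} {t : V →ₗ[A] V →ₗ[A] A}
    (h : ∀ i j u, T i j (r.pt u) = r.ev u (t (𝒢.fr i) (𝒢.fr j))) (i j k : Fin 4) (u : Ω) :
    cov2 pd G T i j k (r.pt u) = r.ev u (𝒢.cov2 t (𝒢.fr k) (𝒢.fr i) (𝒢.fr j)) := by
  have h1 := sum_dual_apply (𝒢 := 𝒢) (t.flip (𝒢.fr j)) (𝒢.nab (𝒢.fr k) (𝒢.fr i))
  have h2 := sum_dual_apply (𝒢 := 𝒢) (t (𝒢.fr i)) (𝒢.nab (𝒢.fr k) (𝒢.fr j))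
  simp only [LinearMap.flip_apply] at h1
  rw [LeviCivita.cov2_apply, ← h1, ← h2, cov2]
  simp only [Finset.sum_add_distrib, map_sub, map_sum, map_mul, r.christoffel_pd_eq, h,
    r.pd_eq _ _ (h _ _)]
  ring

theorem cov4_eq {T : Fin 4 → Fin 4 → Fin 4 → Fin 4 → E4 → ℝ}
    {t : V →ₗ[A] V →ₗ[A] V →ₗ[A] V →ₗ[A] A}
    (h : ∀ i j k l u, T i j k l (r.pt u) = r.ev u (t (𝒢.fr i) (𝒢.fr j) (𝒢.fr k) (𝒢.fr l)))
    (i j k l q : Fin 4) (u : Ω) : cov4 pd G T i j k l q (r.pt u) =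
      r.ev u (𝒢.cov4 t (𝒢.fr q) (𝒢.fr i) (𝒢.fr j) (𝒢.fr k) (𝒢.fr l)) := by
  have h1 := sum_dual_apply (𝒢 := 𝒢) (((t.flip (𝒢.fr j)).flip (𝒢.fr k)).flip (𝒢.fr l))
    (𝒢.nab (𝒢.fr q) (𝒢.fr i))
  have h2 := sum_dual_apply (𝒢 := 𝒢) (((t (𝒢.fr i)).flip (𝒢.fr k)).flip (𝒢.fr l))
    (𝒢.nab (𝒢.fr q) (𝒢.fr j))
  have h3 := sum_dual_apply (𝒢 := 𝒢) ((t (𝒢.fr i) (𝒢.fr j)).flip (𝒢.fr l))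
    (𝒢.nab (𝒢.fr q) (𝒢.fr k))
  have h4 := sum_dual_apply (𝒢 := 𝒢) (t (𝒢.fr i) (𝒢.fr j) (𝒢.fr k))
    (𝒢.nab (𝒢.fr q) (𝒢.fr l))
  simp only [LinearMap.flip_apply] at h1 h2 h3
  rw [LeviCivita.cov4_apply, ← h1, ← h2, ← h3, ← h4, cov4]
  simp only [Finset.sum_add_distrib, map_sub, map_sum, map_mul, r.christoffel_pd_eq, h,
    r.pd_eq _ _ (h _ _ _ _)]
  ring

section Boundary

variable {s : ℤˣ} {c : A}
  (hcs : ∀ u, r.ev u c = ((s : ℤ) : ℝ) / Real.sqrt ((G (r.pt u))⁻¹ 0 0))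

include hcs

theorem normal_eq (i : Fin 4) (u : Ω) :
    normal s G i (r.pt u) = r.ev u (𝒢.met (𝒢.unitNormal c) (𝒢.dual i)) := by
  rw [normal, LeviCivita.unitNormal]
  simp only [map_smul, LinearMap.smul_apply, smul_eq_mul, map_mul, hcs, ← r.inv_metric_eq]
  ring

theorem sum_normal {f : Fin 4 → ℝ} {t : V →ₗ[A] A} {u : Ω}
    (h : ∀ i, f i = r.ev u (t (𝒢.fr i))) :
    ∑ i, normal s G i (r.pt u) * f i = r.ev u (t (𝒢.unitNormal c)) := by
  rw [← sum_dual_apply (𝒢 := 𝒢)]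
  simp only [map_sum, map_mul, r.normal_eq hcs, h]

theorem weylNN_eq (a b : Fin 3) (u : Ω) : weylNN s G a b (r.pt u) =
    r.ev u (𝒢.weyl (𝒢.unitNormal c) (𝒢.fr a.succ) (𝒢.unitNormal c) (𝒢.fr b.succ)) := by
  simp only [weylNN, mul_assoc, ← Finset.mul_sum]
  refine r.sum_normal hcs (t := ((𝒢.weyl.flip (𝒢.fr a.succ)).flip (𝒢.unitNormal c)).flip
    (𝒢.fr b.succ)) fun i => ?_
  exact r.sum_normal hcs (t := (𝒢.weyl (𝒢.fr i) (𝒢.fr a.succ)).flip (𝒢.fr b.succ))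
    fun k => r.weyl_eq _ _ _ _ _

theorem divWeyl_eq (a b : Fin 3) (u : Ω) : divWeyl s G a b (r.pt u) =
    r.ev u (𝒢.div4 𝒢.weyl (𝒢.fr a.succ) (𝒢.unitNormal c) (𝒢.fr b.succ)) := by
  simp only [divWeyl, mul_assoc, ← Finset.mul_sum]
  rw [LeviCivita.div4, map_sum]
  refine Finset.sum_congr rfl fun i _ => ?_
  have h := sum_inv_apply (𝒢 := 𝒢) (𝒢.divForm 𝒢.weyl (𝒢.fr a.succ) (𝒢.unitNormal c) (𝒢.fr b.succ)
    (𝒢.fr i)) i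
  simp only [LeviCivita.divForm_apply] at h
  rw [← h, map_sum]
  refine Finset.sum_congr rfl fun k _ => ?_
  rw [map_mul, r.inv_metric_eq]
  congr 1
  exact r.sum_normal hcs (t := (𝒢.cov4 𝒢.weyl (𝒢.fr k) (𝒢.fr i) (𝒢.fr a.succ)).flip
    (𝒢.fr b.succ)) fun k => r.cov4_eq r.weyl_eq _ _ _ _ _ _

theorem normalDerivWeyl_eq (a b : Fin 3) (u : Ω) : normalDerivWeyl s G a b (r.pt u) =
    r.ev u (𝒢.cov4 𝒢.weyl (𝒢.unitNormal c) (𝒢.unitNormal c) (𝒢.fr a.succ) (𝒢.unitNormal c)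
      (𝒢.fr b.succ)) := by
  simp only [normalDerivWeyl, mul_assoc, ← Finset.mul_sum]
  refine r.sum_normal hcs (t := (((𝒢.cov4 𝒢.weyl (𝒢.unitNormal c)).flip (𝒢.fr a.succ)).flip
    (𝒢.unitNormal c)).flip (𝒢.fr b.succ)) fun i => ?_
  refine r.sum_normal hcs (t := (𝒢.cov4 𝒢.weyl (𝒢.unitNormal c) (𝒢.fr i) (𝒢.fr a.succ)).flip
    (𝒢.fr b.succ)) fun k => ?_
  exact r.sum_normal hcs (t := 𝒢.divForm 𝒢.weyl (𝒢.fr a.succ) (𝒢.fr k) (𝒢.fr b.succ) (𝒢.fr i))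
    fun q => r.cov4_eq r.weyl_eq _ _ _ _ _ _

theorem dA_tn_t_eq (a b : Fin 3) (u : Ω) : dA_tn_t s G a b (r.pt u) =
    r.ev u (𝒢.cov2 𝒢.sch (𝒢.fr b.succ) (𝒢.fr a.succ) (𝒢.unitNormal c)) :=
  r.sum_normal hcs (t := 𝒢.cov2 𝒢.sch (𝒢.fr b.succ) (𝒢.fr a.succ))
    fun _ => r.cov2_eq r.schouten_eq _ _ _ _

theorem dA_tt_n_eq (a b : Fin 3) (u : Ω) : dA_tt_n s G a b (r.pt u) =
    r.ev u (𝒢.cov2 𝒢.sch (𝒢.unitNormal c) (𝒢.fr a.succ) (𝒢.fr b.succ)) :=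
  r.sum_normal hcs (t := 𝒢.cov2Form 𝒢.sch (𝒢.fr b.succ) (𝒢.fr a.succ))
    fun _ => r.cov2_eq r.schouten_eq _ _ _ _

theorem dRic_tt_n_eq (a b : Fin 3) (u : Ω) : dRic_tt_n s G a b (r.pt u) =
    r.ev u (𝒢.cov2 𝒢.ric (𝒢.unitNormal c) (𝒢.fr a.succ) (𝒢.fr b.succ)) :=
  r.sum_normal hcs (t := 𝒢.cov2Form 𝒢.ric (𝒢.fr b.succ) (𝒢.fr a.succ))
    fun _ => r.cov2_eq r.ricci_eq _ _ _ _

theorem dScal_n_eq (u : Ω) :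
    dScal_n s G (r.pt u) = r.ev u (𝒢.der (𝒢.unitNormal c) 𝒢.scal) := by
  have h := congrArg (fun X => 𝒢.der X 𝒢.scal) (𝒢.sum_dual (𝒢.unitNormal c))
  simp only [LeviCivita.der_sum_apply, map_smul, Derivation.smul_apply, smul_eq_mul] at h
  rw [← h, dScal_n]
  simp only [map_sum, map_mul, r.normal_eq hcs, r.pd_eq _ _ r.scal_eq]

theorem riemNN_eq (a b : Fin 3) (u : Ω) : riemNN s G a b (r.pt u) =
    r.ev u (𝒢.riem (𝒢.fr a.succ) (𝒢.unitNormal c) (𝒢.fr b.succ) (𝒢.unitNormal c)) := by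
  simp only [riemNN, mul_assoc, ← Finset.mul_sum]
  refine r.sum_normal hcs (t := ((𝒢.riem (𝒢.fr a.succ)).flip (𝒢.fr b.succ)).flip
    (𝒢.unitNormal c)) fun i => ?_
  exact r.sum_normal hcs (t := 𝒢.riem (𝒢.fr a.succ) (𝒢.fr i) (𝒢.fr b.succ))
    fun k => r.riem_eq _ _ _ _ _

variable (hc : c * c * 𝒢.met (𝒢.dual 0) (𝒢.dual 0) = 1)

include hc

theorem secondFF_eq (a b : Fin 3) (u : Ω) :
    secondFF s G a b (r.pt u) = r.ev u (𝒢.shape c (𝒢.fr a.succ) (𝒢.fr b.succ)) := by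
  have h := sum_dual_apply (𝒢 := 𝒢) (𝒢.met.flip (𝒢.unitNormal c))
    (𝒢.nab (𝒢.fr a.succ) (𝒢.fr b.succ))
  simp only [LinearMap.flip_apply] at h
  rw [𝒢.shape_tangential c hc, secondFF, ← h, map_sum]
  refine Finset.sum_congr rfl fun i _ => ?_
  rw [map_mul, ← r.sum_normal hcs (t := 𝒢.met (𝒢.fr i)) (fun j => rfl),
    Finset.mul_sum]
  refine Finset.sum_congr rfl fun j _ => ?_
  rw [r.christoffel_pd_eq, r.metric_eq]
  ring

omit hcs hc in
theorem met_fr_tdual (a b : Fin 3) :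
    𝒢.met (𝒢.fr a.succ) (𝒢.tdual c b) = if a = b then 1 else 0 := by
  rw [LeviCivita.tdual, map_sub, map_smul, LeviCivita.met_fr_succ_unitNormal, 𝒢.met_fr_dual]
  simp

omit hcs in
theorem inv_bmetric_eq (a b : Fin 3) (u : Ω) :
    (bmetric G (r.pt u))⁻¹ a b = r.ev u (𝒢.met (𝒢.tdual c a) (𝒢.tdual c b)) :=
  r.inv_eq (E := fun a : Fin 3 => 𝒢.fr a.succ) (fun i j u => r.metric_eq i.succ j.succ u)
    (fun k => (𝒢.tdual_eq c hc k).symm) (met_fr_tdual) a b u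

theorem meanCurv_eq (u : Ω) : meanCurv s G (r.pt u) = r.ev u (𝒢.meanCurv c) := by
  rw [meanCurv, LeviCivita.meanCurv]
  simp only [map_sum, map_mul, r.inv_bmetric_eq hc, r.secondFF_eq hcs hc]

theorem tensorS_eq (a b : Fin 3) (u : Ω) :
    tensorS s G a b (r.pt u) = r.ev u (𝒢.tensorS c (𝒢.fr a.succ) (𝒢.fr b.succ)) := by
  rw [tensorS, LeviCivita.tensorS_apply, r.divWeyl_eq hcs, r.divWeyl_eq hcs,
    r.normalDerivWeyl_eq hcs, r.weylNN_eq hcs, r.meanCurv_eq hcs hc]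
  simp only [map_add, map_sub, map_mul, r.ev_twelfth, map_ofNat]
  ring

omit hcs in
theorem christoffel_tpd_eq (k i j : Fin 3) (u : Ω) :
    christoffel tpd (bmetric G) k i j (r.pt u) = r.ev u (𝒢.tchr c k i j) :=
  r.christoffel_eq (E := fun a : Fin 3 => 𝒢.fr a.succ) (fun f a h i u => r.pd_eq f a h i.succ u)
    (fun i j u => r.metric_eq i.succ j.succ u) (fun k => (𝒢.tdual_eq c hc k).symm)
    (met_fr_tdual) (fun _ _ => r.nab_comm _ _) k i j u

theorem covL_eq (a b e : Fin 3) (u : Ω) : covL s G a b e (r.pt u) = r.ev u (𝒢.covL c a b e) := by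
  rw [covL, cov2, LeviCivita.covL, tpd]
  simp only [map_sub, map_sum, map_add, map_mul, r.christoffel_tpd_eq hc, r.secondFF_eq hcs hc,
    r.pd_eq _ _ (r.secondFF_eq hcs hc a b)]

theorem covcovL_eq (a b e k : Fin 3) (u : Ω) :
    covcovL s G a b e k (r.pt u) = r.ev u (𝒢.covcovL c a b e k) := by
  rw [covcovL, cov3, LeviCivita.covcovL, tpd]
  simp only [map_sub, map_sum, map_add, map_mul, r.christoffel_tpd_eq hc, r.covL_eq hcs hc,
    r.pd_eq _ _ (r.covL_eq hcs hc a b e)]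

theorem explicitS_eq (a b : Fin 3) (u : Ω) :
    explicitS s G a b (r.pt u) = r.ev u (𝒢.explicitS c a b) := by
  rw [explicitS, LeviCivita.explicitS]
  simp only [map_add, map_sub, map_neg, map_mul, map_sum, r.ev_twelfth, map_ofNat,
    r.dA_tn_t_eq hcs, r.dA_tt_n_eq hcs, r.inv_bmetric_eq hc, r.covcovL_eq hcs hc,
    r.secondFF_eq hcs hc, r.riemNN_eq hcs, r.meanCurv_eq hcs hc, r.riem_eq, r.metric_eq,
    r.weylNN_eq hcs]
  norm_num

end Boundary

end Realization

/-! ### The Levi-Civita connection built from metric coefficients. -/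

namespace LeviCivita

section Coordinates

variable {ι A : Type*} [Fintype ι] [DecidableEq ι] [CommRing A] [Algebra ℝ A]
  (d : ι → Derivation ℝ A A) (g h : Matrix ι ι A)

/-- The derivation along a vector field. -/
def coordDer : (ι → A) →ₗ[A] Derivation ℝ A A where
  toFun X := ∑ i, X i • d i
  map_add' X Y := by simp only [Pi.add_apply, add_smul, Finset.sum_add_distrib]
  map_smul' f X := by
    simp only [Pi.smul_apply, smul_eq_mul, mul_smul, ← Finset.smul_sum, RingHom.id_apply]

omit [DecidableEq ι] in
theorem coordDer_apply (X : ι → A) (f : A) : coordDer d X f = ∑ i, X i * d i f := by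
  have h : ∀ s : Finset ι, (∑ i ∈ s, X i • d i) f = ∑ i ∈ s, X i * d i f := by
    intro s
    induction s using Finset.cons_induction with
    | empty => simp
    | cons a s ha ih =>
      rw [Finset.sum_cons, Finset.sum_cons, Derivation.add_apply, ih, Derivation.smul_apply,
        smul_eq_mul]
  exact h _

/-- The Christoffel symbols. -/
noncomputable def coordChristoffel (k i j : ι) : A :=
  6 * twelfth A * ∑ l, h k l * (d i (g j l) + d j (g i l) - d l (g i j))

/-- The covariant derivative along a coordinate vector field. -/
noncomputable def coordNabla (i : ι) : (ι → A) →+ (ι → A) :=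
  AddMonoidHom.mk' (fun Y k => d i (Y k) + ∑ j, coordChristoffel d g h k i j * Y j)
    (by
      intro Y Z
      ext k
      simp only [Pi.add_apply, map_add, mul_add, Finset.sum_add_distrib]
      ring)

theorem coordNabla_apply (i : ι) (Y : ι → A) (k : ι) : coordNabla d g h i Y k =
    d i (Y k) + ∑ j, coordChristoffel d g h k i j * Y j := rfl

/-- The Levi-Civita connection in coordinates. -/
noncomputable def coordNab : (ι → A) →ₗ[A] ((ι → A) →+ (ι → A)) where
  toFun X := ∑ i, X i • coordNabla d g h i
  map_add' X Y := by simp only [Pi.add_apply, add_smul, Finset.sum_add_distrib]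
  map_smul' f X := by
    simp only [Pi.smul_apply, smul_eq_mul, mul_smul, ← Finset.smul_sum, RingHom.id_apply]

theorem coordNab_apply (X Y : ι → A) (k : ι) : coordNab d g h X Y k =
    coordDer d X (Y k) + ∑ i, ∑ j, X i * (coordChristoffel d g h k i j * Y j) := by
  rw [coordDer_apply]
  change (∑ i, X i • coordNabla d g h i) Y k = _
  rw [AddMonoidHom.finsetSum_apply, Finset.sum_apply, ← Finset.sum_add_distrib]
  refine Finset.sum_congr rfl fun i _ => ?_
  rw [AddMonoidHom.smul_apply, Pi.smul_apply, coordNabla_apply, smul_eq_mul, mul_add,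
    Finset.mul_sum]

/-- The metric in coordinates. -/
def coordMet : (ι → A) →ₗ[A] (ι → A) →ₗ[A] A :=
  LinearMap.mk₂ A (fun X Y => ∑ i, ∑ j, X i * g i j * Y j)
    (by intros; simp only [Pi.add_apply, add_mul, Finset.sum_add_distrib])
    (by intros; simp only [Pi.smul_apply, smul_eq_mul, Finset.mul_sum, mul_assoc])
    (by intros; simp only [Pi.add_apply, mul_add, Finset.sum_add_distrib])
    (by
      intros
      simp only [Pi.smul_apply, smul_eq_mul, Finset.mul_sum]
      exact Finset.sum_congr rfl fun i _ => Finset.sum_congr rfl fun j _ => by ring)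

omit [DecidableEq ι] [Algebra ℝ A] in
theorem coordMet_apply (X Y : ι → A) : coordMet g X Y = ∑ i, ∑ j, X i * g i j * Y j := rfl

variable {d g h}

section

variable (hg : ∀ i j, g i j = g j i)

include hg

theorem coordChristoffel_symm (k i j : ι) :
    coordChristoffel d g h k i j = coordChristoffel d g h k j i := by
  rw [coordChristoffel, coordChristoffel]
  congr 1
  refine Finset.sum_congr rfl fun l _ => ?_
  rw [hg i j]
  ring

/-- Symmetry of the Christoffel symbols cancels the zeroth-order terms, leaving the coordinate
bracket. -/
theorem coordNab_sub (X Y : ι → A) (k : ι) : (coordNab d g h X Y - coordNab d g h Y X) k =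
    coordDer d X (Y k) - coordDer d Y (X k) := by
  rw [Pi.sub_apply, coordNab_apply, coordNab_apply]
  have e : ∑ i, ∑ j, X i * (coordChristoffel d g h k i j * Y j) =
      ∑ i, ∑ j, Y i * (coordChristoffel d g h k i j * X j) := by
    rw [Finset.sum_comm]
    refine Finset.sum_congr rfl fun i _ => Finset.sum_congr rfl fun j _ => ?_
    rw [coordChristoffel_symm hg k j i]
    ring
  rw [e]
  ring

omit hg in
theorem coordDer_comm (hd : ∀ i j f, d i (d j f) = d j (d i f)) (X Y : ι → A) (f : A) :
    coordDer d X (coordDer d Y f) - coordDer d Y (coordDer d X f) =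
      ∑ k, (coordDer d X (Y k) - coordDer d Y (X k)) * d k f := by
  simp only [coordDer_apply, map_sum, Derivation.leibniz, smul_eq_mul, Finset.mul_sum,
    Finset.sum_add_distrib, sub_mul, Finset.sum_sub_distrib, Finset.sum_mul]
  have e : ∑ j, ∑ i, Y j * (X i * d i (d j f)) = ∑ j, ∑ i, X j * (Y i * d i (d j f)) := by
    rw [Finset.sum_comm]
    refine Finset.sum_congr rfl fun i _ => Finset.sum_congr rfl fun j _ => ?_
    rw [hd j i]
    ring
  have e1 : ∀ X Y : ι → A, ∑ j, ∑ i, d j f * (X i * d i (Y j)) =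
      ∑ j, ∑ i, X i * d i (Y j) * d j f := by
    intro X Y
    exact Finset.sum_congr rfl fun i _ => Finset.sum_congr rfl fun j _ => by ring
  rw [e, e1, e1]
  ring

theorem coordMet_symm (X Y : ι → A) : coordMet g X Y = coordMet g Y X := by
  rw [coordMet_apply, coordMet_apply, Finset.sum_comm]
  refine Finset.sum_congr rfl fun i _ => Finset.sum_congr rfl fun j _ => ?_
  rw [hg j i]
  ring

variable (hgh : g * h = 1)

include hgh

/-- Lowering the index gives symbols of the first kind, free of the inverse metric; metric
compatibility then needs no further inverse-matrix identity. -/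
theorem sum_coordChristoffel_mul (k i j : ι) :
    ∑ l, coordChristoffel d g h l i j * g l k =
      6 * twelfth A * (d i (g j k) + d j (g i k) - d k (g i j)) := by
  have e : ∀ l p, ∑ q, g q l * h q p = if l = p then 1 else 0 := by
    intro l p
    rw [← Matrix.one_apply, ← hgh, Matrix.mul_apply]
    exact Finset.sum_congr rfl fun q _ => by rw [hg l q]
  simp only [coordChristoffel, Finset.mul_sum, Finset.sum_mul]
  rw [Finset.sum_comm]
  have e2 : ∀ p, ∑ q, 6 * twelfth A * (h q p * (d i (g j p) + d j (g i p) - d p (g i j))) * g q k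
      = (if k = p then 1 else 0) *
        (6 * twelfth A * (d i (g j p) + d j (g i p) - d p (g i j))) := by
    intro p
    rw [← e, Finset.sum_mul]
    exact Finset.sum_congr rfl fun q _ => by ring
  simp only [e2]
  simp

/-- The two symbols of the first kind that occur add up to ∂_k g_{ij}; the other derivatives of g
cancel in pairs. -/
theorem coordNabla_met (k : ι) (X Y : ι → A) : d k (coordMet g X Y) =
    coordMet g (coordNabla d g h k X) Y + coordMet g X (coordNabla d g h k Y) := by
  have e1 : ∀ X Y : ι → A, coordMet g (coordNabla d g h k X) Y = (∑ p, ∑ j, d k (X p) * g p j * Y j)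
      + ∑ p, ∑ j, X p * (6 * twelfth A * (d k (g p j) + d p (g k j) - d j (g k p))) * Y j := by
    intro X Y
    simp only [coordMet_apply, coordNabla_apply, add_mul, Finset.sum_add_distrib]
    congr 1
    simp only [← sum_coordChristoffel_mul hg hgh, Finset.mul_sum, Finset.sum_mul]
    calc ∑ i, ∑ j, ∑ p, coordChristoffel d g h i k p * X p * g i j * Y j
        = ∑ i, ∑ p, ∑ j, coordChristoffel d g h i k p * X p * g i j * Y j :=
          Finset.sum_congr rfl fun i _ => Finset.sum_comm
      _ = ∑ p, ∑ i, ∑ j, coordChristoffel d g h i k p * X p * g i j * Y j := Finset.sum_comm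
      _ = ∑ p, ∑ j, ∑ i, X p * (coordChristoffel d g h i k p * g i j) * Y j := by
          refine Finset.sum_congr rfl fun p _ => ?_
          rw [Finset.sum_comm]
          exact Finset.sum_congr rfl fun i _ => Finset.sum_congr rfl fun j _ => by ring
  have e2 : ∀ f : ι → ι → A, ∑ p, ∑ j, Y p * f p j * X j = ∑ p, ∑ j, X p * f j p * Y j := by
    intro f
    rw [Finset.sum_comm]
    exact Finset.sum_congr rfl fun i _ => Finset.sum_congr rfl fun j _ => by ring
  have e3 : ∑ p, ∑ j, d k (Y p) * g p j * X j = ∑ p, ∑ j, X p * g p j * d k (Y j) := by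
    rw [Finset.sum_comm]
    refine Finset.sum_congr rfl fun i _ => Finset.sum_congr rfl fun j _ => ?_
    rw [hg j i]
    ring
  rw [coordMet_symm hg X (coordNabla d g h k Y), e1, e1, e2, e3, coordMet_apply]
  simp only [map_sum, Derivation.leibniz, smul_eq_mul, ← Finset.sum_add_distrib]
  refine Finset.sum_congr rfl fun i _ => Finset.sum_congr rfl fun j _ => ?_
  rw [hg j i, hg k j, hg k i]
  linear_combination (-(X i * d k (g i j) * Y j)) * twelfth_spec A

end

/-- The Levi-Civita connection of a metric given by its components. -/
noncomputable def ofMetric (hd : ∀ i j f, d i (d j f) = d j (d i f)) (hg : ∀ i j, g i j = g j i)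
    (hgh : g * h = 1) (hh : ∀ i j, h i j = h j i) : LeviCivita ι A (ι → A) where
  der := coordDer d
  met := coordMet g
  nab := coordNab d g h
  fr i := Pi.single i 1
  dual i := h i
  met_comm X Y := coordMet_symm hg X Y
  nab_smul X f Y := by
    ext k
    simp only [Pi.add_apply, Pi.smul_apply, coordNab_apply, smul_eq_mul, Derivation.leibniz,
      mul_add, Finset.mul_sum]
    have e : ∑ i, ∑ j, X i * (coordChristoffel d g h k i j * (f * Y j)) =
        ∑ i, ∑ j, f * (X i * (coordChristoffel d g h k i j * Y j)) :=
      Finset.sum_congr rfl fun i _ => Finset.sum_congr rfl fun j _ => by ring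
    rw [e]
    ring
  der_met Z X Y := by
    have e : ∀ X, coordNab d g h Z X = ∑ i, Z i • coordNabla d g h i X := by
      intro X
      change (∑ i, Z i • coordNabla d g h i) X = _
      rw [AddMonoidHom.finsetSum_apply]
      rfl
    rw [e, e, coordDer_apply]
    simp only [map_sum, map_smul, LinearMap.sum_apply, LinearMap.smul_apply, smul_eq_mul,
      coordNabla_met hg hgh, mul_add, Finset.sum_add_distrib]
  der_comm X Y f := by
    rw [coordDer_comm hd, ← Derivation.sub_apply, ← map_sub, coordDer_apply]
    simp only [coordNab_sub hg]
  jacobi X Y Z := by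
    -- The derivation along a bracket is the commutator, so each component of the Jacobi identity is
    -- a formal identity of commutators.
    have e : ∀ (X Y : ι → A) (f : A), coordDer d (coordNab d g h X Y - coordNab d g h Y X) f =
        coordDer d X (coordDer d Y f) - coordDer d Y (coordDer d X f) := by
      intro X Y f
      rw [coordDer_comm hd, coordDer_apply]
      simp only [coordNab_sub hg]
    ext k
    rw [Pi.add_apply, Pi.add_apply, coordNab_sub hg X (_ - _), coordNab_sub hg Y (_ - _),
      coordNab_sub hg Z (_ - _), e, e, e, coordNab_sub hg Y Z, coordNab_sub hg Z X,
      coordNab_sub hg X Y]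
    simp only [map_sub, Pi.zero_apply]
    ring
  met_fr_dual i j := by
    rw [coordMet_apply, ← Matrix.one_apply, ← hgh, Matrix.mul_apply,
      Finset.sum_eq_single i (fun p _ hp => by simp [Pi.single_eq_of_ne hp]) (by simp)]
    simp [hh j]
  sum_dual X := by
    ext p
    rw [Finset.sum_apply, Finset.sum_eq_single p (fun q _ hq => by simp [Pi.single_eq_of_ne' hq])
      (by simp)]
    rw [Pi.smul_apply, Pi.single_eq_same, smul_eq_mul, mul_one, coordMet_apply]
    have e : ∀ q, ∑ j, X q * g q j * h p j = if q = p then X q else 0 := by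
      intro q
      have e' : ∑ j, g q j * h p j = if q = p then 1 else 0 := by
        rw [← Matrix.one_apply, ← hgh, Matrix.mul_apply]
        exact Finset.sum_congr rfl fun j _ => by rw [hh p j]
      simp only [mul_assoc, ← Finset.mul_sum, e', mul_ite, mul_one, mul_zero]
    simp [e]

end Coordinates

/-! ### Independence of the chosen frame. -/

section Frame

variable {ι A V : Type*} [Fintype ι] [DecidableEq ι] [CommRing A] [Algebra ℝ A]
  [AddCommGroup V] [Module A V]

/-- The same metric and connection with another frame. -/
def withFrame (𝒢 : LeviCivita ι A V) (E F : ι → V)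
    (hEF : ∀ i j, 𝒢.met (E i) (F j) = if i = j then 1 else 0)
    (hF : ∀ X, ∑ i, 𝒢.met X (F i) • E i = X) : LeviCivita ι A V :=
  { 𝒢 with fr := E, dual := F, met_fr_dual := hEF, sum_dual := hF }

theorem withFrame_ric (𝒢 : LeviCivita ι A V) (E F : ι → V) (hEF) (hF) :
    (𝒢.withFrame E F hEF hF).ric = 𝒢.ric := by
  ext X Y
  exact (trace_eq_trace 𝒢.met (slot13 𝒢.riem X Y) 𝒢.met_comm hF 𝒢.sum_fr).symm

theorem withFrame_scal (𝒢 : LeviCivita ι A V) (E F : ι → V) (hEF) (hF) :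
    (𝒢.withFrame E F hEF hF).scal = 𝒢.scal := by
  rw [scal, withFrame_ric]
  exact (trace_eq_trace 𝒢.met 𝒢.ric 𝒢.met_comm hF 𝒢.sum_fr).symm

theorem withFrame_weyl (𝒢 : LeviCivita ι A V) (E F : ι → V) (hEF) (hF) :
    (𝒢.withFrame E F hEF hF).weyl = 𝒢.weyl := by
  have h : (𝒢.withFrame E F hEF hF).sch = 𝒢.sch := by
    rw [sch, withFrame_ric, withFrame_scal]
    rfl
  rw [weyl]
  simp only [h]
  rfl

theorem withFrame_div4_weyl (𝒢 : LeviCivita ι A V) (E F : ι → V) (hEF) (hF) (X Y Z : V) :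
    (𝒢.withFrame E F hEF hF).div4 (𝒢.withFrame E F hEF hF).weyl X Y Z = 𝒢.div4 𝒢.weyl X Y Z := by
  rw [withFrame_weyl]
  exact (trace_eq_trace 𝒢.met (𝒢.divForm 𝒢.weyl X Y Z) 𝒢.met_comm hF 𝒢.sum_fr).symm

end Frame

end LeviCivita

/-! ### Smooth functions and metrics on relatively open sets of the half-space. -/

open BoundaryTensor

/-- A relatively open subset of the half-space. -/
structure HalfOpen where
  carrier : Set E4
  subset : carrier ⊆ range (𝓡∂ 4)
  mem_nhdsWithin : ∀ y ∈ carrier, carrier ∈ nhdsWithin y (range (𝓡∂ 4))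

namespace HalfOpen

variable (U : HalfOpen)

theorem nhdsWithin_eq {y : E4} (hy : y ∈ U.carrier) :
    nhdsWithin y U.carrier = nhdsWithin y (range (𝓡∂ 4)) :=
  le_antisymm (nhdsWithin_mono _ U.subset)
    (nhdsWithin_le_of_mem (U.mem_nhdsWithin y hy))

theorem uniqueDiffWithinAt {y : E4} (hy : y ∈ U.carrier) :
    UniqueDiffWithinAt ℝ (range (𝓡∂ 4)) y := (𝓡∂ 4).uniqueDiffOn y (U.subset hy)

theorem uniqueDiffOn : UniqueDiffOn ℝ U.carrier := fun _ hy =>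
  (U.uniqueDiffWithinAt hy).mono_nhds (U.nhdsWithin_eq hy).ge

theorem differentiableWithinAt {F : E4 → ℝ} (hF : ContDiffOn ℝ ∞ F U.carrier) {y : E4}
    (hy : y ∈ U.carrier) : DifferentiableWithinAt ℝ F (range (𝓡∂ 4)) y :=
  ((hF y hy).differentiableWithinAt (by simp)).mono_of_mem_nhdsWithin
    (U.mem_nhdsWithin y hy)

theorem fderivWithin_eq {E' : Type*} [NormedAddCommGroup E'] [NormedSpace ℝ E'] (F : E4 → E')
    {y : E4} (hy : y ∈ U.carrier) :
    fderivWithin ℝ F U.carrier y = fderivWithin ℝ F (range (𝓡∂ 4)) y := by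
  have h := U.nhdsWithin_eq hy
  apply fderivWithin_congr_set
  exact nhdsWithin_eq_iff_eventuallyEq.mp h

theorem pd_congr {F F' : E4 → ℝ} (h : ∀ y ∈ U.carrier, F y = F' y) (i : Fin 4) {y : E4}
    (hy : y ∈ U.carrier) : pd i F y = pd i F' y := by
  rw [pd, pd, Filter.EventuallyEq.fderivWithin_eq (f₁ := F) (f := F') _ (h y hy)]
  filter_upwards [U.mem_nhdsWithin y hy] with z hz using h z hz

theorem contDiffOn_pd {F : E4 → ℝ} (hF : ContDiffOn ℝ ∞ F U.carrier) (i : Fin 4) :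
    ContDiffOn ℝ ∞ (pd i F) U.carrier := by
  have h : ContDiffOn ℝ ∞ (fun y => fderivWithin ℝ F U.carrier y (EuclideanSpace.single i 1))
      U.carrier := (hF.fderivWithin U.uniqueDiffOn (by simp)).clm_apply contDiffOn_const
  refine h.congr fun y hy => ?_
  rw [U.fderivWithin_eq F hy]
  rfl

theorem mem_closure_interior {y : E4} (hy : y ∈ range (𝓡∂ 4)) :
    y ∈ closure (interior (range (𝓡∂ 4))) :=
  (𝓡∂ 4).range_subset_closure_interior hy

/-- One-sided second derivatives commute at boundary points as well, because every point of the
half-space is a limit of interior points. -/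
theorem pd_comm {F : E4 → ℝ} (hF : ContDiffOn ℝ ∞ F U.carrier) (i j : Fin 4) {y : E4}
    (hy : y ∈ U.carrier) : pd i (pd j F) y = pd j (pd i F) y := by
  have hs : IsSymmSndFDerivWithinAt ℝ F (range (𝓡∂ 4)) y :=
    ((hF y hy).mono_of_mem_nhdsWithin (U.mem_nhdsWithin y hy)).isSymmSndFDerivWithinAt
      (by rw [minSmoothness_of_isRCLikeNormedField]; exact WithTop.coe_le_coe.mpr le_top)
      (𝓡∂ 4).uniqueDiffOn (mem_closure_interior (U.subset hy)) (U.subset hy)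
  have hd : DifferentiableWithinAt ℝ (fderivWithin ℝ F (range (𝓡∂ 4))) (range (𝓡∂ 4)) y := by
    have h1 := (hF.fderivWithin U.uniqueDiffOn (m := ∞) (by simp)).congr
      (f₁ := fderivWithin ℝ F (range (𝓡∂ 4))) fun z hz => (U.fderivWithin_eq F hz).symm
    exact ((h1 y hy).differentiableWithinAt (by simp)).mono_of_mem_nhdsWithin
      (U.mem_nhdsWithin y hy)
  have e : ∀ i j : Fin 4, pd i (pd j F) y = fderivWithin ℝ (fderivWithin ℝ F (range (𝓡∂ 4)))
      (range (𝓡∂ 4)) y (EuclideanSpace.single i 1) (EuclideanSpace.single j 1) := by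
    intro i j
    have h2 := fderivWithin_clm_apply (U.uniqueDiffWithinAt hy) hd
      (differentiableWithinAt_const (EuclideanSpace.single j (1 : ℝ)))
    change fderivWithin ℝ (fun z => fderivWithin ℝ F (range (𝓡∂ 4)) z
      (EuclideanSpace.single j 1)) (range (𝓡∂ 4)) y (EuclideanSpace.single i 1) = _
    rw [h2]
    simp
  rw [e, e]
  exact hs _ _

/-- The smooth functions on a relatively open subset of the half-space. -/
def smooth : Subalgebra ℝ (U.carrier → ℝ) where
  carrier := {f | ∃ F : E4 → ℝ, ContDiffOn ℝ ∞ F U.carrier ∧ ∀ u : U.carrier, F u = f u}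
  mul_mem' := by
    rintro f f' ⟨F, hF, hf⟩ ⟨F', hF', hf'⟩
    exact ⟨fun y => F y * F' y, hF.mul hF', fun u => by simp [hf, hf']⟩
  add_mem' := by
    rintro f f' ⟨F, hF, hf⟩ ⟨F', hF', hf'⟩
    exact ⟨fun y => F y + F' y, hF.add hF', fun u => by simp [hf, hf']⟩
  algebraMap_mem' c := ⟨fun _ => c, contDiffOn_const, fun _ => rfl⟩

/-- An extension of a smooth function to the whole space. -/
noncomputable def ext (a : U.smooth) : E4 → ℝ := a.2.choose

theorem contDiffOn_ext (a : U.smooth) : ContDiffOn ℝ ∞ (U.ext a) U.carrier := a.2.choose_spec.1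

theorem ext_apply (a : U.smooth) (u : U.carrier) : U.ext a u = a.1 u := a.2.choose_spec.2 u

/-- The smooth function given by a smooth function on the whole space. -/
def ofFun (F : E4 → ℝ) (hF : ContDiffOn ℝ ∞ F U.carrier) : U.smooth :=
  ⟨fun u => F u, F, hF, fun _ => rfl⟩

/-- The coordinate derivations on smooth functions. -/
noncomputable def deriv (i : Fin 4) : Derivation ℝ U.smooth U.smooth where
  toFun a := U.ofFun (pd i (U.ext a)) (U.contDiffOn_pd (U.contDiffOn_ext a) i)
  map_add' a b := by
    ext u
    change pd i (U.ext (a + b)) u = pd i (U.ext a) u + pd i (U.ext b) u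
    -- Extensions are chosen arbitrarily, so they are additive only on the carrier; one-sided
    -- derivatives see nothing else. The other derivation axioms use the same device.
    rw [U.pd_congr (F' := fun y => U.ext a y + U.ext b y) (fun y hy => by
      rw [U.ext_apply _ ⟨y, hy⟩, U.ext_apply a ⟨y, hy⟩, U.ext_apply b ⟨y, hy⟩]; rfl) i u.2]
    rw [pd, fderivWithin_fun_add (U.uniqueDiffWithinAt u.2)
      (U.differentiableWithinAt (U.contDiffOn_ext a) u.2)
      (U.differentiableWithinAt (U.contDiffOn_ext b) u.2)]
    rfl
  map_smul' c a := by
    ext u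
    change pd i (U.ext (c • a)) u = c * pd i (U.ext a) u
    rw [U.pd_congr (F' := fun y => c * U.ext a y) (fun y hy => by
      rw [U.ext_apply _ ⟨y, hy⟩, U.ext_apply a ⟨y, hy⟩]; rfl) i u.2]
    rw [pd, fderivWithin_const_mul (U.uniqueDiffWithinAt u.2)
      (U.differentiableWithinAt (U.contDiffOn_ext a) u.2)]
    rfl
  map_one_eq_zero' := by
    ext u
    change pd i (U.ext 1) u = 0
    rw [U.pd_congr (F' := fun _ => 1) (fun y hy => by rw [U.ext_apply _ ⟨y, hy⟩]; rfl) i u.2]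
    simp [pd]
  leibniz' a b := by
    ext u
    change pd i (U.ext (a * b)) u = a.1 u * pd i (U.ext b) u + b.1 u * pd i (U.ext a) u
    rw [U.pd_congr (F' := fun y => U.ext a y * U.ext b y) (fun y hy => by
      rw [U.ext_apply _ ⟨y, hy⟩, U.ext_apply a ⟨y, hy⟩, U.ext_apply b ⟨y, hy⟩]; rfl) i u.2]
    rw [pd, fderivWithin_fun_mul (U.uniqueDiffWithinAt u.2)
      (U.differentiableWithinAt (U.contDiffOn_ext a) u.2)
      (U.differentiableWithinAt (U.contDiffOn_ext b) u.2), ← U.ext_apply a, ← U.ext_apply b]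
    rfl

theorem pd_eq {F : E4 → ℝ} {a : U.smooth} (h : ∀ u : U.carrier, F u = a.1 u) (i : Fin 4)
    (u : U.carrier) : pd i F u = (U.deriv i a).1 u :=
  U.pd_congr (F' := U.ext a) (fun y hy => by rw [h ⟨y, hy⟩, U.ext_apply a ⟨y, hy⟩]) i u.2

theorem deriv_comm (i j : Fin 4) (a : U.smooth) :
    U.deriv i (U.deriv j a) = U.deriv j (U.deriv i a) := by
  ext u
  rw [← U.pd_eq (F := pd j (U.ext a)) (fun _ => rfl), ← U.pd_eq (F := pd i (U.ext a)) (fun _ => rfl)]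
  exact U.pd_comm (U.contDiffOn_ext a) i j u.2

/-- Evaluation at a point. -/
def eval (u : U.carrier) : U.smooth →ₐ[ℝ] ℝ := (Pi.evalAlgHom ℝ (fun _ => ℝ) u).comp U.smooth.val

theorem eval_ext {a b : U.smooth} (h : ∀ u, U.eval u a = U.eval u b) : a = b :=
  Subtype.ext (funext h)

theorem exists_inv {a : U.smooth} (h : ∀ u, U.eval u a ≠ 0) : ∃ b : U.smooth, a * b = 1 := by
  refine ⟨U.ofFun (fun y => (U.ext a y)⁻¹) ((U.contDiffOn_ext a).inv fun y hy => ?_), ?_⟩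
  · rw [U.ext_apply a ⟨y, hy⟩]
    exact h _
  · apply U.eval_ext
    intro u
    change a.1 u * (U.ext a u)⁻¹ = 1
    rw [U.ext_apply]
    exact mul_inv_cancel₀ (h u)

/-- With t = ±1 and a = |dx₀|² this provides the normalising factor of the unit normal. -/
theorem exists_div_sqrt {a : U.smooth} (h : ∀ u, 0 < U.eval u a) (t : ℝ) :
    ∃ b : U.smooth, ∀ u, U.eval u b = t / Real.sqrt (U.eval u a) := by
  have hpos : ∀ y ∈ U.carrier, 0 < U.ext a y := fun y hy => by
    rw [U.ext_apply a ⟨y, hy⟩]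
    exact h _
  refine ⟨U.ofFun (fun y => t / Real.sqrt (U.ext a y)) (contDiffOn_const.div
    ((U.contDiffOn_ext a).sqrt fun y hy => (hpos y hy).ne')
    fun y hy => (Real.sqrt_pos.mpr (hpos y hy)).ne'), fun u => ?_⟩
  change t / Real.sqrt (U.ext a u) = _
  rw [U.ext_apply]
  rfl

/-- A metric on a relatively open subset of the half-space. -/
structure IsMetric (G : E4 → Matrix (Fin 4) (Fin 4) ℝ) : Prop where
  smooth : ∀ i j, ContDiffOn ℝ ∞ (fun y => G y i j) U.carrier
  posDef : ∀ y ∈ U.carrier, (G y).PosDef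

variable {U} {G : E4 → Matrix (Fin 4) (Fin 4) ℝ} (hG : U.IsMetric G)

/-- The matrix of metric coefficients. -/
def IsMetric.coeffs : Matrix (Fin 4) (Fin 4) U.smooth :=
  Matrix.of fun i j => U.ofFun (fun y => G y i j) (hG.smooth i j)

theorem IsMetric.map_coeffs (u : U.carrier) : (U.eval u).mapMatrix hG.coeffs = G u := rfl

/-- A nowhere vanishing smooth function is a unit, so the inverse matrix over the ring of smooth
functions is a true inverse. -/
theorem IsMetric.isUnit_det : IsUnit hG.coeffs.det := by
  obtain ⟨b, hb⟩ := U.exists_inv (a := hG.coeffs.det) fun u => by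
    rw [AlgHom.map_det, hG.map_coeffs]
    exact (hG.posDef u u.2).det_pos.ne'
  exact IsUnit.of_mul_eq_one b hb

theorem IsMetric.coeffs_symm (i j : Fin 4) : hG.coeffs i j = hG.coeffs j i := by
  apply U.eval_ext
  intro u
  have h := (hG.posDef u u.2).isHermitian.apply i j
  exact h.symm

theorem IsMetric.inv_symm (i j : Fin 4) : hG.coeffs⁻¹ i j = hG.coeffs⁻¹ j i := by
  have h : hG.coeffsᵀ = hG.coeffs := Matrix.ext fun i j => hG.coeffs_symm j i
  have h' := Matrix.transpose_nonsing_inv hG.coeffs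
  rw [h] at h'
  exact congrFun (congrFun h' j) i

/-- The Levi-Civita connection over the smooth functions. -/
noncomputable def IsMetric.leviCivita : LeviCivita (Fin 4) U.smooth (Fin 4 → U.smooth) :=
  LeviCivita.ofMetric (d := U.deriv) (g := hG.coeffs) (h := hG.coeffs⁻¹) U.deriv_comm
    hG.coeffs_symm (Matrix.mul_nonsing_inv _ hG.isUnit_det) hG.inv_symm

theorem IsMetric.der_fr (i : Fin 4) (a : U.smooth) :
    hG.leviCivita.der (hG.leviCivita.fr i) a = U.deriv i a := by
  change LeviCivita.coordDer U.deriv (Pi.single i 1) a = _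
  rw [LeviCivita.coordDer_apply, Finset.sum_eq_single i
    (fun j _ hj => by rw [Pi.single_eq_of_ne hj, zero_mul])
    (fun h => absurd (Finset.mem_univ i) h), Pi.single_eq_same, one_mul]

theorem IsMetric.met_fr (i j : Fin 4) :
    hG.leviCivita.met (hG.leviCivita.fr i) (hG.leviCivita.fr j) = hG.coeffs i j := by
  change LeviCivita.coordMet hG.coeffs (Pi.single i 1) (Pi.single j 1) = _
  rw [LeviCivita.coordMet_apply, Finset.sum_eq_single i
    (fun p _ hp => by simp [Pi.single_eq_of_ne hp])
    (fun h => absurd (Finset.mem_univ i) h), Finset.sum_eq_single j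
    (fun p _ hp => by simp [Pi.single_eq_of_ne hp])
    (fun h => absurd (Finset.mem_univ j) h)]
  simp

theorem IsMetric.nab_comm_of_der_comm {X Y : Fin 4 → U.smooth}
    (h : ∀ k, hG.leviCivita.der X (Y k) = hG.leviCivita.der Y (X k)) :
    hG.leviCivita.nab X Y = hG.leviCivita.nab Y X := by
  rw [← sub_eq_zero]
  ext1 k
  have e := LeviCivita.coordNab_sub (d := U.deriv) (h := hG.coeffs⁻¹) hG.coeffs_symm X Y k
  exact e.trans (sub_eq_zero.mpr (h k))

/-- Elements of the ring of smooth functions are interpreted as themselves. -/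
noncomputable def IsMetric.realization : Realization hG.leviCivita G U.carrier where
  pt := Subtype.val
  ev := U.eval
  pd_eq f a h i u := by
    rw [hG.der_fr]
    exact U.pd_eq h i u
  metric_eq i j u := by
    rw [hG.met_fr]
    rfl
  nab_comm i j := hG.nab_comm_of_der_comm fun k => by
    rw [hG.der_fr, hG.der_fr]
    have e : ∀ i : Fin 4, hG.leviCivita.fr i k = if k = i then 1 else 0 := fun i =>
      Pi.single_apply i 1 k
    rw [e, e]
    split_ifs <;> simp

/-- Stated for any realization, because it is applied both in a chart and to the frame of a second
chart over the same ring. -/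
theorem exists_normal {A V : Type*} [CommRing A] [Algebra ℝ A] [AddCommGroup V] [Module A V]
    {𝒢 : LeviCivita (Fin 4) A V} {Ω : Type*} (r : Realization 𝒢 G Ω)
    (hA : ∀ a : A, (∀ u, 0 < r.ev u a) → ∀ t : ℝ,
      ∃ b : A, ∀ u, r.ev u b = t / Real.sqrt (r.ev u a))
    (hinj : ∀ a b : A, (∀ u, r.ev u a = r.ev u b) → a = b)
    (hpos : ∀ u, (G (r.pt u)).PosDef) (s : ℤˣ) :
    ∃ c : A, c * c * 𝒢.met (𝒢.dual 0) (𝒢.dual 0) = 1 ∧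
      ∀ u, r.ev u c = ((s : ℤ) : ℝ) / Real.sqrt ((G (r.pt u))⁻¹ 0 0) := by
  have h0 : ∀ u, 0 < r.ev u (𝒢.met (𝒢.dual 0) (𝒢.dual 0)) := by
    intro u
    rw [← r.inv_metric_eq]
    exact (hpos u).inv.diag_pos
  obtain ⟨c, hc⟩ := hA _ h0 ((s : ℤ) : ℝ)
  refine ⟨c, hinj _ _ fun u => ?_, fun u => by rw [hc, r.inv_metric_eq]⟩
  have hs : ((s : ℤ) : ℝ) * ((s : ℤ) : ℝ) = 1 := by
    rcases Int.units_eq_one_or s with h | h <;> simp [h]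
  rw [map_mul, map_mul, hc, map_one, div_mul_div_comm, Real.mul_self_sqrt (h0 u).le, hs,
    one_div, inv_mul_cancel₀ (h0 u).ne']

end HalfOpen

/-! ### Charts, overlaps and the metric in coordinates. -/

namespace BoundaryTensor

open Bundle

/-- The coordinates, in the chart `e`, of the points in the domains of both `e` and `e'`. -/
def overlap {X : Type*} [TopologicalSpace X] (e e' : OpenPartialHomeomorph X H4) : HalfOpen where
  carrier := ((𝓡∂ 4).extendCoordChange e e').source
  subset := inter_subset_left.trans e.extend_target_subset_range
  mem_nhdsWithin _ hy := (𝓡∂ 4).extendCoordChange_source_mem_nhdsWithin hy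

variable {X : Type*} [TopologicalSpace X] {e e' : OpenPartialHomeomorph X H4}

theorem overlap_subset : (overlap e e').carrier ⊆ (e.extend (𝓡∂ 4)).target := inter_subset_left

theorem symm_mem_source {y : E4} (hy : y ∈ (overlap e e').carrier) :
    (e.extend (𝓡∂ 4)).symm y ∈ e'.source := by
  have h := hy.2
  rwa [mem_preimage, OpenPartialHomeomorph.extend_source] at h

theorem symm_mem_source_self {y : E4} (hy : y ∈ (overlap e e').carrier) :
    (e.extend (𝓡∂ 4)).symm y ∈ e.source := by
  have h := (e.extend (𝓡∂ 4)).map_target (overlap_subset hy)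
  rwa [OpenPartialHomeomorph.extend_source] at h

theorem extend_mem_overlap {p : X} (hp : p ∈ e.source) (hp' : p ∈ e'.source) :
    e.extend (𝓡∂ 4) p ∈ (overlap e e').carrier := by
  change _ ∈ ((𝓡∂ 4).extendCoordChange e e').source
  rw [← OpenPartialHomeomorph.extend_image_source_inter]
  exact mem_image_of_mem _ ⟨hp, hp'⟩

/-- The change of coordinates from `e` to `e'`. -/
noncomputable def coordChange (e e' : OpenPartialHomeomorph X H4) (y : E4) : E4 :=
  e'.extend (𝓡∂ 4) ((e.extend (𝓡∂ 4)).symm y)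

theorem symm_coordChange {y : E4} (hy : y ∈ (overlap e e').carrier) :
    (e'.extend (𝓡∂ 4)).symm (coordChange e e' y) = (e.extend (𝓡∂ 4)).symm y :=
  e'.extend_left_inv (symm_mem_source hy)

theorem coordChange_extend {p : X} (hp : p ∈ e.source) :
    coordChange e e' (e.extend (𝓡∂ 4) p) = e'.extend (𝓡∂ 4) p := by
  rw [coordChange, e.extend_left_inv hp]

theorem coordChange_mem {y : E4} (hy : y ∈ (overlap e e').carrier) :
    coordChange e e' y ∈ (overlap e' e).carrier :=
  extend_mem_overlap (symm_mem_source hy) (symm_mem_source_self hy)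

theorem coordChange_coordChange {y : E4} (hy : y ∈ (overlap e e').carrier) :
    coordChange e' e (coordChange e e' y) = y := by
  rw [coordChange, symm_coordChange hy]
  exact (e.extend (𝓡∂ 4)).right_inv (overlap_subset hy)

theorem sum_smul_bilinear {V : Type*} [AddCommGroup V] [Module ℝ V] [TopologicalSpace V]
    (B : V →L[ℝ] V →L[ℝ] ℝ) (a b : Fin 4 → ℝ) (v w : Fin 4 → V) :
    B (∑ k, a k • v k) (∑ l, b l • w l) = ∑ k, ∑ l, a k * b l * B (v k) (w l) := by
  simp only [map_sum, map_smul, _root_.sum_apply, _root_.smul_apply, smul_eq_mul, Finset.mul_sum]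
  rw [Finset.sum_comm]
  refine Finset.sum_congr rfl fun i _ => Finset.sum_congr rfl fun j _ => ?_
  ring

variable [ChartedSpace H4 X] [IsManifold (𝓡∂ 4) ∞ X]
  (he : e ∈ IsManifold.maximalAtlas (𝓡∂ 4) ∞ X) (he' : e' ∈ IsManifold.maximalAtlas (𝓡∂ 4) ∞ X)

include he

theorem contMDiffOn_symm : ContMDiffOn 𝓘(ℝ, E4) (𝓡∂ 4) ∞ (e.extend (𝓡∂ 4)).symm
    (overlap e e').carrier := by
  refine (contMDiffOn_extend_symm he).mono ?_
  rw [← e.extend_target']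
  exact overlap_subset

theorem hasMFDerivWithinAt_symm {y : E4} (hy : y ∈ (overlap e e').carrier) :
    HasMFDerivWithinAt 𝓘(ℝ, E4) (𝓡∂ 4) (e.extend (𝓡∂ 4)).symm (range (𝓡∂ 4)) y
      (mfderivWithin 𝓘(ℝ, E4) (𝓡∂ 4) (e.extend (𝓡∂ 4)).symm (range (𝓡∂ 4)) y) :=
  (((contMDiffOn_symm he y hy).mdifferentiableWithinAt (by simp)).mono_of_mem_nhdsWithin
    ((overlap e e').mem_nhdsWithin y hy)).hasMFDerivWithinAt

/-- The coordinate field is the tangent map of the inverse chart applied to a constant vector field.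
-/
theorem contMDiffOn_coordVec (i : Fin 4) :
    ContMDiffOn 𝓘(ℝ, E4) ((𝓡∂ 4).prod 𝓘(ℝ, E4)) ∞
      (fun y => TotalSpace.mk' E4 (E := fun x : X => TangentSpace (𝓡∂ 4) x)
        ((e.extend (𝓡∂ 4)).symm y) (coordVec e i y)) (overlap e e').carrier := by
  have h1 := (contMDiffOn_symm (e' := e') he).contMDiffOn_tangentMapWithin (m := ∞) (by simp)
    (overlap e e').uniqueDiffOn.uniqueMDiffOn
  have h2 : ContMDiffOn 𝓘(ℝ, E4) (𝓘(ℝ, E4).prod 𝓘(ℝ, E4)) ∞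
      (fun y : E4 => TotalSpace.mk' E4 (E := fun x : E4 => TangentSpace 𝓘(ℝ, E4) x)
        y (EuclideanSpace.single i (1 : ℝ))) (overlap e e').carrier :=
    contMDiffOn_vectorSpace_iff_contDiffOn.2 contDiffOn_const
  have h3 := h1.comp h2 (fun y hy => hy)
  refine h3.congr fun y hy => ?_
  have h4 : mfderivWithin 𝓘(ℝ, E4) (𝓡∂ 4) (e.extend (𝓡∂ 4)).symm (overlap e e').carrier y =
      mfderivWithin 𝓘(ℝ, E4) (𝓡∂ 4) (e.extend (𝓡∂ 4)).symm (range (𝓡∂ 4)) y :=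
    ((hasMFDerivWithinAt_symm he hy).mono (overlap e e').subset).mfderivWithin
      ((overlap e e').uniqueDiffOn.uniqueMDiffOn y hy)
  simp only [Function.comp, tangentMapWithin, h4]
  rfl

theorem contDiffOn_coeff (g : Metric4 X) (i j : Fin 4) :
    ContDiffOn ℝ ∞ (fun y => coeff g e y i j) (overlap e e').carrier := by
  rw [← contMDiffOn_iff_contDiffOn]
  intro y hy
  have hb := contMDiffOn_symm he y hy
  have : ContMDiffWithinAt 𝓘(ℝ, E4) ((𝓡∂ 4).prod 𝓘(ℝ)) ∞
      (fun m ↦ TotalSpace.mk' ℝ (E := Bundle.Trivial X ℝ) ((e.extend (𝓡∂ 4)).symm m)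
        (g.inner ((e.extend (𝓡∂ 4)).symm m) (coordVec e i m) (coordVec e j m)))
        (overlap e e').carrier y := by
    apply ContMDiffWithinAt.clm_bundle_apply₂ (F₁ := E4) (F₂ := E4)
    · exact ContMDiffAt.comp_contMDiffWithinAt y g.contMDiff.contMDiffAt hb
    · exact contMDiffOn_coordVec he i y hy
    · exact contMDiffOn_coordVec he j y hy
  simp only [Bundle.contMDiffWithinAt_totalSpace] at this
  exact this.2

omit he in
theorem sum_coordVec (y : E4) (v : Fin 4 → ℝ) :
    ∑ i, v i • coordVec e i y = mfderivWithin 𝓘(ℝ, E4) (𝓡∂ 4) (e.extend (𝓡∂ 4)).symm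
      (range (𝓡∂ 4)) y (WithLp.toLp 2 v) := by
  have h : (WithLp.toLp 2 v : E4) = ∑ i, v i • EuclideanSpace.single i (1 : ℝ) := by
    ext j
    rw [WithLp.ofLp_sum, Finset.sum_apply, Finset.sum_eq_single j]
    · simp
    · intro i _ hi
      simp [show j ≠ i from hi.symm]
    · exact fun h => absurd (Finset.mem_univ j) h
  rw [h]
  exact ((map_sum (mfderivWithin 𝓘(ℝ, E4) (𝓡∂ 4) (e.extend (𝓡∂ 4)).symm (range (𝓡∂ 4)) y)
    _ _).trans (Finset.sum_congr rfl fun i _ => map_smul _ _ _)).symm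

include he'

theorem contDiffOn_coordChange :
    ContDiffOn ℝ ∞ (coordChange e e') (overlap e e').carrier :=
  (𝓡∂ 4).contDiffOn_extendCoordChange he he'

theorem hasFDerivWithinAt_coordChange {y : E4} (hy : y ∈ (overlap e e').carrier) :
    HasFDerivWithinAt (coordChange e e') (fderivWithin ℝ (coordChange e e') (range (𝓡∂ 4)) y)
      (range (𝓡∂ 4)) y :=
  (((contDiffOn_coordChange he he' y hy).differentiableWithinAt
    (by simp)).mono_of_mem_nhdsWithin
      ((overlap e e').mem_nhdsWithin y hy)).hasFDerivWithinAt

theorem mfderivWithin_symm_apply {y : E4} (hy : y ∈ (overlap e e').carrier) (v : E4) :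
    (mfderivWithin 𝓘(ℝ, E4) (𝓡∂ 4) (e.extend (𝓡∂ 4)).symm (range (𝓡∂ 4)) y v : E4) =
      mfderivWithin 𝓘(ℝ, E4) (𝓡∂ 4) (e'.extend (𝓡∂ 4)).symm (range (𝓡∂ 4)) (coordChange e e' y)
        (fderivWithin ℝ (coordChange e e') (range (𝓡∂ 4)) y v) := by
  have h1 := hasMFDerivWithinAt_symm (e' := e) he' (coordChange_mem hy)
  have h2 := (hasFDerivWithinAt_coordChange he he' hy).hasMFDerivWithinAt.mono
    (overlap e e').subset
  have h3 := h1.comp y h2 fun z hz => (overlap e' e).subset (coordChange_mem hz)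
  have h4 := (hasMFDerivWithinAt_symm he hy).mono (overlap e e').subset
  have h5 := h4.congr_mono (t := (overlap e e').carrier) (fun z hz => symm_coordChange hz)
    (symm_coordChange hy) subset_rfl
  have h6 := ((overlap e e').uniqueDiffOn.uniqueMDiffOn y hy).eq h5 h3
  exact congrArg (fun L : E4 →L[ℝ] E4 => L v) h6

theorem jac_eq {y : E4} (hy : y ∈ (overlap e e').carrier) (i j : Fin 4) : jac e e' i j y =
    fderivWithin ℝ (coordChange e e') (range (𝓡∂ 4)) y (EuclideanSpace.single j 1) i := by
  have h := (EuclideanSpace.proj (𝕜 := ℝ) i).hasFDerivAt.comp_hasFDerivWithinAt y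
    (hasFDerivWithinAt_coordChange he he' hy)
  have h' := h.fderivWithin ((overlap e e').uniqueDiffWithinAt hy)
  exact congrArg (fun L : E4 →L[ℝ] ℝ => L (EuclideanSpace.single j 1)) h'

theorem coeff_transform (g : Metric4 X) {y : E4} (hy : y ∈ (overlap e e').carrier) (i j : Fin 4) :
    coeff g e y i j = ∑ k, ∑ l, jac e e' k i y * jac e e' l j y *
      coeff g e' (coordChange e e' y) k l := by
  have h : ∀ i, coordVec e i y = ∑ k, jac e e' k i y • coordVec e' k (coordChange e e' y) := by
    intro i
    rw [sum_coordVec]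
    refine (mfderivWithin_symm_apply he he' hy _).trans ?_
    refine congrArg (mfderivWithin 𝓘(ℝ, E4) (𝓡∂ 4) (e'.extend (𝓡∂ 4)).symm (range (𝓡∂ 4))
      (coordChange e e' y)) (PiLp.ext fun k => ?_)
    exact (jac_eq he he' hy k i).symm
  have h' : ∀ (p p' : X), p = p' → ∀ v w : E4, g.inner p v w = g.inner p' v w := by
    rintro p _ rfl v w
    rfl
  refine (h' _ _ (symm_coordChange hy).symm _ _).trans ?_
  rw [h, h]
  exact sum_smul_bilinear (g.inner _) _ _ _ _

omit he' in
-- The derivative of the chart is a left inverse, by the chain rule. Positive definiteness of the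
-- coefficient matrix needs this injectivity.
theorem mfderivWithin_symm_injective {y : E4} (hy : y ∈ (overlap e e').carrier) :
    Function.Injective (mfderivWithin 𝓘(ℝ, E4) (𝓡∂ 4) (e.extend (𝓡∂ 4)).symm
      (range (𝓡∂ 4)) y) := by
  have h1 := ((e.contMDiffAt_extend he (symm_mem_source_self hy)).mdifferentiableAt
    (by simp)).hasMFDerivAt
  have h2 := (hasMFDerivWithinAt_symm he hy).mono (overlap e e').subset
  have h3 := h1.comp_hasMFDerivWithinAt y h2
  have h4 := h3.congr_mono (f₁ := id) (t := (overlap e e').carrier)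
    (fun z hz => ((e.extend (𝓡∂ 4)).right_inv (overlap_subset hz)).symm)
    ((e.extend (𝓡∂ 4)).right_inv (overlap_subset hy)).symm subset_rfl
  let L : E4 →L[ℝ] E4 := mfderiv (𝓡∂ 4) 𝓘(ℝ, E4) (e.extend (𝓡∂ 4)) ((e.extend (𝓡∂ 4)).symm y)
  let M : E4 →L[ℝ] E4 := mfderivWithin 𝓘(ℝ, E4) (𝓡∂ 4) (e.extend (𝓡∂ 4)).symm (range (𝓡∂ 4)) y
  have h5 : HasFDerivWithinAt (id : E4 → E4) (L.comp M) (overlap e e').carrier y :=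
    hasMFDerivWithinAt_iff_hasFDerivWithinAt.1 h4
  have h6 := ((overlap e e').uniqueDiffOn y hy).eq h5 (hasFDerivWithinAt_id y _)
  intro v w hvw
  have h7 : ∀ v : E4, L (M v) = v := fun v => congrArg (fun L : E4 →L[ℝ] E4 => L v) h6
  exact (h7 v).symm.trans ((congrArg L hvw).trans (h7 w))

omit he' in
theorem isMetric_coeff (g : Metric4 X) : (overlap e e').IsMetric (coeff g e) where
  smooth := contDiffOn_coeff he g
  posDef y hy := by
    refine Matrix.PosDef.of_dotProduct_mulVec_pos ?_ fun v hv => ?_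
    · ext i j
      exact g.symm _ _ _
    · have hv' : mfderivWithin 𝓘(ℝ, E4) (𝓡∂ 4) (e.extend (𝓡∂ 4)).symm
          (range (𝓡∂ 4)) y (WithLp.toLp 2 v) ≠ 0 := by
        intro h0
        have := mfderivWithin_symm_injective he hy (h0.trans (map_zero _).symm)
        exact hv (congrArg WithLp.ofLp this)
      have h := g.pos _ _ hv'
      rw [← sum_coordVec, sum_smul_bilinear] at h
      refine h.trans_eq ?_
      simp only [dotProduct, mulVec, Finset.mul_sum, star_trivial]
      refine Finset.sum_congr rfl fun i _ => Finset.sum_congr rfl fun j _ => ?_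
      change v i * v j * coeff g e y i j = _
      ring

end BoundaryTensor

/-! ### Boundary points in an arbitrary chart. -/

namespace BoundaryTensor

theorem mem_range_iff {y : E4} : y ∈ range (𝓡∂ 4) ↔ 0 ≤ y 0 := by
  rw [range_modelWithCornersEuclideanHalfSpace]
  rfl

theorem isInteriorPoint_model_iff {z : H4} :
    (𝓡∂ 4).IsInteriorPoint z ↔ 0 < (𝓡∂ 4) z 0 := by
  change extChartAt (𝓡∂ 4) z z ∈ interior (range (𝓡∂ 4)) ↔ _
  rw [interior_range_modelWithCornersEuclideanHalfSpace]
  simp [chartAt_self_eq]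

section Boundary

variable {X : Type*} [TopologicalSpace X] {e e' : OpenPartialHomeomorph X H4} [ChartedSpace H4 X] [IsManifold (𝓡∂ 4) ∞ X]
  (he : e ∈ IsManifold.maximalAtlas (𝓡∂ 4) ∞ X) (he' : e' ∈ IsManifold.maximalAtlas (𝓡∂ 4) ∞ X)
include he

theorem mdifferentiable_chart : e.MDifferentiable (𝓡∂ 4) (𝓡∂ 4) :=
  ⟨(contMDiffOn_of_mem_maximalAtlas he).mdifferentiableOn (by simp),
    (contMDiffOn_symm_of_mem_maximalAtlas he).mdifferentiableOn (by simp)⟩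

/-- The boundary of X is defined by preferred charts, whereas `e` is any chart of the maximal atlas.
A map with surjective derivative sends interior points to interior points; this is applied to `e`
and to its inverse. -/
theorem isInteriorPoint_iff_chart {p : X} (hp : p ∈ e.source) :
    (𝓡∂ 4).IsInteriorPoint p ↔ (𝓡∂ 4).IsInteriorPoint (e p) := by
  have hd := mdifferentiable_chart he
  refine ⟨fun h => (hd.mdifferentiableAt hp).isInteriorPoint_of_surjective_mfderiv
    (hd.mfderiv_surjective hp) h, fun h => ?_⟩
  have hp' := e.map_source hp
  have h2 := (hd.symm.mdifferentiableAt hp').isInteriorPoint_of_surjective_mfderiv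
    (hd.symm.mfderiv_surjective hp') h
  rwa [e.left_inv hp] at h2

theorem mem_boundary_iff {p : X} (hp : p ∈ e.source) :
    p ∈ (𝓡∂ 4).boundary X ↔ e.extend (𝓡∂ 4) p 0 = 0 := by
  have h : (0 : ℝ) ≤ (𝓡∂ 4) (e p) 0 := mem_range_iff.1 (mem_range_self _)
  change (𝓡∂ 4).IsBoundaryPoint p ↔ (𝓡∂ 4) (e p) 0 = 0
  rw [ModelWithCorners.isBoundaryPoint_iff_not_isInteriorPoint, isInteriorPoint_iff_chart he hp,
    isInteriorPoint_model_iff, not_lt]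
  exact ⟨fun h' => le_antisymm h' h, le_of_eq⟩

theorem symm_mem_boundary_iff {y : E4} (hy : y ∈ (overlap e e').carrier) :
    (e.extend (𝓡∂ 4)).symm y ∈ (𝓡∂ 4).boundary X ↔ y 0 = 0 := by
  rw [mem_boundary_iff he (symm_mem_source_self hy), (e.extend (𝓡∂ 4)).right_inv
    (overlap_subset hy)]

include he' in
theorem coordChange_zero {y : E4} (hy : y ∈ (overlap e e').carrier) (h0 : y 0 = 0) :
    coordChange e e' y 0 = 0 := by
  rw [← symm_mem_boundary_iff he' (coordChange_mem hy), symm_coordChange hy]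
  exact (symm_mem_boundary_iff he hy).2 h0

end Boundary

end BoundaryTensor

/-! ### First derivatives at the face x₀ = 0. -/

namespace HalfOpen

open BoundaryTensor

variable (U : HalfOpen)

/-- The line through y in a tangential direction stays in the face, where F vanishes near y. -/
theorem pd_succ_eq_zero {F : E4 → ℝ} (hF : ContDiffOn ℝ ∞ F U.carrier)
    (h0 : ∀ y ∈ U.carrier, y 0 = 0 → F y = 0) (a : Fin 3) {y : E4} (hy : y ∈ U.carrier)
    (hy0 : y 0 = 0) : pd a.succ F y = 0 := by
  set v : E4 := EuclideanSpace.single a.succ 1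
  have hv0 : ∀ t : ℝ, (y + t • v) 0 = 0 := fun t => by
    change y 0 + t * (EuclideanSpace.single a.succ (1 : ℝ) : E4) 0 = 0
    rw [hy0, zero_add]
    simp
  have hc : HasDerivAt (fun t : ℝ => y + t • v) v 0 := by
    simpa using ((hasDerivAt_id (0 : ℝ)).smul_const v).const_add y
  have hmem : ∀ t : ℝ, y + t • v ∈ range (𝓡∂ 4) := fun t => mem_range_iff.2 (hv0 t).ge
  have hF' : HasFDerivWithinAt F (fderivWithin ℝ F (range (𝓡∂ 4)) y) (range (𝓡∂ 4))
      (y + (0 : ℝ) • v) := by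
    rw [zero_smul, add_zero]
    exact (U.differentiableWithinAt hF hy).hasFDerivWithinAt
  have h1 := hF'.comp_hasDerivAt (0 : ℝ) hc (Filter.Eventually.of_forall hmem)
  have h2 : ∀ᶠ t : ℝ in nhds 0, (F ∘ fun t : ℝ => y + t • v) t = 0 := by
    have hct : Filter.Tendsto (fun t : ℝ => y + t • v) (nhds 0) (nhdsWithin y (range (𝓡∂ 4))) := by
      refine tendsto_nhdsWithin_iff.2 ⟨?_, Filter.Eventually.of_forall hmem⟩
      simpa using hc.continuousAt.tendsto
    filter_upwards [hct (U.mem_nhdsWithin y hy)] with t ht using h0 _ ht (hv0 t)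
  exact h1.unique ((hasDerivAt_const (0 : ℝ) (0 : ℝ)).congr_of_eventuallyEq h2)

/-- The point y is a local minimum and ∂₀ points into the half-space, so the one-sided derivative is
nonnegative. It yields the sign of the transition Jacobian. -/
theorem pd_zero_nonneg {F : E4 → ℝ} (h0 : ∀ y ∈ U.carrier, 0 ≤ F y) {y : E4} (hy : y ∈ U.carrier)
    (hy0 : F y = 0) : 0 ≤ pd 0 F y := by
  have hmin : IsLocalMinOn F (range (𝓡∂ 4)) y := by
    filter_upwards [U.mem_nhdsWithin y hy] with z hz
    rw [hy0]
    exact h0 z hz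
  refine hmin.fderivWithin_nonneg (mem_posTangentConeAt_of_segment_subset ?_)
  refine (𝓡∂ 4).convex_range.segment_subset (U.subset hy) ?_
  rw [mem_range_iff]
  have := mem_range_iff.1 (U.subset hy)
  change 0 ≤ y 0 + (EuclideanSpace.single 0 (1 : ℝ) : E4) 0
  simp
  linarith

end HalfOpen

/-! ### Results on a metric in one chart. -/

/-- An interpretation of a metric `g` and of a function `φ` gives one of `φ² g`. -/
def Realization.conformal {A V Ω : Type*} [CommRing A] [Algebra ℝ A] [AddCommGroup V] [Module A V]
    {𝒢 : LeviCivita (Fin 4) A V} {G : BoundaryTensor.E4 → Matrix (Fin 4) (Fin 4) ℝ}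
    (r : Realization 𝒢 G Ω) (φ ψ : A) (h : φ * ψ = 1) {f : BoundaryTensor.E4 → ℝ}
    (hf : ∀ u, f (r.pt u) = r.ev u φ) :
    Realization (𝒢.conformal φ ψ h) (fun z => f z ^ 2 • G z) Ω where
  pt := r.pt
  ev := r.ev
  pd_eq := r.pd_eq
  metric_eq i j u := by
    rw [LeviCivita.conformal_met, map_mul, map_mul, Matrix.smul_apply, smul_eq_mul, pow_two, hf,
      r.metric_eq]
    rfl
  nab_comm i j := by
    have h := 𝒢.conformalNab_sub φ ψ (𝒢.fr i) (𝒢.fr j)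
    rw [r.nab_comm i j, sub_self, sub_eq_zero] at h
    exact h

theorem Realization.tensorS_conformal {A V Ω : Type*} [CommRing A] [Algebra ℝ A] [AddCommGroup V]
    [Module A V] {𝒢 : LeviCivita (Fin 4) A V}
    {G : BoundaryTensor.E4 → Matrix (Fin 4) (Fin 4) ℝ} (r : Realization 𝒢 G Ω) {c : A} {s : ℤˣ}
    (hcs : ∀ u, r.ev u c = ((s : ℤ) : ℝ) / Real.sqrt ((G (r.pt u))⁻¹ 0 0))
    (hc : c * c * 𝒢.met (𝒢.dual 0) (𝒢.dual 0) = 1) (hG : ∀ u, (G (r.pt u)).PosDef)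
    (φ ψ : A) (h : φ * ψ = 1) {f : BoundaryTensor.E4 → ℝ}
    (hf : ∀ u, f (r.pt u) = r.ev u φ) (hpos : ∀ u, 0 < f (r.pt u)) (a b : Fin 3) (u : Ω) :
    BoundaryTensor.tensorS s (fun z => f z ^ 2 • G z) a b (r.pt u) =
      (f (r.pt u))⁻¹ * BoundaryTensor.tensorS s G a b (r.pt u) := by
  -- The factor of the new normal is φc with the same sign s; positivity of f is used in taking the
  -- square root of f².
  have hcs' : ∀ u, (r.conformal φ ψ h hf).ev u (φ * c) = ((s : ℤ) : ℝ) /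
      Real.sqrt ((f ((r.conformal φ ψ h hf).pt u) ^ 2 • G ((r.conformal φ ψ h hf).pt u))⁻¹ 0 0) := by
    intro u
    have hp := hpos u
    have hdet := (hG u).det_pos.ne'
    change r.ev u (φ * c) = ((s : ℤ) : ℝ) / Real.sqrt ((f (r.pt u) ^ 2 • G (r.pt u))⁻¹ 0 0)
    have hinv : (f (r.pt u) ^ 2 • G (r.pt u))⁻¹ = (f (r.pt u) ^ 2)⁻¹ • (G (r.pt u))⁻¹ := by
      apply Matrix.inv_eq_left_inv
      rw [Matrix.smul_mul, Matrix.mul_smul, smul_smul, inv_mul_cancel₀ (pow_ne_zero 2 hp.ne'),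
        one_smul, Matrix.nonsing_inv_mul _ (Ne.isUnit hdet)]
    rw [map_mul, ← hf, hcs, hinv, Matrix.smul_apply, smul_eq_mul, Real.sqrt_mul (by positivity),
      Real.sqrt_inv, Real.sqrt_sq hp.le]
    field_simp
  have h0 : ∀ a : Fin 3, 𝒢.met (𝒢.unitNormal c) (𝒢.fr a.succ) = 0 := fun a => by
    rw [LeviCivita.met_comm, LeviCivita.met_fr_succ_unitNormal]
  have h1 := (r.conformal φ ψ h hf).tensorS_eq hcs'
    (𝒢.unitNormal_conformal_spec φ ψ h hc) a b u
  have h2 := 𝒢.tensorS_conformal φ ψ h hc (𝒢.fr a.succ) (𝒢.fr b.succ) (h0 a) (h0 b)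
  have h3 := congrArg (r.ev u) h
  rw [map_mul, map_one, ← hf] at h3
  rw [r.tensorS_eq hcs hc, ← eq_inv_of_mul_eq_one_right h3, ← map_mul, ← h2]
  exact h1

namespace HalfOpen

open BoundaryTensor

namespace IsMetric

variable {U : HalfOpen} {G : E4 → Matrix (Fin 4) (Fin 4) ℝ} (hG : U.IsMetric G) (s : ℤˣ)

theorem exists_normal : ∃ c : U.smooth,
    c * c * hG.leviCivita.met (hG.leviCivita.dual 0) (hG.leviCivita.dual 0) = 1 ∧
      ∀ u, hG.realization.ev u c = ((s : ℤ) : ℝ) / Real.sqrt ((G (hG.realization.pt u))⁻¹ 0 0) :=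
  HalfOpen.exists_normal hG.realization (fun _ h t => U.exists_div_sqrt h t)
    (fun _ _ h => U.eval_ext h) (fun u => hG.posDef u u.2) s

include hG

theorem tensorS_symm (a b : Fin 3) {y : E4} (hy : y ∈ U.carrier) :
    tensorS s G a b y = tensorS s G b a y := by
  obtain ⟨c, hc, hcs⟩ := hG.exists_normal s
  have h : ∀ a b, tensorS s G a b y = _ := fun a b => hG.realization.tensorS_eq hcs hc a b ⟨y, hy⟩
  rw [h, h, LeviCivita.tensorS_symm]

theorem sum_tensorS {y : E4} (hy : y ∈ U.carrier) :
    ∑ a, ∑ b, (bmetric G y)⁻¹ a b * tensorS s G a b y = 0 := by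
  obtain ⟨c, hc, hcs⟩ := hG.exists_normal s
  have h : ∀ a b, tensorS s G a b y = _ := fun a b => hG.realization.tensorS_eq hcs hc a b ⟨y, hy⟩
  have h' : ∀ a b, (bmetric G y)⁻¹ a b = _ :=
    fun a b => hG.realization.inv_bmetric_eq hc a b ⟨y, hy⟩
  simp only [h, h', ← map_mul, ← map_sum]
  rw [← map_zero (hG.realization.ev ⟨y, hy⟩), ← hG.leviCivita.sum_tensorS c hc]
  congr 1
  refine Finset.sum_congr rfl fun a _ => ?_
  conv_rhs => rw [hG.leviCivita.tdual_eq c hc a, map_sum]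
  exact Finset.sum_congr rfl fun b _ => by rw [map_smul, smul_eq_mul]

theorem tensorS_eq_explicitS (a b : Fin 3) {y : E4} (hy : y ∈ U.carrier) :
    tensorS s G a b y = explicitS s G a b y := by
  obtain ⟨c, hc, hcs⟩ := hG.exists_normal s
  refine (hG.realization.tensorS_eq hcs hc a b ⟨y, hy⟩).trans ?_
  rw [hG.leviCivita.tensorS_eq_explicitS c hc hG.realization.nab_comm]
  exact (hG.realization.explicitS_eq hcs hc a b ⟨y, hy⟩).symm

theorem dA_tt_n_eq (a b : Fin 3) {y : E4} (hy : y ∈ U.carrier) :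
    dA_tt_n s G a b y = (1 / 2) * dRic_tt_n s G a b y - dScal_n s G y / 12 * G y a.succ b.succ := by
  obtain ⟨c, hc, hcs⟩ := hG.exists_normal s
  have h1 := hG.realization.dA_tt_n_eq hcs a b ⟨y, hy⟩
  have h2 := hG.realization.dRic_tt_n_eq hcs a b ⟨y, hy⟩
  have h3 := hG.realization.dScal_n_eq hcs ⟨y, hy⟩
  have h4 := hG.realization.metric_eq a.succ b.succ ⟨y, hy⟩
  refine h1.trans ?_
  rw [LeviCivita.cov2_sch, map_sub, map_mul, map_mul, map_mul, map_mul, ← h2, ← h3, ← h4,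
    hG.realization.ev_twelfth, map_ofNat]
  change 6 * (1 / 12) * dRic_tt_n s G a b y - 1 / 12 * dScal_n s G y * G y a.succ b.succ = _
  ring

/-- L vanishes at x₀ = 0 but is unknown inside, so it is not zero in the ring. It lies in the ideal
of functions vanishing on the face, which tangential derivatives preserve by `pd_succ_eq_zero`. -/
theorem tensorS_eq_dA_tt_n (hL : ∀ y ∈ U.carrier, y 0 = 0 → ∀ a b, secondFF s G a b y = 0)
    (a b : Fin 3) {y : E4} (hy : y ∈ U.carrier) (hy0 : y 0 = 0) :
    tensorS s G a b y = dA_tt_n s G a b y := by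
  obtain ⟨c, hc, hcs⟩ := hG.exists_normal s
  let I : Ideal U.smooth :=
    { carrier := {f | ∀ u : U.carrier, u.1 0 = 0 → U.eval u f = 0}
      add_mem' := fun {f f'} hf hf' u hu => by rw [map_add, hf u hu, hf' u hu, add_zero]
      zero_mem' := fun u _ => map_zero _
      smul_mem' := fun f f' hf' u hu => by rw [smul_eq_mul, map_mul, hf' u hu, mul_zero] }
  have h := hG.leviCivita.tensorS_sub_mem c hc hG.realization.nab_comm I ?_ ?_ a b
  · have h1 := h ⟨y, hy⟩ hy0
    rw [map_sub, sub_eq_zero] at h1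
    refine (hG.realization.tensorS_eq hcs hc a b ⟨y, hy⟩).trans (h1.trans ?_)
    exact (hG.realization.dA_tt_n_eq hcs a b ⟨y, hy⟩).symm
  · intro a f hf u hu
    rw [hG.der_fr]
    refine U.pd_succ_eq_zero (U.contDiffOn_ext f) (fun z hz hz0 => ?_) a u.2 hu
    rw [U.ext_apply f ⟨z, hz⟩]
    exact hf _ hz0
  · intro a b u hu
    exact (hG.realization.secondFF_eq hcs hc a b u).symm.trans (hL u u.2 hu a b)

theorem tensorS_smul {f : E4 → ℝ} (hf : ContDiffOn ℝ ∞ f U.carrier)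
    (hpos : ∀ y ∈ U.carrier, 0 < f y) (a b : Fin 3) {y : E4} (hy : y ∈ U.carrier) :
    tensorS s (fun z => f z ^ 2 • G z) a b y = (f y)⁻¹ * tensorS s G a b y := by
  obtain ⟨c, hc, hcs⟩ := hG.exists_normal s
  obtain ⟨ψ, hψ⟩ := U.exists_inv (a := U.ofFun f hf) fun u => (hpos u u.2).ne'
  exact hG.realization.tensorS_conformal hcs hc (fun u => hG.posDef u u.2) (U.ofFun f hf) ψ hψ
    (fun _ => rfl) (fun u => hpos u u.2) a b ⟨y, hy⟩

end IsMetric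

end HalfOpen

/-! ### Comparison of S for two frames along the boundary. -/

namespace LeviCivita

section Transform

variable {A V B : Type*} [CommRing A] [Algebra ℝ A] [AddCommGroup V] [Module A V]
  (𝒢 : LeviCivita (Fin 4) A V) {E F : Fin 4 → V}
  (hEF : ∀ i j, 𝒢.met (E i) (F j) = if i = j then 1 else 0)
  (hF : ∀ X, ∑ i, 𝒢.met X (F i) • E i = X) (ev : B → A →+* ℝ) {c c' : A}
  (hc : c * c * 𝒢.met (𝒢.dual 0) (𝒢.dual 0) = 1) (hc' : c' * c' * 𝒢.met (F 0) (F 0) = 1)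
  (hB : ∀ f, (∀ u, ev u f = 0) → ∀ (a : Fin 3) u, ev u (𝒢.der (𝒢.fr a.succ) f) = 0)
  (hN : ∀ u (t : V →ₗ[A] A), ev u (t (c' • F 0)) = ev u (t (𝒢.unitNormal c)))

-- The two normals agree only at the evaluation points, yet ∇n agrees there in tangential
-- directions: pairing their difference with Y gives a function vanishing at those points, whose
-- tangential derivatives vanish too.
include hB hN in
theorem shape_withFrame (a : Fin 3) (Y : V) (u : B) :
    ev u ((𝒢.withFrame E F hEF hF).shape c' (𝒢.fr a.succ) Y) =
      ev u (𝒢.shape c (𝒢.fr a.succ) Y) := by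
  have h0 : ∀ u W, ev u (𝒢.met (c' • F 0) W) = ev u (𝒢.met (𝒢.unitNormal c) W) := fun u W =>
    hN u (𝒢.met.flip W)
  have h1 := hB (𝒢.met (c' • F 0) Y - 𝒢.met (𝒢.unitNormal c) Y)
    (fun u => by rw [map_sub, h0, sub_self]) a u
  rw [map_sub, 𝒢.der_met, 𝒢.der_met, map_sub, map_add, map_add, h0] at h1
  change ev u (-𝒢.met (𝒢.nab (𝒢.fr a.succ) (c' • F 0)) Y) = _
  rw [shape_apply, map_neg, map_neg]
  linear_combination -h1

-- Since ∇n is orthogonal to n, H is the full trace of the shape form, which does not depend on the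
-- frame. Splitting that trace along the other frame leaves only tangential directions, where
-- `shape_withFrame` applies.
include hc hc' hB hN in
theorem meanCurv_withFrame (u : B) :
    ev u ((𝒢.withFrame E F hEF hF).meanCurv c') = ev u (𝒢.meanCurv c) := by
  have h1 := (𝒢.withFrame E F hEF hF).sum_tangential c' hc' ((𝒢.withFrame E F hEF hF).shape c')
  rw [← (𝒢.withFrame E F hEF hF).meanCurv_eq_sum hc', shape_apply, met_nab_unitNormal _ _ hc',
    neg_zero, add_zero] at h1
  have h2 := trace_eq_trace 𝒢.met ((𝒢.withFrame E F hEF hF).shape c') 𝒢.met_comm hF 𝒢.sum_fr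
  have h3 := 𝒢.sum_tangential c hc ((𝒢.withFrame E F hEF hF).shape c')
  have h4 : ev u ((𝒢.withFrame E F hEF hF).shape c' (𝒢.unitNormal c) (𝒢.unitNormal c)) = 0 := by
    rw [← hN u, ← LinearMap.flip_apply, ← hN u]
    have h5 := met_nab_unitNormal (𝒢.withFrame E F hEF hF) c' hc' (c' • F 0)
    change ev u (-(𝒢.withFrame E F hEF hF).met ((𝒢.withFrame E F hEF hF).nab (c' • F 0)
      ((𝒢.withFrame E F hEF hF).unitNormal c')) ((𝒢.withFrame E F hEF hF).unitNormal c')) = 0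
    rw [h5, neg_zero, map_zero]
  rw [← h1]
  refine (congrArg (ev u) (h2.symm.trans h3)).trans ?_
  rw [map_add, h4, add_zero, map_sum, 𝒢.meanCurv_eq_sum hc, map_sum]
  exact Finset.sum_congr rfl fun a _ => 𝒢.shape_withFrame hEF hF ev hB hN a _ u

-- Apart from H, the normal enters S undifferentiated as an argument of tensors, so its value at the
-- evaluation points is enough.
include hc hc' hB hN in
theorem tensorS_withFrame (X Y : V) (u : B) :
    ev u ((𝒢.withFrame E F hEF hF).tensorS c' X Y) = ev u (𝒢.tensorS c X Y) := by
  have hw := 𝒢.withFrame_weyl E F hEF hF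
  have e : (𝒢.withFrame E F hEF hF).unitNormal c' = c' • F 0 := rfl
  have hcov : (𝒢.withFrame E F hEF hF).cov4 = 𝒢.cov4 := rfl
  have hdiv : ∀ X Y, ev u (𝒢.div4 𝒢.weyl X (c' • F 0) Y) =
      ev u (𝒢.div4 𝒢.weyl X (𝒢.unitNormal c) Y) := by
    intro X Y
    simp only [div4, map_sum]
    exact Finset.sum_congr rfl fun i _ => hN u ((𝒢.cov4 𝒢.weyl (𝒢.dual i) (𝒢.fr i) X).flip Y)
  have h1 : ev u (𝒢.cov4 𝒢.weyl (c' • F 0) (c' • F 0) X (c' • F 0) Y) =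
      ev u (𝒢.cov4 𝒢.weyl (𝒢.unitNormal c) (𝒢.unitNormal c) X (𝒢.unitNormal c) Y) :=
    ((hN u ((𝒢.cov4 𝒢.weyl (c' • F 0) (c' • F 0) X).flip Y)).trans
      (hN u (((𝒢.cov4 𝒢.weyl (c' • F 0)).flip X).flip (𝒢.unitNormal c) |>.flip Y))).trans
      (hN u (𝒢.divForm 𝒢.weyl X (𝒢.unitNormal c) Y (𝒢.unitNormal c)))
  have h2 : ev u (𝒢.weyl (c' • F 0) X (c' • F 0) Y) =
      ev u (𝒢.weyl (𝒢.unitNormal c) X (𝒢.unitNormal c) Y) :=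
    (hN u ((𝒢.weyl (c' • F 0) X).flip Y)).trans
      (hN u (((𝒢.weyl.flip X).flip (𝒢.unitNormal c)).flip Y))
  rw [tensorS_apply, tensorS_apply, withFrame_div4_weyl, withFrame_div4_weyl, hw, hcov, e]
  simp only [map_add, map_sub, map_mul, hdiv, h1, h2,
    𝒢.meanCurv_withFrame hEF hF ev hc hc' hB hN u]

/-- At a boundary point the new dx₀ is a multiple of the old one, since its tangential components
vanish. -/
theorem eval_dual_zero (hF0 : ∀ u (a : Fin 3), ev u (𝒢.met (𝒢.fr a.succ) (F 0)) = 0) (u : B)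
    (t : V →ₗ[A] A) : ev u (t (F 0)) = ev u (𝒢.met (𝒢.fr 0) (F 0)) * ev u (t (𝒢.dual 0)) := by
  conv_lhs => rw [← 𝒢.sum_fr (F 0)]
  rw [map_sum, Fin.sum_univ_succ, map_add, map_sum, Finset.sum_eq_zero fun a _ => by
    rw [LinearMap.map_smul, smul_eq_mul, map_mul, 𝒢.met_comm, hF0, zero_mul], add_zero,
    LinearMap.map_smul, smul_eq_mul, map_mul, 𝒢.met_comm]

theorem unitNormal_withFrame (hF0 : ∀ u (a : Fin 3), ev u (𝒢.met (𝒢.fr a.succ) (F 0)) = 0)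
    (hcc : ∀ u, ev u c' * ev u (𝒢.met (𝒢.fr 0) (F 0)) = ev u c) (u : B) (t : V →ₗ[A] A) :
    ev u (t (c' • F 0)) = ev u (t (𝒢.unitNormal c)) := by
  rw [unitNormal, LinearMap.map_smul, LinearMap.map_smul, smul_eq_mul, smul_eq_mul, map_mul,
    map_mul, 𝒢.eval_dual_zero ev hF0, ← mul_assoc, hcc]

theorem bilinear_withFrame (hF0 : ∀ u (a : Fin 3), ev u (𝒢.met (𝒢.fr a.succ) (F 0)) = 0)
    (hF : ∀ X, ∑ i, 𝒢.met X (F i) • E i = X)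
    (β : V →ₗ[A] V →ₗ[A] A) (a b : Fin 3) (u : B) :
    ev u (β (𝒢.fr a.succ) (𝒢.fr b.succ)) = ∑ p : Fin 3, ∑ q : Fin 3,
      ev u (𝒢.met (𝒢.fr a.succ) (F p.succ)) * ev u (𝒢.met (𝒢.fr b.succ) (F q.succ)) *
        ev u (β (E p.succ) (E q.succ)) := by
  have h : ∀ (t : V →ₗ[A] A) (a : Fin 3), ev u (t (𝒢.fr a.succ)) = ∑ p : Fin 3,
      ev u (𝒢.met (𝒢.fr a.succ) (F p.succ)) * ev u (t (E p.succ)) := by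
    intro t a
    conv_lhs => rw [← hF (𝒢.fr a.succ)]
    rw [map_sum, Fin.sum_univ_succ]
    simp only [map_smul, smul_eq_mul, map_mul, map_add, map_sum, hF0, zero_mul, zero_add]
  rw [h _ b]
  simp only [mul_assoc]
  rw [Finset.sum_comm]
  refine Finset.sum_congr rfl fun q _ => ?_
  have h' := h (β.flip (E q.succ)) a
  simp only [LinearMap.flip_apply] at h'
  rw [h', Finset.mul_sum]
  exact Finset.sum_congr rfl fun p _ => by ring

end Transform

end LeviCivita

theorem Realization.tensorS_transform {A V Ω : Type*} [CommRing A] [Algebra ℝ A] [AddCommGroup V]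
    [Module A V] {𝒢 : LeviCivita (Fin 4) A V} {E F : Fin 4 → V}
    {hEF : ∀ i j, 𝒢.met (E i) (F j) = if i = j then 1 else 0}
    {hF : ∀ X, ∑ i, 𝒢.met X (F i) • E i = X}
    {G G' : BoundaryTensor.E4 → Matrix (Fin 4) (Fin 4) ℝ} (r : Realization 𝒢 G Ω)
    (r' : Realization (𝒢.withFrame E F hEF hF) G' Ω) (hev : r'.ev = r.ev) {c c' : A} {s : ℤˣ}
    (hc : c * c * 𝒢.met (𝒢.dual 0) (𝒢.dual 0) = 1)
    (hcs : ∀ u, r.ev u c = ((s : ℤ) : ℝ) / Real.sqrt ((G (r.pt u))⁻¹ 0 0))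
    (hc' : c' * c' * 𝒢.met (F 0) (F 0) = 1)
    (hcs' : ∀ u, r'.ev u c' = ((s : ℤ) : ℝ) / Real.sqrt ((G' (r'.pt u))⁻¹ 0 0))
    (D : Set Ω)
    (hB : ∀ f, (∀ u ∈ D, r.ev u f = 0) → ∀ (a : Fin 3), ∀ u ∈ D, r.ev u (𝒢.der (𝒢.fr a.succ) f) = 0)
    (hF0 : ∀ u ∈ D, ∀ (a : Fin 3), r.ev u (𝒢.met (𝒢.fr a.succ) (F 0)) = 0)
    (hpos : ∀ u ∈ D, 0 < r.ev u (𝒢.met (𝒢.fr 0) (F 0))) (a b : Fin 3) {u : Ω} (hu : u ∈ D) :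
    BoundaryTensor.tensorS s G a b (r.pt u) = ∑ p : Fin 3, ∑ q : Fin 3,
      r.ev u (𝒢.met (𝒢.fr a.succ) (F p.succ)) * r.ev u (𝒢.met (𝒢.fr b.succ) (F q.succ)) *
        BoundaryTensor.tensorS s G' p q (r'.pt u) := by
  set ev : D → A →+* ℝ := fun u => (r.ev u : A →+* ℝ)
  have hF0' : ∀ u (a : Fin 3), ev u (𝒢.met (𝒢.fr a.succ) (F 0)) = 0 := fun u => hF0 u u.2
  -- With J the derivative of the new x₀ along the old x₀, the lengths satisfy |dx₀'| = J|dx₀|.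
  -- Positivity of J makes the two unit normals equal rather than opposite.
  have hcc : ∀ u, ev u c' * ev u (𝒢.met (𝒢.fr 0) (F 0)) = ev u c := by
    intro u
    have hp : 0 < ev u (𝒢.met (𝒢.fr 0) (F 0)) := hpos u u.2
    have h1 : ev u (𝒢.met (F 0) (F 0)) = ev u (𝒢.met (𝒢.fr 0) (F 0)) ^ 2 *
        ev u (𝒢.met (𝒢.dual 0) (𝒢.dual 0)) := by
      rw [𝒢.eval_dual_zero ev hF0' u (𝒢.met (F 0)), 𝒢.met_comm (F 0) (𝒢.dual 0),
        𝒢.eval_dual_zero ev hF0' u (𝒢.met (𝒢.dual 0))]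
      ring
    have h2 : ev u c = ((s : ℤ) : ℝ) / Real.sqrt (ev u (𝒢.met (𝒢.dual 0) (𝒢.dual 0))) := by
      refine (hcs u).trans ?_
      rw [r.inv_metric_eq]
      rfl
    have h3 : ev u c' = ((s : ℤ) : ℝ) / Real.sqrt (ev u (𝒢.met (F 0) (F 0))) := by
      have h := hcs' u
      rw [r'.inv_metric_eq, hev] at h
      exact h
    rw [h3, h2, h1, Real.sqrt_mul (by positivity), Real.sqrt_sq hp.le]
    field_simp
  have hN := 𝒢.unitNormal_withFrame ev hF0' hcc
  have hB' : ∀ f, (∀ u, ev u f = 0) → ∀ (a : Fin 3) u, ev u (𝒢.der (𝒢.fr a.succ) f) = 0 :=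
    fun f hf a u => hB f (fun u hu => hf ⟨u, hu⟩) a u u.2
  rw [r.tensorS_eq hcs hc]
  refine (𝒢.bilinear_withFrame ev hF0' hF _ a b ⟨u, hu⟩).trans ?_
  refine Finset.sum_congr rfl fun p _ => Finset.sum_congr rfl fun q _ => ?_
  rw [r'.tensorS_eq hcs' hc', hev, ← 𝒢.tensorS_withFrame hEF hF ev hc hc' hB' hN]
  rfl

/-! ### Jacobians of coordinate changes. -/

namespace BoundaryTensor

open HalfOpen

variable {X : Type*} [TopologicalSpace X] {e e' : OpenPartialHomeomorph X H4} [ChartedSpace H4 X]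
  [IsManifold (𝓡∂ 4) ∞ X]
  (he : e ∈ IsManifold.maximalAtlas (𝓡∂ 4) ∞ X) (he' : e' ∈ IsManifold.maximalAtlas (𝓡∂ 4) ∞ X)

include he he'

theorem contDiffOn_coordChange_apply (k : Fin 4) :
    ContDiffOn ℝ ∞ (fun y => coordChange e e' y k) (overlap e e').carrier :=
  (EuclideanSpace.proj (𝕜 := ℝ) k).contDiff.comp_contDiffOn (contDiffOn_coordChange he he')

theorem contDiffOn_jac (k l : Fin 4) :
    ContDiffOn ℝ ∞ (jac e e' k l) (overlap e e').carrier :=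
  (overlap e e').contDiffOn_pd (contDiffOn_coordChange_apply he he' k) l

theorem pd_comp {F : E4 → ℝ} (hF : ContDiffOn ℝ ∞ F (overlap e' e).carrier) (j : Fin 4) {y : E4}
    (hy : y ∈ (overlap e e').carrier) : pd j (fun z => F (coordChange e e' z)) y =
      ∑ l, jac e e' l j y * pd l F (coordChange e e' y) := by
  have h1 := ((overlap e' e).differentiableWithinAt hF (coordChange_mem hy)).hasFDerivWithinAt
  have h2 := (hasFDerivWithinAt_coordChange he he' hy).mono (overlap e e').subset
  have h3 := h1.comp y h2 fun z hz => (overlap e' e).subset (coordChange_mem hz)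
  have h4 := h3.fderivWithin ((overlap e e').uniqueDiffOn y hy)
  rw [(overlap e e').fderivWithin_eq _ hy] at h4
  have h5 := congrArg (fun L : E4 →L[ℝ] ℝ => L (EuclideanSpace.single j 1)) h4
  refine h5.trans ?_
  have h6 : fderivWithin ℝ (coordChange e e') (range (𝓡∂ 4)) y (EuclideanSpace.single j 1) =
      ∑ l, jac e e' l j y • EuclideanSpace.single l (1 : ℝ) := by
    refine PiLp.ext fun k => ?_
    rw [WithLp.ofLp_sum, Finset.sum_apply, Finset.sum_eq_single k]
    · rw [jac_eq he he' hy]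
      simp
    · intro i _ hi
      simp [show k ≠ i from hi.symm]
    · exact fun h => absurd (Finset.mem_univ k) h
  change fderivWithin ℝ F (range (𝓡∂ 4)) (coordChange e e' y) (fderivWithin ℝ (coordChange e e')
    (range (𝓡∂ 4)) y (EuclideanSpace.single j 1)) = _
  rw [h6, map_sum]
  exact Finset.sum_congr rfl fun l _ => by rw [map_smul]; rfl

omit he he' in
theorem pd_coord (k j : Fin 4) {y : E4} (hy : y ∈ range (𝓡∂ 4)) :
    pd j (fun z => z k) y = if k = j then 1 else 0 := by
  have h := (EuclideanSpace.proj (𝕜 := ℝ) k : E4 →L[ℝ] ℝ).hasFDerivAt.hasFDerivWithinAt.fderivWithin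
    ((𝓡∂ 4).uniqueDiffOn y hy)
  refine (congrArg (fun L : E4 →L[ℝ] ℝ => L (EuclideanSpace.single j 1)) h).trans ?_
  simp

theorem sum_jac_mul_jac (k j : Fin 4) {y : E4} (hy : y ∈ (overlap e e').carrier) :
    ∑ l, jac e e' l j y * jac e' e k l (coordChange e e' y) = if k = j then 1 else 0 := by
  rw [← pd_coord k j ((overlap e e').subset hy)]
  refine (pd_comp he he' (contDiffOn_coordChange_apply he' he k) j hy).symm.trans ?_
  exact (overlap e e').pd_congr (fun z hz => by rw [coordChange_coordChange hz]) j hy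

theorem sum_jac_mul_jac' (k j : Fin 4) {y : E4} (hy : y ∈ (overlap e e').carrier) :
    ∑ l, jac e' e l j (coordChange e e' y) * jac e e' k l y = if k = j then 1 else 0 := by
  have h := sum_jac_mul_jac he' he k j (coordChange_mem hy)
  rwa [coordChange_coordChange hy] at h

theorem jac_zero_succ (a : Fin 3) {y : E4} (hy : y ∈ (overlap e e').carrier) (hy0 : y 0 = 0) :
    jac e e' 0 a.succ y = 0 :=
  (overlap e e').pd_succ_eq_zero (contDiffOn_coordChange_apply he he' 0)
    (fun _ hz hz0 => coordChange_zero he he' hz hz0) a hy hy0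

/-- The new x₀ is nonnegative and vanishes at y, so the derivative is at least 0. It cannot be 0:
the rest of its Jacobian row vanishes, and the Jacobian is invertible. -/
theorem jac_zero_zero_pos {y : E4} (hy : y ∈ (overlap e e').carrier) (hy0 : y 0 = 0) :
    0 < jac e e' 0 0 y := by
  have h1 : 0 ≤ jac e e' 0 0 y := (overlap e e').pd_zero_nonneg
    (fun z hz => mem_range_iff.1 ((overlap e' e).subset (coordChange_mem hz))) hy
    (coordChange_zero he he' hy hy0)
  have h2 := sum_jac_mul_jac' he he' 0 0 hy
  rw [Fin.sum_univ_succ, Finset.sum_eq_zero fun a _ => by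
    rw [jac_zero_succ he he' a hy hy0, mul_zero], add_zero, if_pos rfl] at h2
  exact lt_of_le_of_ne h1 fun h => by simp [← h] at h2

/-- The Jacobian matrix as a matrix of smooth functions. -/
noncomputable def jacSmooth (k l : Fin 4) : (overlap e e').smooth :=
  (overlap e e').ofFun (jac e e' k l) (contDiffOn_jac he he' k l)

/-- The inverse Jacobian matrix as a matrix of smooth functions. -/
noncomputable def invJacSmooth (k l : Fin 4) : (overlap e e').smooth :=
  (overlap e e').ofFun (fun y => jac e' e k l (coordChange e e' y))
    ((contDiffOn_jac he' he k l).comp (contDiffOn_coordChange he he') fun _ hy =>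
      coordChange_mem hy)

theorem sum_jacSmooth_mul (k j : Fin 4) :
    ∑ l, jacSmooth he he' l j * invJacSmooth he he' k l = if k = j then 1 else 0 := by
  apply HalfOpen.eval_ext
  intro u
  rw [map_sum]
  refine (sum_jac_mul_jac he he' k j u.2).trans ?_
  split_ifs <;> simp

theorem sum_invJacSmooth_mul (k j : Fin 4) :
    ∑ l, invJacSmooth he he' l j * jacSmooth he he' k l = if k = j then 1 else 0 := by
  apply HalfOpen.eval_ext
  intro u
  rw [map_sum]
  refine (sum_jac_mul_jac' he he' k j u.2).trans ?_
  split_ifs <;> simp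

end BoundaryTensor

/-! ### The second chart as a frame over the first, and tensoriality. -/

namespace HalfOpen.IsMetric

open BoundaryTensor

variable {U : HalfOpen} {G : E4 → Matrix (Fin 4) (Fin 4) ℝ} (hG : U.IsMetric G)

theorem fr_apply (i k : Fin 4) : hG.leviCivita.fr i k = if k = i then 1 else 0 :=
  Pi.single_apply i 1 k

theorem met_dual (X : Fin 4 → U.smooth) (j : Fin 4) :
    hG.leviCivita.met X (hG.leviCivita.dual j) = X j := by
  have h := congrFun (hG.leviCivita.sum_dual X) j
  rw [Finset.sum_apply, Finset.sum_eq_single j] at h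
  · rwa [Pi.smul_apply, fr_apply, if_pos rfl, smul_eq_mul, mul_one] at h
  · intro i _ hi
    rw [Pi.smul_apply, fr_apply, if_neg hi.symm, smul_zero]
  · exact fun h => absurd (Finset.mem_univ j) h

theorem der_apply (X : Fin 4 → U.smooth) (a : U.smooth) :
    hG.leviCivita.der X a = ∑ l, X l * U.deriv l a :=
  LeviCivita.coordDer_apply U.deriv X a

theorem met_apply (X Y : Fin 4 → U.smooth) :
    hG.leviCivita.met X Y = ∑ i, ∑ j, X i * hG.coeffs i j * Y j :=
  LeviCivita.coordMet_apply hG.coeffs X Y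

end HalfOpen.IsMetric

namespace BoundaryTensor

variable {X : Type*} [TopologicalSpace X] {e e' : OpenPartialHomeomorph X H4} [ChartedSpace H4 X]
  [IsManifold (𝓡∂ 4) ∞ X]
  (he : e ∈ IsManifold.maximalAtlas (𝓡∂ 4) ∞ X) (he' : e' ∈ IsManifold.maximalAtlas (𝓡∂ 4) ∞ X)
  (g : Metric4 X)

/-- The coordinate vector fields of the chart `e'`, in the coordinates of the chart `e`. -/
noncomputable def chartFrame (i : Fin 4) : Fin 4 → (overlap e e').smooth :=
  fun k => invJacSmooth he he' k i

/-- The frame dual to the coordinate vector fields of the chart `e'`. -/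
noncomputable def chartDual (i : Fin 4) : Fin 4 → (overlap e e').smooth :=
  ∑ j, jacSmooth he he' i j • (isMetric_coeff (e' := e') he g).leviCivita.dual j

theorem met_chartDual (Y : Fin 4 → (overlap e e').smooth) (i : Fin 4) :
    (isMetric_coeff he g).leviCivita.met Y (chartDual he he' g i) =
      ∑ j, jacSmooth he he' i j * Y j := by
  rw [chartDual, map_sum]
  exact Finset.sum_congr rfl fun j _ => by
    rw [map_smul, HalfOpen.IsMetric.met_dual, smul_eq_mul]

theorem met_chartFrame_chartDual (i j : Fin 4) :
    (isMetric_coeff he g).leviCivita.met (chartFrame he he' i) (chartDual he he' g j) =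
      if i = j then 1 else 0 := by
  rw [met_chartDual]
  simp only [chartFrame, mul_comm (jacSmooth he he' j _), eq_comm (a := i)]
  exact sum_invJacSmooth_mul he he' j i

theorem sum_chartDual (Y : Fin 4 → (overlap e e').smooth) :
    ∑ i, (isMetric_coeff he g).leviCivita.met Y (chartDual he he' g i) • chartFrame he he' i =
      Y := by
  ext1 k
  rw [Finset.sum_apply]
  simp only [Pi.smul_apply, met_chartDual, smul_eq_mul, chartFrame, Finset.sum_mul]
  rw [Finset.sum_comm]
  have h : ∀ j, ∑ i, jacSmooth he he' i j * Y j * invJacSmooth he he' k i =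
      if k = j then Y j else 0 := by
    intro j
    have h1 := congrArg (Y j * ·) (sum_jacSmooth_mul he he' k j)
    simp only [Finset.mul_sum, mul_ite, mul_one, mul_zero] at h1
    rw [← h1]
    exact Finset.sum_congr rfl fun i _ => by ring
  simp only [h]
  rw [Finset.sum_ite_eq, if_pos (Finset.mem_univ k)]

/-- The chain rule: differentiating in the second coordinates is the action of the transported
fields on functions of the first. The function `f` is first replaced by an extension of `a` composed
with the coordinate change, so that it is smooth. -/
theorem pd_eq_der_chartFrame {f : E4 → ℝ} {a : (overlap e e').smooth}
    (h : ∀ u : (overlap e e').carrier, f (coordChange e e' u) = (overlap e e').eval u a)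
    (i : Fin 4) (u : (overlap e e').carrier) : pd i f (coordChange e e' u) =
      (overlap e e').eval u ((isMetric_coeff he g).leviCivita.der (chartFrame he he' i) a) := by
  have h1 : pd i f (coordChange e e' u) =
      pd i (fun z => (overlap e e').ext a (coordChange e' e z)) (coordChange e e' u) := by
    refine (overlap e' e).pd_congr (fun z hz => ?_) i (coordChange_mem u.2)
    rw [(overlap e e').ext_apply a ⟨_, coordChange_mem hz⟩]
    have h2 := h ⟨_, coordChange_mem hz⟩
    rwa [coordChange_coordChange hz] at h2
  rw [h1, pd_comp he' he ((overlap e e').contDiffOn_ext a) i (coordChange_mem u.2),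
    coordChange_coordChange u.2, HalfOpen.IsMetric.der_apply, map_sum]
  rfl

/-- Functions and metric on the overlap of two charts, in the coordinates of the second one. -/
noncomputable def chartRealization : Realization ((isMetric_coeff he g).leviCivita.withFrame
    (chartFrame he he') (chartDual he he' g) (met_chartFrame_chartDual he he' g)
    (sum_chartDual he he' g)) (coeff g e') (overlap e e').carrier where
  pt u := coordChange e e' u
  ev := (overlap e e').eval
  pd_eq f a h i u := pd_eq_der_chartFrame he he' g h i u
  metric_eq i j u := by
    rw [coeff_transform he' he g (coordChange_mem u.2), coordChange_coordChange u.2]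
    have h := (isMetric_coeff he g).met_apply (chartFrame he he' i) (chartFrame he he' j)
    refine Eq.trans ?_ (congrArg ((overlap e e').eval u) h).symm
    simp only [map_sum, map_mul]
    refine Finset.sum_congr rfl fun k _ => Finset.sum_congr rfl fun l _ => ?_
    rw [mul_right_comm]
    rfl
  nab_comm i j := by
    -- The transported coordinate fields commute because second partial derivatives in the second
    -- coordinates do.
    refine (isMetric_coeff he g).nab_comm_of_der_comm fun k => ?_
    have h : ∀ i j : Fin 4, ∀ u, (overlap e e').eval u
        ((isMetric_coeff he g).leviCivita.der (chartFrame he he' i) (chartFrame he he' j k)) =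
        pd i (pd j fun z => coordChange e' e z k) (coordChange e e' u) := fun i j u =>
      (pd_eq_der_chartFrame he he' g (fun _ => rfl) i u).symm
    apply HalfOpen.eval_ext
    intro u
    refine (h i j u).trans (Eq.trans ?_ (h j i u).symm)
    exact (overlap e' e).pd_comm (contDiffOn_coordChange_apply he' he k) i j (coordChange_mem u.2)

include he he' in
theorem tensorS_coordChange (s : ℤˣ) (a b : Fin 3) {y : E4} (hy : y ∈ (overlap e e').carrier)
    (hy0 : y 0 = 0) : tensorS s (coeff g e) a b y = ∑ p : Fin 3, ∑ q : Fin 3,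
      jac e e' p.succ a.succ y * jac e e' q.succ b.succ y *
        tensorS s (coeff g e') p q (coordChange e e' y) := by
  have hG := isMetric_coeff (e' := e') he g
  have hJ : ∀ i j : Fin 4, hG.leviCivita.met (hG.leviCivita.fr j) (chartDual he he' g i) =
      jacSmooth he he' i j := by
    intro i j
    rw [met_chartDual]
    simp only [HalfOpen.IsMetric.fr_apply, mul_ite, mul_one, mul_zero]
    rw [Finset.sum_ite_eq', if_pos (Finset.mem_univ j)]
  obtain ⟨c, hc, hcs⟩ := hG.exists_normal s
  obtain ⟨c', hc', hcs'⟩ := HalfOpen.exists_normal (chartRealization he he' g)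
    (fun _ h t => (overlap e e').exists_div_sqrt h t) (fun _ _ h => (overlap e e').eval_ext h)
    (fun u => (isMetric_coeff (e' := e) he' g).posDef _ (coordChange_mem u.2)) s
  have h := Realization.tensorS_transform hG.realization (chartRealization he he' g) rfl hc hcs
    hc' hcs' {u | u.1 0 = 0} ?_ ?_ ?_ a b (u := ⟨y, hy⟩) hy0
  · refine h.trans ?_
    simp only [hJ]
    rfl
  · intro f hf a u hu
    rw [hG.der_fr]
    refine (overlap e e').pd_succ_eq_zero ((overlap e e').contDiffOn_ext f)
      (fun z hz hz0 => ?_) a u.2 hu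
    rw [(overlap e e').ext_apply f ⟨z, hz⟩]
    exact hf ⟨z, hz⟩ hz0
  · intro u hu a
    rw [hJ]
    exact jac_zero_succ he he' a u.2 hu
  · intro u hu
    rw [hJ]
    exact jac_zero_zero_pos he he' u.2 hu

end BoundaryTensor

/-! ### The theorem on the manifold. -/

namespace BoundaryTensor

variable {X : Type*} [TopologicalSpace X] [ChartedSpace H4 X] [IsManifold (𝓡∂ 4) ∞ X]

theorem secondFF_coeff_eq_zero {g : Metric4 X} {s : ℤˣ} (h : TotallyGeodesicBoundary s g)
    {e : OpenPartialHomeomorph X H4} (he : e ∈ IsManifold.maximalAtlas (𝓡∂ 4) ∞ X) {y : E4}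
    (hy : y ∈ (overlap e e).carrier) (hy0 : y 0 = 0) (a b : Fin 3) :
    secondFF s (coeff g e) a b y = 0 := by
  have h1 := h e he _ (symm_mem_source_self hy) ((symm_mem_boundary_iff he hy).2 hy0) a b
  rwa [(e.extend (𝓡∂ 4)).right_inv (overlap_subset hy)] at h1

theorem contDiffOn_comp_symm {φ : X → ℝ} (hφ : ContMDiff (𝓡∂ 4) 𝓘(ℝ, ℝ) ∞ φ)
    {e e' : OpenPartialHomeomorph X H4} (he : e ∈ IsManifold.maximalAtlas (𝓡∂ 4) ∞ X) :
    ContDiffOn ℝ ∞ (fun y => φ ((e.extend (𝓡∂ 4)).symm y)) (overlap e e').carrier :=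
  contMDiffOn_iff_contDiffOn.1 (hφ.comp_contMDiffOn (contMDiffOn_symm he))

end BoundaryTensor

theorem lemma2p1 {X : Type*} [TopologicalSpace X] [ChartedSpace BoundaryTensor.H4 X]
    [IsManifold (𝓡∂ 4) ∞ X] (g : BoundaryTensor.Metric4 X) (s : ℤˣ) :
    -- `S` is a 2-tensor on the boundary: its components transform covariantly
    (∀ e ∈ IsManifold.maximalAtlas (𝓡∂ 4) ∞ X, ∀ e' ∈ IsManifold.maximalAtlas (𝓡∂ 4) ∞ X,
      ∀ p ∈ e.source ∩ e'.source, p ∈ (𝓡∂ 4).boundary X → ∀ a b : Fin 3,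
        BoundaryTensor.S s g e a b p =
          ∑ c : Fin 3, ∑ d : Fin 3,
            BoundaryTensor.jac e e' c.succ a.succ (e.extend (𝓡∂ 4) p) *
            BoundaryTensor.jac e e' d.succ b.succ (e.extend (𝓡∂ 4) p) *
            BoundaryTensor.S s g e' c d p) ∧
    -- in every chart, at every boundary point:
    (∀ e ∈ IsManifold.maximalAtlas (𝓡∂ 4) ∞ X,
      ∀ p ∈ e.source, p ∈ (𝓡∂ 4).boundary X →
        -- `S` is symmetric
        (∀ a b : Fin 3, BoundaryTensor.S s g e a b p = BoundaryTensor.S s g e b a p) ∧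
        -- `S` is trace-free
        (∑ a : Fin 3, ∑ b : Fin 3,
          (BoundaryTensor.bmetric (BoundaryTensor.coeff g e) (e.extend (𝓡∂ 4) p))⁻¹ a b *
            BoundaryTensor.S s g e a b p = 0) ∧
        -- `S(φ² g) = φ⁻¹ S(g)`
        (∀ (φ : X → ℝ) (hφ : ContMDiff (𝓡∂ 4) 𝓘(ℝ, ℝ) ∞ φ) (hpos : ∀ x, 0 < φ x),
          ∀ a b : Fin 3, BoundaryTensor.S s (BoundaryTensor.conformal g φ hφ hpos) e a b p =
            (φ p)⁻¹ * BoundaryTensor.S s g e a b p) ∧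
        -- the explicit formula (in any boundary chart, in particular in Fermi coordinates)
        (∀ a b : Fin 3, BoundaryTensor.S s g e a b p =
          BoundaryTensor.explicitS s (BoundaryTensor.coeff g e) a b (e.extend (𝓡∂ 4) p)) ∧
        -- the totally geodesic case
        (BoundaryTensor.TotallyGeodesicBoundary s g → ∀ a b : Fin 3,
          BoundaryTensor.S s g e a b p =
              BoundaryTensor.dA_tt_n s (BoundaryTensor.coeff g e) a b (e.extend (𝓡∂ 4) p) ∧
          BoundaryTensor.dA_tt_n s (BoundaryTensor.coeff g e) a b (e.extend (𝓡∂ 4) p) =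
            (1 / 2) * BoundaryTensor.dRic_tt_n s (BoundaryTensor.coeff g e) a b
                (e.extend (𝓡∂ 4) p)
              - BoundaryTensor.dScal_n s (BoundaryTensor.coeff g e) (e.extend (𝓡∂ 4) p) / 12 *
                BoundaryTensor.coeff g e (e.extend (𝓡∂ 4) p) a.succ b.succ)) := by
  refine ⟨fun e he e' he' p hp hpb a b => ?_, fun e he p hp hpb => ?_⟩
  · have h := BoundaryTensor.tensorS_coordChange he he' g s a b
      (BoundaryTensor.extend_mem_overlap hp.1 hp.2) ((BoundaryTensor.mem_boundary_iff he hp.1).1 hpb)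
    rw [BoundaryTensor.coordChange_extend hp.1] at h
    exact h
  · have hG := BoundaryTensor.isMetric_coeff (e' := e) he g
    -- The overlap of a chart with itself is its whole image, so single-chart statements are
    -- instances of those on overlaps.
    have hy := BoundaryTensor.extend_mem_overlap hp hp
    have hy0 := (BoundaryTensor.mem_boundary_iff he hp).1 hpb
    refine ⟨fun a b => hG.tensorS_symm s a b hy, hG.sum_tensorS s hy, fun φ hφ hpos a b => ?_,
      fun a b => hG.tensorS_eq_explicitS s a b hy, fun hL a b => ⟨hG.tensorS_eq_dA_tt_n s
        (fun y hy hy0 => BoundaryTensor.secondFF_coeff_eq_zero hL he hy hy0) a b hy hy0,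
        hG.dA_tt_n_eq s a b hy⟩⟩
    -- The coefficients of φ²g in the chart are, by definition, f² times those of g, with f the
    -- coordinate expression of φ.
    have h := hG.tensorS_smul s (BoundaryTensor.contDiffOn_comp_symm hφ he)
      (fun y _ => hpos _) a b hy
    rw [e.extend_left_inv hp] at h
    exact h
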